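/- **Setting.** Let $T\ge 1$, $\omega$ a primitive $T$-th root of unity, and let $\Pi=\langle \mathsf s,\mathsf t\mid \mathsf s^T=\mathsf t^2=(\mathsf s\mathsf t)^2=1\rangle$ act on $\mathbb P^1$ by $\mathsf s\cdot x=\omega x$, $\mathsf t\cdot x=\bar x$. Let $\mathfrak g$ be a finite-dimensional complex Lie algebra with an automorphism $\sigma$, $\sigma^T=1$, an anti-linear involutive automorphism $\tau$ preserving each eigenspace of $\sigma$, and a non-degenerate invariant symmetric bilinear form $\langle\cdot,\cdot\rangle$ with $\langle\sigma x,\sigma y\rangle=\langle x,y\rangle$, $\langle\tau x,\tau y\rangle=\overline{\langle x,y\rangle}$. Let $\tilde{\mathfrak g}=\mathfrak g\otimes\mathbb C[t,t^{-1}]\oplus\mathbb C\mathsf K\oplus\mathbb C\mathsf D$ with $x_n=x\otimes t^n$, $\mathsf K$ central, $[x_m,y_n]=[x,y]_{m+n}+m\delta_{m+n,0}\langle x,y\rangle\mathsf K$, $[\mathsf D,x_n]=n x_n$, with the form $(x_m|y_n)=\delta_{m+n,0}\langle x,y\rangle$, $(\mathsf K|\mathsf D)=1$ (the other pairings vanish),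 and with $\sigma x_n=(\sigma x)_n$, $\sigma\mathsf K=\mathsf K$, $\sigma\mathsf D=\mathsf D$, $\tau x_n=(\tau x)_{-n}$, $\tau\mathsf K=-\mathsf K$, $\tau\mathsf D=-\mathsf D$. Put $\mathsf F_n=\mathfrak g\otimes t^n\mathbb C[t]$, $\bar{\mathsf F}_n=\tau\mathsf F_n$. Let $\boldsymbol z\subset\mathbb P^1$ be a finite set containing $\infty$ whose points lie in distinct $\Pi$-orbits, with multiplicities $n_x\ge1$, $x\in\boldsymbol z$. For $x\in\boldsymbol z$ let $\Pi_x$ be its stabiliser; $\Pi$ acts on $\tilde{\mathfrak g}\otimes\mathbb C[\varepsilon]/\varepsilon^{n_x}$ by $\mathsf s(X\varepsilon^p)=\omega^{-p}\sigma X\,\varepsilon^p$ ($\omega^{p}\sigma X\,\varepsilon^p$ if $x=\infty$) and $\mathsf t(X\varepsilon^p)=\tau X\,\varepsilon^p$. Let $\tilde{\mathfrak g}^{\mathcal D}$ be the real Lie algebra which is the direct sum over $x\in\boldsymbol z$ of the $\Pi_x$-invariants, without constant terms ($p\ge1$) at $x=\infty$; let $\tilde{\mathfrak g}^{\mathcal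 D}_{\mathbb C}$ be its complexification and $c$ the complex conjugation of the latter. Let $\pi_{x}$ be the average over $\Pi_x$. Define the complex linear map $X\mapsto X^{(x)}_p=\nu_x\big(\pi_x(X\varepsilon^p)\otimes1-\pi_x(iX\varepsilon^p)\otimes i\big)\in\tilde{\mathfrak g}^{\mathcal D}_{\mathbb C}$, with $\nu_x=\frac12$ if $\Pi_x$ is trivial and $\nu_x=1$ otherwise (zero for $p\ge n_x$, and for $p=0$ if $x=\infty$). Let $\boldsymbol z_{\rm c}$ be the set of $x\in\boldsymbol z$ with trivial stabiliser and put $X^{(\bar x)}_p=c(X^{(x)}_p)$ for these. Let $\mathsf F_n(\tilde{\mathfrak g}^{\mathcal D}_{\mathbb C})$ be spanned by the $X^{(x)}_p$, $X\in\mathsf F_n$, and the $X^{(\bar x)}_p$, $X\in\bar{\mathsf F}_n$. The algebra $\hat S$ of formal observables is the completion of the Poisson algebra $S=S(\tilde{\mathfrak g}^{\mathcal D}_{\mathbb C})$ with respect to the ideals $\mathsf F_n(\tilde{\mathfrak g}^{\mathcal D}_{\mathbb C})S\cap c(\mathsf F_n(\tilde{\mathfrak g}^{\mathcal D}_{\mathbb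 C}))S$, with the continuously extended Poisson bracket $\{\cdot,\cdot\}$. The space $\mathfrak F$ of formal fields is the completion of $\tilde{\mathfrak g}\otimes\tilde{\mathfrak g}^{\mathcal D}_{\mathbb C}$ with respect to $\mathsf F_n\otimes c(\mathsf F_n(\tilde{\mathfrak g}^{\mathcal D}_{\mathbb C}))+\bar{\mathsf F}_n\otimes\mathsf F_n(\tilde{\mathfrak g}^{\mathcal D}_{\mathbb C})$; $\sigma$ acts on it through the first factor, and $(X\otimes Z\,|\,Y\otimes W)=(X|Y)ZW$ extends to a bilinear map $\mathfrak F\times\mathfrak F\to\hat S$. With $I_{\tilde a}\otimes I^{\tilde a}=\mathsf D\otimes\mathsf K+\mathsf K\otimes\mathsf D+\sum_{n\in\mathbb Z}\sum_a (I_a)_{-n}\otimes (I^a)_n$, where $(I_a)$, $(I^a)$ are dual bases of $\mathfrak g$, put $\mathcal A^x_p=I_{\tilde a}\otimes (I^{\tilde a})^{(x)}_p$ for $x\in\boldsymbol z$ and $\mathcal A^{\bar x}_p=\tau I_{\tilde a}\otimes (I^{\tilde a})^{(\bar x)}_p$ for $x\in\boldsymbol z_{\rm c}$; $\mathcal A^0_p=0$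 if $0\notin\boldsymbol z$. Let $\boldsymbol{\mathcal Z}'=(\boldsymbol z\cup\bar{\boldsymbol z}_{\rm c})\setminus\{0,\infty\}$. The formal quadratic Gaudin Hamiltonians are the elements of $\hat S$ $$\mathcal H^x_p=\sum_{\substack{0\le\ell<T,\ y\in\boldsymbol{\mathcal Z}'\cup\{0\}\\(\ell,y)\ne(0,x)}}\sum_{q,s\ge0}\binom{q+s}{s}(-1)^s\frac{\omega^{\ell q}(\mathcal A^x_{p+s}|\sigma^\ell\mathcal A^y_q)}{(x-\omega^\ell y)^{q+s+1}}-T\sum_{q,s\ge0}\binom qs x^{q-s}(\mathcal A^x_{p+s}|\mathcal A^\infty_{q+1})+\tfrac12\sum_{q=0}^{p-1}(\mathcal A^x_q|\mathcal A^x_{p-q-1})$$ for $x\in\boldsymbol{\mathcal Z}'$, $p\ge0$, $$\mathcal H^0_p=\sum_{x\in\boldsymbol{\mathcal Z}'}\sum_{q,s\ge0}(-1)^{q+1}\binom{q+s}{s}\frac{(\mathcal A^0_{p+s}|\mathcal A^x_q)}{x^{q+s+1}}-\sum_{q\ge0}(\mathcal A^0_{p+q}|\mathcal A^\infty_{q+1})+\tfrac12\sum_{q=0}^{p-1}(\mathcal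 A^0_{p-q-1}|\mathcal A^0_q),$$ $$\mathcal H^\infty_q=-\sum_{x\in\boldsymbol{\mathcal Z}'}\sum_{p,s\ge0}\binom sp x^{s-p}(\mathcal A^x_p|\mathcal A^\infty_{q+s+2})-\sum_{p\ge0}(\mathcal A^0_p|\mathcal A^\infty_{q+p+2})+\tfrac12\sum_{p=0}^q(\mathcal A^\infty_{p+1}|\mathcal A^\infty_{q-p+1})$$ for $p,q\ge 0$ (of these, the ones with $p\equiv1$, respectively $q+2\equiv0$, modulo $T$ are the coefficients of the generating function of the Hamiltonians). The formal momentum is $\mathcal P=-i\sum_{x\in\boldsymbol z\setminus\{\infty\}}\mathsf D^{(x)}_0+i\sum_{x\in\boldsymbol z_{\rm c}}\mathsf D^{(\bar x)}_0$. The constraints are $\mathcal K$, defined by the same formula with $\mathsf K$ for $\mathsf D$, and $$\mathcal C^\alpha_n=\sum_{x\in\boldsymbol z\setminus\{\infty\}}(I^{(0,\alpha)}_n)^{(x)}_0+\sum_{x\in\boldsymbol z_{\rm c}}(I^{(0,\alpha)}_{-n})^{(\bar x)}_0,\qquad n\in\mathbb Z,$$ where $(I^{(0,\alpha)})_\alpha$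 is a basis of the real space $\{y\in\mathfrak g:\sigma y=\tau y=y\}$. Let $J_{\mathcal C}\subset S$ be the ideal generated by the constraints, $\hat J_{\mathcal C}\subset\hat S$ its completion (the inverse limit of its images in the quotients of $S$ by the ideals of the filtration), $N(\hat J_{\mathcal C})=\{X\in\hat S:\{X,\hat J_{\mathcal C}\}\subset\hat J_{\mathcal C}\}$, and $\hat S_{\rm red}=N(\hat J_{\mathcal C})/(\hat J_{\mathcal C}\cap N(\hat J_{\mathcal C}))$ the Hamiltonian reduction with its induced Poisson bracket. **Proposition.** Suppose $n_\infty=1$. Then $\mathcal P$ and all formal quadratic Gaudin Hamiltonians $\mathcal H^x_p$ ($x\in\boldsymbol{\mathcal Z}'$, $p\ge0$), $\mathcal H^0_p$ and $\mathcal H^\infty_q$ belong to $N(\hat J_{\mathcal C})$. Hence they have classes in $\hat S_{\rm red}$, and the classes of the Hamiltonians Poisson commute with that of $\mathcal P$. Moreover, every such Hamiltonian $\mathcal H$ satisfies $\{\mathcal H,\mathcal K\}=\{\mathcal H,\mathcal C^\alpha_n\}=\{\mathcal H,\mathcal P\}=0$ in $\hat S$ for all $\alpha$ and all $n\in\mathbb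 Z$, while $\{\mathcal P,\mathcal K\}=0$ and $\{\mathcal P,\mathcal C^\alpha_n\}=-i\,n\,\mathcal C^\alpha_n$. -/

import Mathlib

open scoped TensorProduct ComplexConjugate

set_option linter.unusedSectionVars false
set_option linter.unusedSimpArgs false
set_option linter.unnecessarySeqFocus false

noncomputable section

namespace DihedralGaudin

/-- The finite-dimensional data: a complex Lie algebra `𝔤` with an automorphism `σ` of order
dividing `T`, an anti-linear involutive automorphism `τ` stabilising every eigenspace of `σ`, and a
non-degenerate invariant symmetric bilinear form which is `σ`-invariant and is the complexification
of a real form on the fixed points of `τ` (that is, `⟨τ x, τ y⟩` is the conjugate of `⟨x, y⟩`). -/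
structure DihedralLie (T : ℕ) (𝔤 : Type*) [LieRing 𝔤] [LieAlgebra ℂ 𝔤] where
  ω : ℂ
  isPrimitiveRoot_ω : IsPrimitiveRoot ω T
  σ : 𝔤 →ₗ⁅ℂ⁆ 𝔤
  σ_iterate : ∀ x, σ^[T] x = x
  τ : 𝔤 →ₛₗ[starRingEnd ℂ] 𝔤
  τ_lie : ∀ x y, τ ⁅x, y⁆ = ⁅τ x, τ y⁆
  τ_τ : ∀ x, τ (τ x) = x
  τ_eigen : ∀ (j : ℕ) (x : 𝔤), σ x = ω ^ j • x → σ (τ x) = ω ^ j • τ x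
  form : LinearMap.BilinForm ℂ 𝔤
  form_symm : ∀ x y, form x y = form y x
  form_nondegenerate : form.Nondegenerate
  form_invariant : ∀ x y z, form ⁅x, y⁆ z = form x ⁅y, z⁆
  form_σ : ∀ x y, form (σ x) (σ y) = form x y
  form_τ : ∀ x y, form (τ x) (τ y) = conj (form x y)

/-! ### Loop algebra -/

section Loop

variable {𝔤 : Type*} [LieRing 𝔤] [LieAlgebra ℂ 𝔤]

/-- The bracket of `𝔤 ⊗ ℂ[t, t⁻¹]`; an element `∑ xₙ ⊗ tⁿ` is the finitely supported function
`n ↦ xₙ`. -/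
def loopBr : (ℤ →₀ 𝔤) →ₗ[ℂ] (ℤ →₀ 𝔤) →ₗ[ℂ] (ℤ →₀ 𝔤) :=
  Finsupp.lsum ℂ fun m => LinearMap.flip (Finsupp.lsum ℂ fun n => LinearMap.flip
    ((LieModule.toEnd ℂ 𝔤 𝔤 : 𝔤 →ₗ[ℂ] 𝔤 →ₗ[ℂ] 𝔤).compr₂ (Finsupp.lsingle (m + n))))

/-- The derivation `t d/dt`. -/
def loopDer : (ℤ →₀ 𝔤) →ₗ[ℂ] (ℤ →₀ 𝔤) :=
  Finsupp.lsum ℂ fun n => (n : ℂ) • Finsupp.lsingle n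

/-- The form `(xₘ, yₙ) ↦ ⟨x, y⟩ δ_{m+n,0}`. -/
def loopForm (κ : LinearMap.BilinForm ℂ 𝔤) : (ℤ →₀ 𝔤) →ₗ[ℂ] (ℤ →₀ 𝔤) →ₗ[ℂ] ℂ :=
  Finsupp.lsum ℂ fun m => LinearMap.flip (Finsupp.lsum ℂ fun n => LinearMap.flip
    (if m + n = 0 then κ else 0))

@[simp] theorem loopBr_single (m n : ℤ) (x y : 𝔤) :
    loopBr (Finsupp.single m x) (Finsupp.single n y) = Finsupp.single (m + n) ⁅x, y⁆ := by
  simp [loopBr]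

@[simp] theorem loopDer_single (n : ℤ) (x : 𝔤) :
    loopDer (Finsupp.single n x) = Finsupp.single n ((n : ℂ) • x) := by
  simp [loopDer]

@[simp] theorem loopForm_single (κ : LinearMap.BilinForm ℂ 𝔤) (m n : ℤ) (x y : 𝔤) :
    loopForm κ (Finsupp.single m x) (Finsupp.single n y) = if m + n = 0 then κ x y else 0 := by
  simp only [loopForm, Finsupp.lsum_single, LinearMap.flip_apply]
  split_ifs <;> simp

theorem loop_ind {P : (ℤ →₀ 𝔤) → Prop} (h0 : P 0) (ha : ∀ f g, P f → P g → P (f + g))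
    (hs : ∀ n x, P (Finsupp.single n x)) (f : ℤ →₀ 𝔤) : P f :=
  Finsupp.induction_linear f h0 ha hs

theorem loopBr_symm (f g : ℤ →₀ 𝔤) : loopBr f g = -loopBr g f := by
  induction f using loop_ind with
  | h0 => simp
  | ha f f' hf hf' => simp [hf, hf']; abel
  | hs m x =>
    induction g using loop_ind with
    | h0 => simp
    | ha f f' hf hf' => simp [hf, hf']; abel
    | hs n y =>
      rw [loopBr_single, loopBr_single, ← lie_skew, add_comm n m, Finsupp.single_neg]

theorem loopBr_jacobi (f g h : ℤ →₀ 𝔤) :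
    loopBr f (loopBr g h) = loopBr (loopBr f g) h + loopBr g (loopBr f h) := by
  induction f using loop_ind with
  | h0 => simp
  | ha f f' hf hf' => simp [hf, hf']; abel
  | hs m x =>
    induction g using loop_ind with
    | h0 => simp
    | ha f f' hf hf' => simp [hf, hf']; abel
    | hs n y =>
      induction h using loop_ind with
      | h0 => simp
      | ha f f' hf hf' => simp [hf, hf']; abel
      | hs k z =>
        simp only [loopBr_single]
        rw [leibniz_lie x y z, Finsupp.single_add, add_assoc, add_left_comm n m k]

theorem loopDer_loopBr (f g : ℤ →₀ 𝔤) :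
    loopDer (loopBr f g) = loopBr (loopDer f) g + loopBr f (loopDer g) := by
  induction f using loop_ind with
  | h0 => simp
  | ha f f' hf hf' => simp [hf, hf']; abel
  | hs m x =>
    induction g using loop_ind with
    | h0 => simp
    | ha f f' hf hf' => simp [hf, hf']; abel
    | hs n y =>
      simp only [loopBr_single, loopDer_single, smul_lie, lie_smul]
      rw [← Finsupp.single_add, ← add_smul]
      push_cast
      rfl

theorem loopForm_symm {κ : LinearMap.BilinForm ℂ 𝔤} (hκ : ∀ x y, κ x y = κ y x)
    (f g : ℤ →₀ 𝔤) : loopForm κ f g = loopForm κ g f := by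
  induction f using loop_ind with
  | h0 => simp
  | ha f f' hf hf' => simp [hf, hf']
  | hs m x =>
    induction g using loop_ind with
    | h0 => simp
    | ha f f' hf hf' => simp [hf, hf']
    | hs n y => rw [loopForm_single, loopForm_single, add_comm n m, hκ x y]

theorem loopForm_loopDer {κ : LinearMap.BilinForm ℂ 𝔤}
    (f g : ℤ →₀ 𝔤) : loopForm κ (loopDer f) g = -loopForm κ f (loopDer g) := by
  induction f using loop_ind with
  | h0 => simp
  | ha f f' hf hf' => simp only [map_add, LinearMap.add_apply, hf, hf', neg_add]
  | hs m x =>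
    induction g using loop_ind with
    | h0 => simp
    | ha f f' hf hf' => simp only [map_add, hf, hf', neg_add]
    | hs n y =>
      simp only [loopDer_single, loopForm_single]
      split_ifs with h
      · have : m = -n := by omega
        subst this
        simp
      · simp

theorem loopForm_invariant {κ : LinearMap.BilinForm ℂ 𝔤}
    (hκ : ∀ x y z, κ ⁅x, y⁆ z = κ x ⁅y, z⁆) (f g h : ℤ →₀ 𝔤) :
    loopForm κ (loopBr f g) h = loopForm κ f (loopBr g h) := by
  induction f using loop_ind with
  | h0 => simp
  | ha f f' hf hf' => simp [hf, hf']
  | hs m x =>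
    induction g using loop_ind with
    | h0 => simp
    | ha f f' hf hf' => simp [hf, hf']
    | hs n y =>
      induction h using loop_ind with
      | h0 => simp
      | ha f f' hf hf' => simp only [map_add, hf, hf']
      | hs k z => simp [hκ, add_assoc]

end Loop

/-! ### The affine Kac-Moody algebra -/

namespace DihedralLie

variable {T : ℕ} {𝔤 : Type*} [LieRing 𝔤] [LieAlgebra ℂ 𝔤] (D : DihedralLie T 𝔤)

/-- The untwisted affine Kac-Moody algebra `𝔤 ⊗ ℂ[t, t⁻¹] ⊕ ℂ K ⊕ ℂ D` as a vector space. -/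
def Affine (_ : DihedralLie T 𝔤) : Type _ := (ℤ →₀ 𝔤) × ℂ × ℂ

instance : AddCommGroup D.Affine := inferInstanceAs (AddCommGroup ((ℤ →₀ 𝔤) × ℂ × ℂ))

instance : Module ℂ D.Affine := inferInstanceAs (Module ℂ ((ℤ →₀ 𝔤) × ℂ × ℂ))

/-- The element with loop part `f`, component `a` along `K` and component `d` along `D`. -/
def mkA (f : ℤ →₀ 𝔤) (a d : ℂ) : D.Affine := (f, a, d)

/-- The element `xₙ = x ⊗ tⁿ`. -/
def mon (n : ℤ) (x : 𝔤) : D.Affine := D.mkA (Finsupp.single n x) 0 0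

/-- The central element. -/
def K : D.Affine := D.mkA 0 1 0

/-- The derivation element. -/
def Dd : D.Affine := D.mkA 0 0 1

instance : Bracket D.Affine D.Affine where
  bracket X Y := D.mkA (loopBr X.1 Y.1 + X.2.2 • loopDer Y.1 - Y.2.2 • loopDer X.1)
    (loopForm D.form (loopDer X.1) Y.1) 0

@[simp] theorem mkA_fst (f : ℤ →₀ 𝔤) (a d : ℂ) : (D.mkA f a d).1 = f := rfl
@[simp] theorem mkA_k (f : ℤ →₀ 𝔤) (a d : ℂ) : (D.mkA f a d).2.1 = a := rfl
@[simp] theorem mkA_d (f : ℤ →₀ 𝔤) (a d : ℂ) : (D.mkA f a d).2.2 = d := rfl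

theorem affine_ext {X Y : D.Affine} (h1 : X.1 = Y.1) (h2 : X.2.1 = Y.2.1)
    (h3 : X.2.2 = Y.2.2) : X = Y := Prod.ext h1 (Prod.ext h2 h3)

@[simp] theorem add_fst (X Y : D.Affine) : (X + Y).1 = X.1 + Y.1 := rfl
@[simp] theorem add_k (X Y : D.Affine) : (X + Y).2.1 = X.2.1 + Y.2.1 := rfl
@[simp] theorem add_d (X Y : D.Affine) : (X + Y).2.2 = X.2.2 + Y.2.2 := rfl
@[simp] theorem smul_fst (a : ℂ) (X : D.Affine) : (a • X).1 = a • X.1 := rfl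
@[simp] theorem smul_k (a : ℂ) (X : D.Affine) : (a • X).2.1 = a • X.2.1 := rfl
@[simp] theorem smul_d (a : ℂ) (X : D.Affine) : (a • X).2.2 = a • X.2.2 := rfl
@[simp] theorem zero_fst : (0 : D.Affine).1 = 0 := rfl
@[simp] theorem zero_k : (0 : D.Affine).2.1 = 0 := rfl
@[simp] theorem zero_d : (0 : D.Affine).2.2 = 0 := rfl
@[simp] theorem neg_fst (X : D.Affine) : (-X).1 = -X.1 := rfl
@[simp] theorem neg_k (X : D.Affine) : (-X).2.1 = -X.2.1 := rfl
@[simp] theorem neg_d (X : D.Affine) : (-X).2.2 = -X.2.2 := rfl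
@[simp] theorem lie_fst (X Y : D.Affine) :
    ⁅X, Y⁆.1 = loopBr X.1 Y.1 + X.2.2 • loopDer Y.1 - Y.2.2 • loopDer X.1 := rfl
@[simp] theorem lie_k (X Y : D.Affine) :
    ⁅X, Y⁆.2.1 = loopForm D.form (loopDer X.1) Y.1 := rfl
@[simp] theorem lie_d (X Y : D.Affine) : ⁅X, Y⁆.2.2 = 0 := rfl

instance : LieRing D.Affine where
  add_lie X Y Z := by
    apply affine_ext
    · simp [add_smul, smul_add]; abel
    · simp
    · simp
  lie_add X Y Z := by
    apply affine_ext
    · simp [add_smul, smul_add]; abel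
    · simp
    · simp
  lie_self X := by
    apply affine_ext
    · have h := loopBr_symm X.1 X.1
      rw [eq_neg_iff_add_eq_zero, ← two_nsmul] at h
      have h' : (2 : ℂ) • loopBr X.1 X.1 = 0 := by rw [← h, two_smul, two_nsmul]
      simpa using h'
    · have h := loopForm_loopDer (κ := D.form) X.1 X.1
      rw [loopForm_symm D.form_symm X.1] at h
      simpa [self_eq_neg] using h
    · simp
  leibniz_lie X Y Z := by
    apply affine_ext
    · have h1 := loopBr_jacobi X.1 Y.1 Z.1
      have h2 := loopDer_loopBr Y.1 Z.1
      have h3 := loopDer_loopBr X.1 Y.1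
      have h4 := loopDer_loopBr X.1 Z.1
      have h5 := loopBr_symm (loopDer Y.1) X.1
      have h6 := loopBr_symm (loopDer X.1) Y.1
      simp only [lie_fst, lie_d, add_fst, map_add, map_sub, map_smul, LinearMap.add_apply,
        LinearMap.sub_apply, LinearMap.smul_apply, smul_add, smul_sub, h1, h2, h3, h4, h5, h6,
        zero_smul]
      simp only [smul_smul, mul_comm Y.2.2 X.2.2, mul_comm Z.2.2 X.2.2, mul_comm Z.2.2 Y.2.2,
        smul_neg]
      abel
    · have h3 := loopDer_loopBr X.1 Y.1
      have e1 := loopForm_invariant D.form_invariant (loopDer X.1) Y.1 Z.1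
      have e2 := loopForm_invariant D.form_invariant (loopDer Y.1) X.1 Z.1
      have e3 := loopBr_symm (loopDer Y.1) X.1
      have e4 := loopForm_loopDer (κ := D.form) (loopDer X.1) Z.1
      have e5 := loopForm_loopDer (κ := D.form) (loopDer Y.1) Z.1
      have e6 := loopForm_loopDer (κ := D.form) (loopDer X.1) Y.1
      have e7 := loopForm_symm D.form_symm (loopDer Y.1) (loopDer X.1)
      rw [e3] at e2
      simp only [map_neg, LinearMap.neg_apply] at e2
      simp only [lie_k, lie_fst, lie_d, add_k, map_add, map_sub, map_smul, LinearMap.add_apply,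
        LinearMap.sub_apply, LinearMap.smul_apply, smul_eq_mul, h3, ← e1, ← e2, e4, e5, e7]
      ring
    · simp

instance : LieAlgebra ℂ D.Affine where
  lie_smul a X Y := by
    apply affine_ext
    · simp [smul_sub, smul_smul, mul_comm]
    · simp
    · simp

/-- The invariant form of the affine Kac-Moody algebra. -/
def aform : D.Affine →ₗ[ℂ] D.Affine →ₗ[ℂ] ℂ :=
  LinearMap.mk₂ ℂ (fun X Y => loopForm D.form X.1 Y.1 + X.2.1 * Y.2.2 + X.2.2 * Y.2.1)
    (fun X Y Z => by simp; ring) (fun a X Y => by simp; ring)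
    (fun X Y Z => by simp; ring) (fun a X Y => by simp; ring)

/-- The extension of `σ` to the affine algebra: `xₙ ↦ (σ x)ₙ`, `K ↦ K`, `D ↦ D`. -/
def σa : D.Affine →ₗ[ℂ] D.Affine where
  toFun X := D.mkA (Finsupp.mapRange.linearMap (D.σ : 𝔤 →ₗ[ℂ] 𝔤) X.1) X.2.1 X.2.2
  map_add' X Y := by
    apply affine_ext
    · simp only [mkA_fst, add_fst, map_add]
    · rfl
    · rfl
  map_smul' a X := by
    apply affine_ext
    · simp only [mkA_fst, smul_fst, map_smul, RingHom.id_apply]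
    · rfl
    · rfl

/-- The extension of `τ` to the affine algebra: `xₙ ↦ (τ x)₋ₙ`, `K ↦ -K`, `D ↦ -D`, anti-linearly. -/
def τa : D.Affine →ₛₗ[starRingEnd ℂ] D.Affine where
  toFun X := D.mkA (Finsupp.lmapDomain 𝔤 ℂ (fun n : ℤ => -n) (Finsupp.mapRange.linearMap D.τ X.1))
    (-conj X.2.1) (-conj X.2.2)
  map_add' X Y := by
    apply affine_ext
    · simp only [mkA_fst, add_fst, map_add]
    · simp; ring
    · simp; ring
  map_smul' a X := by
    apply affine_ext
    · simp only [mkA_fst, smul_fst, map_smulₛₗ, RingHom.id_apply]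
    · simp
    · simp

/-- For `e = 1` this is `F_n = 𝔤 ⊗ tⁿ ℂ[t]` and for `e = -1` it is the conjugate filtration
`𝔤 ⊗ t⁻ⁿ ℂ[t⁻¹]`. -/
def F (e : ℤ) (n : ℕ) : Submodule ℂ D.Affine :=
  Submodule.span ℂ {X | ∃ (m : ℕ) (x : 𝔤), n ≤ m ∧ X = D.mon (e * m) x}

theorem affine_ind {P : D.Affine → Prop} (hm : ∀ n x, P (D.mon n x)) (hK : P D.K) (hD : P D.Dd)
    (ha : ∀ X Y, P X → P Y → P (X + Y)) (hs : ∀ (a : ℂ) X, P X → P (a • X)) (X : D.Affine) :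
    P X := by
  have h1 : ∀ f : ℤ →₀ 𝔤, P (D.mkA f 0 0) := by
    intro f
    induction f using loop_ind with
    | h0 =>
      have := hs 0 _ hK
      rwa [zero_smul] at this
    | ha f g hf hg =>
      have := ha _ _ hf hg
      have e : D.mkA f 0 0 + D.mkA g 0 0 = D.mkA (f + g) 0 0 := by
        apply affine_ext <;> simp
      rwa [e] at this
    | hs n x => exact hm n x
  have e : X = D.mkA X.1 0 0 + X.2.1 • D.K + X.2.2 • D.Dd := by
    apply affine_ext <;> simp [K, Dd]
  rw [e]
  exact ha _ _ (ha _ _ (h1 _) (hs _ _ hK)) (hs _ _ hD)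

theorem lie_mon_mon (m n : ℤ) (x y : 𝔤) : ⁅D.mon m x, D.mon n y⁆ =
    D.mon (m + n) ⁅x, y⁆ + (if m + n = 0 then (m : ℂ) * D.form x y else 0) • D.K := by
  split_ifs with h
  · apply affine_ext <;> simp [mon, K, h]
  · apply affine_ext <;> simp [mon, K, h]

theorem K_lie (X : D.Affine) : ⁅D.K, X⁆ = 0 := by
  apply affine_ext <;> simp [K]

theorem Dd_lie_mon (n : ℤ) (x : 𝔤) : ⁅D.Dd, D.mon n x⁆ = (n : ℂ) • D.mon n x := by
  apply affine_ext <;> simp [Dd, mon]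

theorem σa_mon (n : ℤ) (x : 𝔤) : D.σa (D.mon n x) = D.mon n (D.σ x) := by
  apply affine_ext <;> simp [σa, mon]

theorem σa_K : D.σa D.K = D.K := by
  apply affine_ext <;> simp [σa, K]

theorem σa_Dd : D.σa D.Dd = D.Dd := by
  apply affine_ext <;> simp [σa, Dd]

theorem τa_mon (n : ℤ) (x : 𝔤) : D.τa (D.mon n x) = D.mon (-n) (D.τ x) := by
  apply affine_ext <;> simp [τa, mon, Finsupp.mapDomain_single]

theorem τa_K : D.τa D.K = -D.K := by
  apply affine_ext <;> simp [τa, K]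

theorem τa_Dd : D.τa D.Dd = -D.Dd := by
  apply affine_ext <;> simp [τa, Dd]

theorem F_anti {e : ℤ} {m n : ℕ} (h : m ≤ n) : D.F e n ≤ D.F e m :=
  Submodule.span_mono fun _ ⟨k, x, hk, hX⟩ => ⟨k, x, h.trans hk, hX⟩

theorem mon_mem_F {e : ℤ} {n : ℕ} (m : ℕ) (x : 𝔤) (h : n ≤ m) : D.mon (e * m) x ∈ D.F e n :=
  Submodule.subset_span ⟨m, x, h, rfl⟩

theorem lie_mem_F {e : ℤ} (he : e ≠ 0) {n : ℕ} {X Y : D.Affine} (hX : X ∈ D.F e n)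
    (hY : Y ∈ D.F e n) : ⁅X, Y⁆ ∈ D.F e n := by
  induction hX using Submodule.span_induction with
  | zero => simp
  | add X X' _ _ h h' => rw [add_lie]; exact add_mem h h'
  | smul a X _ h => rw [smul_lie]; exact Submodule.smul_mem _ _ h
  | mem X hX =>
    obtain ⟨k, x, hk, rfl⟩ := hX
    induction hY using Submodule.span_induction with
    | zero => simp
    | add X X' _ _ h h' => rw [lie_add]; exact add_mem h h'
    | smul a X _ h => rw [lie_smul]; exact Submodule.smul_mem _ _ h
    | mem Y hY =>
      obtain ⟨l, y, hl, rfl⟩ := hY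
      rw [lie_mon_mon, ← mul_add]
      refine add_mem ?_ ?_
      · exact_mod_cast D.mon_mem_F (k + l) _ (by omega)
      · have : (if e * ((k : ℤ) + l) = 0 then ((e * k : ℤ) : ℂ) * D.form x y else 0) = 0 := by
          split_ifs with h
          · have : (k : ℤ) = 0 := by
              rcases mul_eq_zero.1 h with h | h
              · exact absurd h he
              · omega
            simp [this]
          · rfl
        rw [this, zero_smul]
        exact zero_mem _

theorem exists_lie_mem_F {e : ℤ} (he : e = 1 ∨ e = -1) (X : D.Affine) :
    ∃ N, ∀ n, ∀ Y ∈ D.F e (n + N), ⁅X, Y⁆ ∈ D.F e n := by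
  induction X using D.affine_ind with
  | hm k x =>
    refine ⟨k.natAbs + 1, fun n Y hY => ?_⟩
    induction hY using Submodule.span_induction with
    | zero => simp
    | add X X' _ _ h h' => rw [lie_add]; exact add_mem h h'
    | smul a X _ h => rw [lie_smul]; exact Submodule.smul_mem _ _ h
    | mem Y hY =>
      obtain ⟨l, y, hl, rfl⟩ := hY
      have hne : k + e * l ≠ 0 := by rcases he with rfl | rfl <;> omega
      obtain ⟨j, hj, hj'⟩ : ∃ j : ℕ, k + e * l = e * j ∧ n ≤ j := by
        rcases he with rfl | rfl
        · exact ⟨(k + l).toNat, by omega, by omega⟩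
        · exact ⟨(l - k).toNat, by omega, by omega⟩
      rw [lie_mon_mon, if_neg hne, zero_smul, add_zero, hj]
      exact D.mon_mem_F _ _ hj'
  | hK => exact ⟨0, fun n Y _ => by rw [K_lie]; exact zero_mem _⟩
  | hD =>
    refine ⟨0, fun n Y hY => ?_⟩
    induction hY using Submodule.span_induction with
    | zero => simp
    | add X X' _ _ h h' => rw [lie_add]; exact add_mem h h'
    | smul a X _ h => rw [lie_smul]; exact Submodule.smul_mem _ _ h
    | mem Y hY =>
      obtain ⟨l, y, hl, rfl⟩ := hY
      rw [Dd_lie_mon]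
      exact Submodule.smul_mem _ _ (D.mon_mem_F _ _ hl)
  | ha X X' h h' =>
    obtain ⟨N, h⟩ := h
    obtain ⟨N', h'⟩ := h'
    refine ⟨N + N', fun n Y hY => ?_⟩
    rw [add_lie]
    exact add_mem (h n Y (D.F_anti (by omega) hY)) (h' n Y (D.F_anti (by omega) hY))
  | hs a X h =>
    obtain ⟨N, h⟩ := h
    exact ⟨N, fun n Y hY => by rw [smul_lie]; exact Submodule.smul_mem _ _ (h n Y hY)⟩

theorem σa_mem_F {e : ℤ} {n : ℕ} {X : D.Affine} (hX : X ∈ D.F e n) : D.σa X ∈ D.F e n := by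
  induction hX using Submodule.span_induction with
  | zero => simp
  | add X X' _ _ h h' => rw [map_add]; exact add_mem h h'
  | smul a X _ h => rw [map_smul]; exact Submodule.smul_mem _ _ h
  | mem Y hY =>
    obtain ⟨l, y, hl, rfl⟩ := hY
    rw [σa_mon]
    exact D.mon_mem_F _ _ hl

theorem τa_mem_F {e : ℤ} {n : ℕ} {X : D.Affine} (hX : X ∈ D.F e n) : D.τa X ∈ D.F (-e) n := by
  induction hX using Submodule.span_induction with
  | zero => simp
  | add X X' _ _ h h' => rw [map_add]; exact add_mem h h'
  | smul a X _ h => rw [map_smulₛₗ]; exact Submodule.smul_mem _ _ h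
  | mem Y hY =>
    obtain ⟨l, y, hl, rfl⟩ := hY
    rw [τa_mon, ← neg_mul]
    exact D.mon_mem_F _ _ hl

theorem aform_mon_mon (m n : ℤ) (x y : 𝔤) : D.aform (D.mon m x) (D.mon n y) =
    if m + n = 0 then D.form x y else 0 := by
  simp [aform, mon]

theorem aform_symm (X Y : D.Affine) : D.aform X Y = D.aform Y X := by
  simp only [aform, LinearMap.mk₂_apply]
  rw [loopForm_symm D.form_symm]
  ring

theorem aform_F_F {e : ℤ} (he : e ≠ 0) {n : ℕ} (hn : 1 ≤ n) {X Y : D.Affine} (hX : X ∈ D.F e n)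
    (hY : Y ∈ D.F e n) : D.aform X Y = 0 := by
  induction hX using Submodule.span_induction with
  | zero => simp
  | add X X' _ _ h h' => simp [h, h']
  | smul a X _ h => simp [h]
  | mem X hX =>
    obtain ⟨k, x, hk, rfl⟩ := hX
    induction hY using Submodule.span_induction with
    | zero => simp
    | add X X' _ _ h h' => simp [h, h']
    | smul a X _ h => simp [h]
    | mem Y hY =>
      obtain ⟨l, y, hl, rfl⟩ := hY
      rw [aform_mon_mon, if_neg]
      rw [← mul_add]
      exact mul_ne_zero he (by omega)

theorem exists_aform_F {e : ℤ} (he : e = 1 ∨ e = -1) (X : D.Affine) :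
    ∃ N, ∀ Y ∈ D.F e N, D.aform X Y = 0 := by
  induction X using D.affine_ind with
  | hm k x =>
    refine ⟨k.natAbs + 1, fun Y hY => ?_⟩
    induction hY using Submodule.span_induction with
    | zero => simp
    | add X X' _ _ h h' => simp [h, h']
    | smul a X _ h => simp [h]
    | mem Y hY =>
      obtain ⟨l, y, hl, rfl⟩ := hY
      rw [aform_mon_mon, if_neg]
      rcases he with rfl | rfl <;> omega
  | hK =>
    refine ⟨0, fun Y hY => ?_⟩
    induction hY using Submodule.span_induction with
    | zero => simp
    | add X X' _ _ h h' => simp [h, h']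
    | smul a X _ h => simp [h]
    | mem Y hY =>
      obtain ⟨l, y, hl, rfl⟩ := hY
      simp [aform, K, mon]
  | hD =>
    refine ⟨0, fun Y hY => ?_⟩
    induction hY using Submodule.span_induction with
    | zero => simp
    | add X X' _ _ h h' => simp [h, h']
    | smul a X _ h => simp [h]
    | mem Y hY =>
      obtain ⟨l, y, hl, rfl⟩ := hY
      simp [aform, Dd, mon]
  | ha X X' h h' =>
    obtain ⟨N, h⟩ := h
    obtain ⟨N', h'⟩ := h'
    refine ⟨N + N', fun Y hY => ?_⟩
    rw [map_add, LinearMap.add_apply, h Y (D.F_anti (by omega) hY),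
      h' Y (D.F_anti (by omega) hY), add_zero]
  | hs a X h =>
    obtain ⟨N, h⟩ := h
    exact ⟨N, fun Y hY => by rw [map_smul, LinearMap.smul_apply, h Y hY, smul_zero]⟩

theorem σa_lie (X Y : D.Affine) : D.σa ⁅X, Y⁆ = ⁅D.σa X, D.σa Y⁆ := by
  induction X using D.affine_ind with
  | ha X X' h h' => simp only [add_lie, map_add, h, h']
  | hs a X h => simp only [smul_lie, map_smul, h]
  | hK => simp [K_lie, σa_K]
  | hm m x =>
    induction Y using D.affine_ind with
    | ha X X' h h' => simp only [lie_add, map_add, h, h']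
    | hs a X h => simp only [lie_smul, map_smul, h]
    | hK => rw [← lie_skew, K_lie, σa_K, ← lie_skew, K_lie]; simp
    | hm n y => simp only [lie_mon_mon, σa_mon, map_add, map_smul, σa_K, D.form_σ, LieHom.map_lie]
    | hD =>
      rw [← lie_skew, Dd_lie_mon, σa_Dd, σa_mon, ← lie_skew, Dd_lie_mon, map_neg, map_smul, σa_mon]
  | hD =>
    induction Y using D.affine_ind with
    | ha X X' h h' => simp only [lie_add, map_add, h, h']
    | hs a X h => simp only [lie_smul, map_smul, h]
    | hK => rw [← lie_skew, K_lie, σa_K, ← lie_skew, K_lie]; simp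
    | hm n y => rw [Dd_lie_mon, σa_Dd, σa_mon, Dd_lie_mon, map_smul, σa_mon]
    | hD => simp [σa_Dd]

theorem τa_lie (X Y : D.Affine) : D.τa ⁅X, Y⁆ = ⁅D.τa X, D.τa Y⁆ := by
  induction X using D.affine_ind with
  | ha X X' h h' => simp only [add_lie, map_add, h, h']
  | hs a X h => simp only [smul_lie, map_smulₛₗ, h]
  | hK => simp [K_lie, τa_K]
  | hm m x =>
    induction Y using D.affine_ind with
    | ha X X' h h' => simp only [lie_add, map_add, h, h']
    | hs a X h => simp only [lie_smul, map_smulₛₗ, h]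
    | hK => rw [← lie_skew, K_lie, τa_K, lie_neg, ← lie_skew, K_lie]; simp
    | hm n y =>
      have e1 : -m + -n = -(m + n) := by ring
      rw [lie_mon_mon, τa_mon, τa_mon, lie_mon_mon, map_add, map_smulₛₗ, τa_K, τa_mon,
        D.τ_lie, e1, D.form_τ]
      by_cases h : m + n = 0
      · simp [h]
      · have : -(m + n) ≠ 0 := by omega
        simp only [if_neg h, if_neg this]
        simp
    | hD =>
      rw [← lie_skew, Dd_lie_mon, τa_Dd, τa_mon, lie_neg, ← lie_skew, Dd_lie_mon, map_neg,
        map_smulₛₗ, τa_mon]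
      simp
  | hD =>
    induction Y using D.affine_ind with
    | ha X X' h h' => simp only [lie_add, map_add, h, h']
    | hs a X h => simp only [lie_smul, map_smulₛₗ, h]
    | hK => rw [← lie_skew, K_lie, τa_K, lie_neg, ← lie_skew, K_lie]; simp
    | hm n y =>
      rw [Dd_lie_mon, τa_Dd, τa_mon, neg_lie, Dd_lie_mon, map_smulₛₗ, τa_mon]
      simp
    | hD => simp [τa_Dd]

theorem σa_iterate (X : D.Affine) : D.σa^[T] X = X := by
  have hl : ∀ n : ℕ, ∀ X : D.Affine, D.σa^[n] X = (D.σa ^ n) X := fun n X =>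
    (Module.End.pow_apply D.σa n X).symm
  rw [hl]
  induction X using D.affine_ind with
  | ha X X' h h' => rw [map_add, h, h']
  | hs a X h => rw [map_smul, h]
  | hK => rw [← hl]; exact Function.iterate_fixed D.σa_K T
  | hD => rw [← hl]; exact Function.iterate_fixed D.σa_Dd T
  | hm n x =>
    rw [← hl]
    have : ∀ k : ℕ, D.σa^[k] (D.mon n x) = D.mon n (D.σ^[k] x) := by
      intro k
      induction k with
      | zero => rfl
      | succ k ih => rw [Function.iterate_succ_apply', ih, σa_mon, Function.iterate_succ_apply']
    rw [this, D.σ_iterate]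

theorem τa_τa (X : D.Affine) : D.τa (D.τa X) = X := by
  induction X using D.affine_ind with
  | ha X X' h h' => rw [map_add, map_add, h, h']
  | hs a X h => rw [map_smulₛₗ, map_smulₛₗ, h]; simp
  | hK => simp [τa_K]
  | hD => simp [τa_Dd]
  | hm n x => rw [τa_mon, τa_mon, D.τ_τ, neg_neg]

theorem τ_σ_τ_σ [NeZero T] (x : 𝔤) : D.τ (D.σ (D.τ (D.σ x))) = x := by
  have hω : D.ω ^ T = 1 := D.isPrimitiveRoot_ω.pow_eq_one
  have hω0 : D.ω ≠ 0 := D.isPrimitiveRoot_ω.ne_zero (NeZero.ne T)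
  have hconj : conj D.ω * D.ω = 1 := by
    rw [← Complex.normSq_eq_conj_mul_self, Complex.normSq_eq_norm_sq,
      Complex.norm_eq_one_of_pow_eq_one hω (NeZero.ne T)]
    simp
  have heig : ∀ (j : ℕ) (y : 𝔤), D.σ y = D.ω ^ j • y → D.τ (D.σ (D.τ (D.σ y))) = y := by
    intro j y hy
    rw [hy, map_smulₛₗ, map_smul, D.τ_eigen j y hy, smul_smul, map_pow, ← mul_pow, hconj,
      one_pow, one_smul, D.τ_τ]
  let e : ℕ → 𝔤 := fun j => ∑ k ∈ Finset.range T, (D.ω⁻¹ ^ j) ^ k • D.σ^[k] x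
  have he : ∀ j, D.σ (e j) = D.ω ^ j • e j := by
    intro j
    have h1 : D.ω⁻¹ ^ j • D.σ (e j) = ∑ k ∈ Finset.range T, (D.ω⁻¹ ^ j) ^ (k + 1) • D.σ^[k + 1] x := by
      simp only [e, map_sum, map_smul, Finset.smul_sum, smul_smul, Function.iterate_succ_apply',
        pow_succ, mul_comm]
    have h2 : ∑ k ∈ Finset.range T, (D.ω⁻¹ ^ j) ^ (k + 1) • D.σ^[k + 1] x = e j := by
      have h3 := Finset.sum_range_succ' (fun k => (D.ω⁻¹ ^ j) ^ k • D.σ^[k] x) T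
      rw [Finset.sum_range_succ] at h3
      have h4 : (D.ω⁻¹ ^ j) ^ T = 1 := by
        rw [← pow_mul, mul_comm, pow_mul, inv_pow, hω, inv_one, one_pow]
      rw [h4, D.σ_iterate] at h3
      simp only [pow_zero, Function.iterate_zero, id_eq] at h3
      exact (add_right_cancel h3).symm
    conv_rhs => rw [← h2, ← h1]
    rw [smul_smul, inv_pow, mul_inv_cancel₀ (pow_ne_zero _ hω0), one_smul]
  have hsum : ∑ j ∈ Finset.range T, e j = (T : ℂ) • x := by
    simp only [e]
    rw [Finset.sum_comm]
    have h5 : ∀ k ∈ Finset.range T, ∑ j ∈ Finset.range T, (D.ω⁻¹ ^ j) ^ k • D.σ^[k] x =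
        if k = 0 then (T : ℂ) • x else 0 := by
      intro k hk
      rw [← Finset.sum_smul]
      split_ifs with h
      · subst h
        simp
      · have h6 : D.ω⁻¹ ^ k ≠ 1 := by
          rw [inv_pow, Ne, inv_eq_one]
          exact D.isPrimitiveRoot_ω.pow_ne_one_of_pos_of_lt h (Finset.mem_range.1 hk)
        have h7 := mul_neg_geom_sum (D.ω⁻¹ ^ k) T
        have hω' : D.ω⁻¹ ^ T = 1 := by rw [inv_pow, hω, inv_one]
        rw [← pow_mul, mul_comm k T, pow_mul, hω', one_pow, sub_self] at h7
        have h8 := (mul_eq_zero.1 h7).resolve_left (sub_ne_zero.2 h6.symm)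
        have h9 : ∑ j ∈ Finset.range T, (D.ω⁻¹ ^ j) ^ k = 0 := by
          rw [← h8]
          refine Finset.sum_congr rfl fun j _ => ?_
          rw [← pow_mul, mul_comm, pow_mul]
        rw [h9, zero_smul]
    rw [Finset.sum_congr rfl h5]
    simp [NeZero.ne T]
  have hT : (T : ℂ) ≠ 0 := Nat.cast_ne_zero.2 (NeZero.ne T)
  have hx : x = (T : ℂ)⁻¹ • ∑ j ∈ Finset.range T, e j := by
    rw [hsum, smul_smul, inv_mul_cancel₀ hT, one_smul]
  have hfin : D.τ (D.σ (D.τ (D.σ (∑ j ∈ Finset.range T, e j)))) = ∑ j ∈ Finset.range T, e j := by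
    simp only [map_sum]
    exact Finset.sum_congr rfl fun j _ => heig j _ (he j)
  rw [hx]
  simp only [map_smul, map_smulₛₗ, hfin]
  simp

theorem τa_σa_τa_σa [NeZero T] (X : D.Affine) : D.τa (D.σa (D.τa (D.σa X))) = X := by
  induction X using D.affine_ind with
  | ha X X' h h' => simp only [map_add, h, h']
  | hs a X h => simp only [map_smul, map_smulₛₗ, h]; simp
  | hK => simp [τa_K, σa_K]
  | hD => simp [τa_Dd, σa_Dd]
  | hm n x => simp only [τa_mon, σa_mon, D.τ_σ_τ_σ, neg_neg]

end DihedralLie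

/-! ### The dihedral group -/

section Dihedral

variable {T : ℕ} [NeZero T] {M : Type*} [Monoid M]

theorem pow_val_add {s : M} (hs : s ^ T = 1) (i j : ZMod T) :
    s ^ (i + j).val = s ^ i.val * s ^ j.val := by
  rw [ZMod.val_add, ← pow_add, ← pow_eq_pow_mod _ hs]

theorem refl_pow {s t : M} (ht : t * t = 1) (hst : t * s * t * s = 1) (k : ℕ) :
    t * s ^ k * t * s ^ k = 1 := by
  induction k with
  | zero => simpa using ht
  | succ k ih =>
    calc t * s ^ (k + 1) * t * s ^ (k + 1)
        = t * s ^ k * (s * (t * s)) * s ^ k := by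
          rw [pow_succ' s k]
          nth_rewrite 1 [(pow_succ' s k).symm.trans (pow_succ s k)]
          simp only [mul_assoc]
      _ = t * s ^ k * (t * (t * s * t * s)) * s ^ k := by
          simp only [← mul_assoc]
          rw [mul_assoc (t * s ^ k) t t, ht, mul_one]
      _ = 1 := by rw [hst, mul_one]; exact ih

/-- The homomorphism from the dihedral group with `r i ↦ sⁱ` and `sr i ↦ t sⁱ`, for elements with
`s ^ T = 1`, `t ^ 2 = 1` and `(t s) ^ 2 = 1`. -/
def dihHom (s t : M) (hs : s ^ T = 1) (ht : t * t = 1) (hst : t * s * t * s = 1) :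
    DihedralGroup T →* M where
  toFun
    | DihedralGroup.r i => s ^ i.val
    | DihedralGroup.sr i => t * s ^ i.val
  map_one' := by
    show s ^ (0 : ZMod T).val = 1
    rw [ZMod.val_zero, pow_zero]
  map_mul' a b := by
    have key : ∀ i j : ZMod T, s ^ j.val = s ^ i.val * s ^ (j - i).val := fun i j => by
      rw [← pow_val_add hs, add_sub_cancel]
    rcases a with i | i <;> rcases b with j | j
    · exact pow_val_add hs i j
    · show t * s ^ (j - i).val = s ^ i.val * (t * s ^ j.val)
      rw [key i j]
      have h := refl_pow ht hst i.val
      have h' : s ^ i.val * t * s ^ i.val = t := by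
        calc s ^ i.val * t * s ^ i.val = t * t * (s ^ i.val * t * s ^ i.val) := by rw [ht, one_mul]
          _ = t * (t * s ^ i.val * t * s ^ i.val) := by simp only [mul_assoc]
          _ = t := by rw [h, mul_one]
      rw [← mul_assoc, ← mul_assoc, h']
    · show t * s ^ (i + j).val = t * s ^ i.val * s ^ j.val
      rw [pow_val_add hs, mul_assoc]
    · show s ^ (j - i).val = t * s ^ i.val * (t * s ^ j.val)
      rw [key i j, ← mul_assoc, ← mul_assoc, refl_pow ht hst, one_mul]

end Dihedral

namespace DihedralLie

variable {T : ℕ} [NeZero T] {𝔤 : Type*} [LieRing 𝔤] [LieAlgebra ℂ 𝔤] (D : DihedralLie T 𝔤)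

theorem ω_pow : D.ω ^ T = 1 := D.isPrimitiveRoot_ω.pow_eq_one

theorem conj_unit {u : ℂ} (hu : u ^ T = 1) : conj u * u = 1 := by
  rw [← Complex.normSq_eq_conj_mul_self, Complex.normSq_eq_norm_sq,
    Complex.norm_eq_one_of_pow_eq_one hu (NeZero.ne T)]
  simp

/-- The action of the dihedral group on `ℂ`, generated by `x ↦ ω x` and complex conjugation. -/
def ptAct : DihedralGroup T →* Module.End ℝ ℂ :=
  dihHom (LinearMap.mulLeft ℝ D.ω) (Complex.conjAe.toLinearMap)
    (by rw [LinearMap.pow_mulLeft, D.ω_pow, LinearMap.mulLeft_one]; rfl)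
    (by ext x <;> simp)
    (by
      refine LinearMap.ext fun x => ?_
      show conj (D.ω * conj (D.ω * x)) = x
      rw [map_mul, Complex.conj_conj, ← mul_assoc, conj_unit D.ω_pow, one_mul])

/-- The stabiliser of a point of `ℙ¹ = ℂ ∪ {∞}` (where `∞` is `none`). -/
def stab : Option ℂ → Subgroup (DihedralGroup T)
  | none => ⊤
  | some x =>
    { carrier := {α | D.ptAct α x = x}
      mul_mem' := fun {a b} ha hb => by
        simp only [Set.mem_ofPred_eq] at ha hb ⊢
        rw [map_mul, Module.End.mul_apply, hb, ha]
      one_mem' := by simp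
      inv_mem' := fun {a} ha => by
        simp only [Set.mem_ofPred_eq] at ha ⊢
        conv_lhs => rw [← ha]
        rw [← Module.End.mul_apply, ← map_mul, inv_mul_cancel, map_one, Module.End.one_apply] }

/-- The factor by which the generating rotation acts on the local coordinate `ε`: `ω⁻¹` at finite
points, `ω` at infinity. -/
def rot : Option ℂ → ℂ
  | none => D.ω
  | some _ => D.ω⁻¹

theorem rot_pow (i : Option ℂ) (p : ℕ) : (D.rot i ^ p) ^ T = 1 := by
  rw [← pow_mul, mul_comm, pow_mul]
  cases i <;> simp [rot, D.ω_pow]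

/-- `σ` as a real linear map, twisted by a scalar. -/
def σR (u : ℂ) : Module.End ℝ D.Affine := (u • D.σa).restrictScalars ℝ

/-- `τ` as a real linear map. -/
def τR : Module.End ℝ D.Affine where
  toFun := D.τa
  map_add' := map_add D.τa
  map_smul' a X := by
    rw [← Complex.coe_smul, map_smulₛₗ, Complex.conj_ofReal, Complex.coe_smul]; rfl

theorem σR_pow (u : ℂ) (k : ℕ) (X : D.Affine) : (D.σR u ^ k) X = u ^ k • (D.σa^[k] X) := by
  induction k with
  | zero => simp
  | succ k ih =>
    rw [pow_succ', Module.End.mul_apply, ih, Function.iterate_succ_apply']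
    show u • D.σa (u ^ k • _) = _
    rw [map_smul, smul_smul, pow_succ']

/-- The action of the dihedral group on the coefficients of `ε ^ p` in the Takiff algebra attached
to the point `i`: the rotation `s` sends `X ε ^ p` to `σ X (rot ε) ^ p`, the reflection `t` sends
`X ε ^ p` to `τ X ε ^ p`. -/
def rep (i : Option ℂ) (p : ℕ) : DihedralGroup T →* Module.End ℝ D.Affine :=
  dihHom (D.σR (D.rot i ^ p)) D.τR
    (by
      refine LinearMap.ext fun X => ?_
      rw [σR_pow, rot_pow, one_smul, σa_iterate]; rfl)
    (LinearMap.ext fun X => D.τa_τa X)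
    (by
      refine LinearMap.ext fun X => ?_
      show D.τa ((D.rot i ^ p) • D.σa (D.τa ((D.rot i ^ p) • D.σa X))) = X
      have h1 : D.τa ((D.rot i ^ p) • D.σa X) = conj (D.rot i ^ p) • D.τa (D.σa X) :=
        map_smulₛₗ D.τa _ _
      rw [h1, map_smul D.σa, smul_smul, mul_comm, conj_unit (D.rot_pow i p), one_smul,
        D.τa_σa_τa_σa])

theorem rep_r (i : Option ℂ) (p : ℕ) (k : ZMod T) (X : D.Affine) :
    D.rep i p (.r k) X = (D.rot i ^ p) ^ k.val • (D.σa^[k.val] X) := D.σR_pow _ _ _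

theorem rep_sr (i : Option ℂ) (p : ℕ) (k : ZMod T) (X : D.Affine) :
    D.rep i p (.sr k) X = D.τa ((D.rot i ^ p) ^ k.val • (D.σa^[k.val] X)) :=
  congrArg D.τa (D.σR_pow _ _ _)

theorem σa_iter_lie (k : ℕ) (X Y : D.Affine) : D.σa^[k] ⁅X, Y⁆ = ⁅D.σa^[k] X, D.σa^[k] Y⁆ := by
  induction k with
  | zero => rfl
  | succ k ih => simp only [Function.iterate_succ_apply', ih, σa_lie]

theorem σa_iter_smul (k : ℕ) (a : ℂ) (X : D.Affine) : D.σa^[k] (a • X) = a • D.σa^[k] X := by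
  induction k with
  | zero => rfl
  | succ k ih => simp only [Function.iterate_succ_apply', ih, map_smul]

theorem σa_iter_mem_F {e : ℤ} {n : ℕ} {X : D.Affine} (hX : X ∈ D.F e n) (k : ℕ) :
    D.σa^[k] X ∈ D.F e n := by
  induction k with
  | zero => exact hX
  | succ k ih =>
    rw [Function.iterate_succ_apply']
    exact D.σa_mem_F ih

theorem rep_lie (i : Option ℂ) (p q : ℕ) (α : DihedralGroup T) (X Y : D.Affine) :
    D.rep i (p + q) α ⁅X, Y⁆ = ⁅D.rep i p α X, D.rep i q α Y⁆ := by
  rcases α with k | k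
  · rw [rep_r, rep_r, rep_r, σa_iter_lie, smul_lie, lie_smul, smul_smul, pow_add, mul_pow]
  · rw [rep_sr, rep_sr, rep_sr, ← τa_lie, σa_iter_lie, smul_lie, lie_smul, smul_smul, pow_add,
      mul_pow]

open scoped Classical in
/-- The average over the stabiliser of the point `i`, a real projection of the coefficients of
`ε ^ p` onto the invariant ones. -/
def avg (i : Option ℂ) (p : ℕ) : Module.End ℝ D.Affine :=
  (Nat.card (D.stab i) : ℝ)⁻¹ • ∑ α : DihedralGroup T with α ∈ D.stab i, D.rep i p α

theorem rep_avg (i : Option ℂ) (p : ℕ) {α : DihedralGroup T} (hα : α ∈ D.stab i) (X : D.Affine) :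
    D.rep i p α (D.avg i p X) = D.avg i p X := by
  classical
  simp only [avg, LinearMap.smul_apply, map_smul, LinearMap.sum_apply, map_sum]
  congr 1
  refine Finset.sum_bij (fun β _ => α * β) ?_ ?_ ?_ ?_
  · intro β hβ
    simp only [Finset.mem_filter, Finset.mem_univ, true_and] at hβ ⊢
    exact mul_mem hα hβ
  · intro β _ γ _ h
    exact mul_left_cancel h
  · intro β hβ
    simp only [Finset.mem_filter, Finset.mem_univ, true_and] at hβ
    refine ⟨α⁻¹ * β, ?_, by simp⟩
    simp only [Finset.mem_filter, Finset.mem_univ, true_and]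
    exact mul_mem (inv_mem hα) hβ
  · intro β _
    rw [map_mul, Module.End.mul_apply]

theorem lie_real_smul (a : ℝ) (X Y : D.Affine) : ⁅X, a • Y⁆ = a • ⁅X, Y⁆ := by
  rw [← Complex.coe_smul, lie_smul, Complex.coe_smul]

theorem lie_avg (i : Option ℂ) (p q : ℕ) {X : D.Affine}
    (hX : ∀ α ∈ D.stab i, D.rep i p α X = X) (Y : D.Affine) :
    ⁅X, D.avg i q Y⁆ = D.avg i (p + q) ⁅X, Y⁆ := by
  classical
  simp only [avg, LinearMap.smul_apply, LinearMap.sum_apply, lie_real_smul, lie_sum]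
  congr 1
  refine Finset.sum_congr rfl fun α hα => ?_
  simp only [Finset.mem_filter, Finset.mem_univ, true_and] at hα
  rw [rep_lie, hX α hα]

/-- The complex linear part of `avg` has the form of a sum over rotations. -/
theorem avg_sub_mem {e : ℤ} {n : ℕ} (i : Option ℂ) (p : ℕ) {X : D.Affine} (hX : X ∈ D.F e n) :
    D.avg i p X - Complex.I • D.avg i p (Complex.I • X) ∈ D.F e n := by
  classical
  simp only [avg, LinearMap.smul_apply, LinearMap.sum_apply]
  rw [smul_comm, ← smul_sub, Finset.smul_sum, ← Finset.sum_sub_distrib, ← Complex.coe_smul]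
  refine Submodule.smul_mem _ _ (Submodule.sum_mem _ fun α _ => ?_)
  rcases α with k | k
  · rw [rep_r, rep_r, σa_iter_smul]
    exact sub_mem (Submodule.smul_mem _ _ (D.σa_iter_mem_F hX _))
      (Submodule.smul_mem _ _ (Submodule.smul_mem _ _ (Submodule.smul_mem _ _
        (D.σa_iter_mem_F hX _))))
  · rw [rep_sr, rep_sr, σa_iter_smul, smul_comm _ Complex.I, map_smulₛₗ D.τa Complex.I, smul_smul]
    simp

theorem avg_add_mem {e : ℤ} {n : ℕ} (i : Option ℂ) (p : ℕ) {X : D.Affine} (hX : X ∈ D.F e n) :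
    D.avg i p X + Complex.I • D.avg i p (Complex.I • X) ∈ D.F (-e) n := by
  classical
  simp only [avg, LinearMap.smul_apply, LinearMap.sum_apply]
  rw [smul_comm, ← smul_add, Finset.smul_sum, ← Finset.sum_add_distrib, ← Complex.coe_smul]
  refine Submodule.smul_mem _ _ (Submodule.sum_mem _ fun α _ => ?_)
  rcases α with k | k
  · rw [rep_r, rep_r, σa_iter_smul, smul_comm _ Complex.I, smul_smul]
    simp
  · rw [rep_sr, rep_sr, σa_iter_smul, smul_comm _ Complex.I, map_smulₛₗ D.τa Complex.I, smul_smul]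
    have h := D.τa_mem_F (Submodule.smul_mem _ ((D.rot i ^ p) ^ k.val) (D.σa_iter_mem_F hX k.val))
    simpa using add_mem h h

end DihedralLie

/-! ### Points, real Takiff algebras -/

/-- A finite set of finite points, together with infinity, in pairwise distinct orbits of the
dihedral group, and a divisor with positive multiplicities supported exactly on these points. -/
structure GaudinPoints {T : ℕ} [NeZero T] {𝔤 : Type*} [LieRing 𝔤] [LieAlgebra ℂ 𝔤]
    (D : DihedralLie T 𝔤) where
  z : Finset ℂ
  orbit_disjoint : ∀ x ∈ z, ∀ y ∈ z, ∀ α : DihedralGroup T, D.ptAct α x = y → x = y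
  mult : Option ℂ → ℕ
  mult_inf : 1 ≤ mult none
  mult_fin : ∀ x, 1 ≤ mult (some x) ↔ x ∈ z

section Takiff

variable {L : Type*} [LieRing L]

/-- The bracket of truncated polynomials `∑ vₚ ε ^ p`, `p < n`. -/
def truncBr {n : ℕ} (v w : Fin n → L) : Fin n → L := fun r =>
  ∑ p : Fin n, ∑ q : Fin n, if (p : ℕ) + q = r then ⁅v p, w q⁆ else 0

theorem truncBr_self {n : ℕ} (v : Fin n → L) : truncBr v v = 0 := by
  have h2 : ∀ r : Fin n, truncBr v v r =
      ∑ x ∈ (Finset.univ : Finset (Fin n × Fin n)),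
        if (x.1 : ℕ) + x.2 = r then ⁅v x.1, v x.2⁆ else 0 := fun r => by
    rw [truncBr, ← Finset.univ_product_univ, Finset.sum_product]
  funext r
  rw [h2]
  refine Finset.sum_involution (fun x _ => (x.2, x.1)) ?_ ?_ ?_ ?_
  · intro x _
    by_cases h : (x.1 : ℕ) + x.2 = r
    · rw [if_pos h, if_pos (by simpa [add_comm] using h), ← lie_skew (v x.1), neg_add_cancel]
    · rw [if_neg h, if_neg (by simpa [add_comm] using h), add_zero]
  · intro x _ hx heq
    apply hx
    have : x.1 = x.2 := by
      have := congrArg Prod.fst heq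
      exact this.symm
    rw [this, lie_self, ite_self]
  · intro x _; exact Finset.mem_univ _
  · intro x _; rfl

theorem truncBr_left {n : ℕ} (u v w : Fin n → L) (r : Fin n) :
    truncBr u (truncBr v w) r = ∑ p : Fin n, ∑ q : Fin n, ∑ t : Fin n,
      if (p : ℕ) + q + t = r then ⁅u p, ⁅v q, w t⁆⁆ else 0 := by
  unfold truncBr
  refine Finset.sum_congr rfl fun p _ => ?_
  have h1 : ∀ s : Fin n, (if (p : ℕ) + s = r then
      ⁅u p, ∑ q : Fin n, ∑ t : Fin n, if (q : ℕ) + t = s then ⁅v q, w t⁆ else 0⁆ else 0) =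
      ∑ q : Fin n, ∑ t : Fin n, if (p : ℕ) + s = r ∧ (q : ℕ) + t = s then ⁅u p, ⁅v q, w t⁆⁆ else 0 := by
    intro s
    by_cases h : (p : ℕ) + s = r
    · simp only [h, if_true, true_and, lie_sum]
      refine Finset.sum_congr rfl fun q _ => Finset.sum_congr rfl fun t _ => ?_
      split_ifs <;> simp
    · simp [h]
  rw [Finset.sum_congr rfl fun s _ => h1 s, Finset.sum_comm]
  refine Finset.sum_congr rfl fun q _ => ?_
  rw [Finset.sum_comm]
  refine Finset.sum_congr rfl fun t _ => ?_
  by_cases h : (p : ℕ) + q + t = r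
  · rw [if_pos h, Finset.sum_eq_single ⟨(q : ℕ) + t, by omega⟩]
    · rw [if_pos]
      exact ⟨by simp only; omega, rfl⟩
    · intro s _ hs
      rw [if_neg]
      rintro ⟨_, h2⟩
      exact hs (Fin.ext h2.symm)
    · simp
  · rw [if_neg h]
    refine Finset.sum_eq_zero fun s _ => if_neg ?_
    rintro ⟨h1, h2⟩
    omega

theorem truncBr_add {n : ℕ} (u v w : Fin n → L) :
    truncBr u (v + w) = truncBr u v + truncBr u w := by
  funext r
  simp only [truncBr, Pi.add_apply, ← Finset.sum_add_distrib]
  refine Finset.sum_congr rfl fun p _ => Finset.sum_congr rfl fun q _ => ?_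
  split_ifs <;> simp

theorem add_truncBr {n : ℕ} (u v w : Fin n → L) :
    truncBr (u + v) w = truncBr u w + truncBr v w := by
  funext r
  simp only [truncBr, Pi.add_apply, ← Finset.sum_add_distrib]
  refine Finset.sum_congr rfl fun p _ => Finset.sum_congr rfl fun q _ => ?_
  split_ifs <;> simp

theorem truncBr_skew {n : ℕ} (v w : Fin n → L) : truncBr v w = -truncBr w v := by
  have h := truncBr_self (v + w)
  rw [truncBr_add, add_truncBr, add_truncBr, truncBr_self, truncBr_self, zero_add, add_zero] at h
  exact eq_neg_of_add_eq_zero_right h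

theorem truncBr_jacobi {n : ℕ} (u v w : Fin n → L) :
    truncBr u (truncBr v w) = truncBr (truncBr u v) w + truncBr v (truncBr u w) := by
  have h : truncBr (truncBr u v) w = -truncBr w (truncBr u v) := truncBr_skew _ _
  rw [h]
  funext r
  rw [Pi.add_apply, Pi.neg_apply, truncBr_left, truncBr_left, truncBr_left]
  have e1 : (∑ p : Fin n, ∑ q : Fin n, ∑ t : Fin n,
      if (p : ℕ) + q + t = r then ⁅w p, ⁅u q, v t⁆⁆ else 0) =
      ∑ p : Fin n, ∑ q : Fin n, ∑ t : Fin n,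
        if (p : ℕ) + q + t = r then ⁅w t, ⁅u p, v q⁆⁆ else 0 := by
    rw [Finset.sum_comm]
    refine Finset.sum_congr rfl fun p _ => ?_
    rw [Finset.sum_comm]
    refine Finset.sum_congr rfl fun q _ => Finset.sum_congr rfl fun t _ => ?_
    rw [show (t : ℕ) + p + q = p + q + t by omega]
  have e2 : (∑ p : Fin n, ∑ q : Fin n, ∑ t : Fin n,
      if (p : ℕ) + q + t = r then ⁅v p, ⁅u q, w t⁆⁆ else 0) =
      ∑ p : Fin n, ∑ q : Fin n, ∑ t : Fin n,
        if (p : ℕ) + q + t = r then ⁅v q, ⁅u p, w t⁆⁆ else 0 := by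
    rw [Finset.sum_comm]
    refine Finset.sum_congr rfl fun p _ => Finset.sum_congr rfl fun q _ =>
      Finset.sum_congr rfl fun t _ => ?_
    rw [show (q : ℕ) + p + t = p + q + t by omega]
  rw [e1, e2, ← Finset.sum_neg_distrib, ← Finset.sum_add_distrib]
  refine Finset.sum_congr rfl fun p _ => ?_
  rw [← Finset.sum_neg_distrib, ← Finset.sum_add_distrib]
  refine Finset.sum_congr rfl fun q _ => ?_
  rw [← Finset.sum_neg_distrib, ← Finset.sum_add_distrib]
  refine Finset.sum_congr rfl fun t _ => ?_
  split_ifs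
  · rw [leibniz_lie (u p) (v q) (w t), ← lie_skew ⁅u p, v q⁆ (w t)]
  · simp

end Takiff

/-- Complex conjugation on the complexification of a real vector space. -/
def conjT (W : Type*) [AddCommGroup W] [Module ℝ W] :
    (ℂ ⊗[ℝ] W) →ₛₗ[starRingEnd ℂ] (ℂ ⊗[ℝ] W) where
  toFun := TensorProduct.map Complex.conjAe.toLinearMap (LinearMap.id : W →ₗ[ℝ] W)
  map_add' := map_add (TensorProduct.map Complex.conjAe.toLinearMap (LinearMap.id : W →ₗ[ℝ] W))
  map_smul' a Z := by
    induction Z using TensorProduct.induction_on with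
    | zero => rw [smul_zero, map_zero, smul_zero]
    | add x y hx hy => rw [smul_add, map_add, hx, hy, map_add, smul_add]
    | tmul u w => simp [TensorProduct.smul_tmul']

namespace GaudinPoints

variable {T : ℕ} [NeZero T] {𝔤 : Type*} [LieRing 𝔤] [LieAlgebra ℂ 𝔤] {D : DihedralLie T 𝔤}
  (P : GaudinPoints D)

/-- The product of the Takiff algebras `𝔤̃ ⊗ ℂ[ε] / ε ^ (mult i)` over all points `i` of `ℙ¹`
(trivial outside of the support of the divisor). -/
def Amb (P : GaudinPoints D) : Type _ := (i : Option ℂ) → Fin (P.mult i) → D.Affine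

instance : AddCommGroup P.Amb :=
  inferInstanceAs (AddCommGroup ((i : Option ℂ) → Fin (P.mult i) → D.Affine))

instance : Module ℝ P.Amb :=
  inferInstanceAs (Module ℝ ((i : Option ℂ) → Fin (P.mult i) → D.Affine))

instance : LieRing P.Amb where
  bracket v w := fun i => truncBr (v i) (w i)
  add_lie u v w := funext fun i => add_truncBr (u i) (v i) (w i)
  lie_add u v w := funext fun i => truncBr_add (u i) (v i) (w i)
  lie_self v := funext fun i => truncBr_self (v i)
  leibniz_lie u v w := funext fun i => truncBr_jacobi (u i) (v i) (w i)

theorem amb_lie (v w : P.Amb) (i : Option ℂ) (r : Fin (P.mult i)) : ⁅v, w⁆ i r =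
    ∑ p : Fin (P.mult i), ∑ q : Fin (P.mult i), if (p : ℕ) + q = r then ⁅v i p, w i q⁆ else 0 := rfl

instance : LieAlgebra ℝ P.Amb where
  lie_smul a v w := by
    funext i r
    show ⁅v, a • w⁆ i r = a • ⁅v, w⁆ i r
    rw [amb_lie, amb_lie, Finset.smul_sum]
    refine Finset.sum_congr rfl fun p _ => ?_
    rw [Finset.smul_sum]
    refine Finset.sum_congr rfl fun q _ => ?_
    split_ifs
    · exact D.lie_real_smul a _ _
    · rw [smul_zero]

/-- The direct sum over all points of the real Lie algebras of elements of the Takiff algebras which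
are invariant under the stabiliser of the point; at infinity there is no constant term. -/
def gD : LieSubalgebra ℝ P.Amb where
  carrier := {v | (∀ i, ∀ α ∈ D.stab i, ∀ p : Fin (P.mult i), D.rep i p α (v i p) = v i p) ∧
    ∀ p : Fin (P.mult none), (p : ℕ) = 0 → v none p = 0}
  add_mem' {v w} hv hw := by
    refine ⟨fun i α hα p => ?_, fun p hp => ?_⟩
    · show D.rep i p α (v i p + w i p) = v i p + w i p
      rw [map_add, hv.1 i α hα, hw.1 i α hα]
    · show v none p + w none p = 0
      rw [hv.2 p hp, hw.2 p hp, add_zero]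
  zero_mem' := by
    refine ⟨fun i α hα p => ?_, fun p hp => rfl⟩
    show D.rep i p α 0 = 0
    rw [map_zero]
  smul_mem' a v hv := by
    refine ⟨fun i α hα p => ?_, fun p hp => ?_⟩
    · show D.rep i p α (a • v i p) = a • v i p
      rw [map_smul, hv.1 i α hα]
    · show a • v none p = 0
      rw [hv.2 p hp, smul_zero]
  lie_mem' {v w} hv hw := by
    refine ⟨fun i α hα r => ?_, fun r hr => ?_⟩
    · show D.rep i r α (⁅v, w⁆ i r) = ⁅v, w⁆ i r
      rw [amb_lie, map_sum]
      refine Finset.sum_congr rfl fun p _ => ?_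
      rw [map_sum]
      refine Finset.sum_congr rfl fun q _ => ?_
      split_ifs with h
      · rw [← h, D.rep_lie, hv.1 i α hα, hw.1 i α hα]
      · rw [map_zero]
    · show ⁅v, w⁆ none r = 0
      rw [amb_lie]
      refine Finset.sum_eq_zero fun p _ => Finset.sum_eq_zero fun q _ => ?_
      split_ifs with h
      · rw [hv.2 p (by omega), zero_lie]
      · rfl

/-- The complexification of `gD`. -/
def gDC : Type _ := ℂ ⊗[ℝ] P.gD

instance : AddCommGroup P.gDC := inferInstanceAs (AddCommGroup (ℂ ⊗[ℝ] P.gD))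

instance : Module ℂ P.gDC := inferInstanceAs (Module ℂ (ℂ ⊗[ℝ] P.gD))

instance : LieRing P.gDC := inferInstanceAs (LieRing (ℂ ⊗[ℝ] P.gD))

instance : LieAlgebra ℂ P.gDC := inferInstanceAs (LieAlgebra ℂ (ℂ ⊗[ℝ] P.gD))

/-- The pure tensor `u ⊗ w`. -/
def tm (u : ℂ) (w : P.gD) : P.gDC := u ⊗ₜ[ℝ] w

theorem gDC_ind {C : P.gDC → Prop} (h0 : C 0) (ht : ∀ u w, C (P.tm u w))
    (ha : ∀ Z W, C Z → C W → C (Z + W)) (Z : P.gDC) : C Z :=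
  TensorProduct.induction_on Z h0 ht ha

@[simp] theorem tm_lie (u u' : ℂ) (w w' : P.gD) :
    ⁅P.tm u w, P.tm u' w'⁆ = P.tm (u * u') ⁅w, w'⁆ :=
  LieAlgebra.ExtendScalars.bracket_tmul ℝ ℂ P.gD P.gD u u' w w'

theorem tm_add (u : ℂ) (w w' : P.gD) : P.tm u (w + w') = P.tm u w + P.tm u w' :=
  TensorProduct.tmul_add u w w'

theorem tm_sum {κ : Type*} (s : Finset κ) (u : ℂ) (f : κ → P.gD) :
    P.tm u (∑ k ∈ s, f k) = ∑ k ∈ s, P.tm u (f k) :=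
  TensorProduct.tmul_sum u s f

theorem tm_real_smul (u : ℂ) (b : ℝ) (w : P.gD) : P.tm u (b • w) = (b : ℂ) • P.tm u w :=
  (TensorProduct.smul_tmul b u w).symm.trans (by
    rw [Complex.real_smul]; exact (TensorProduct.smul_tmul' (b : ℂ) u w).symm)

theorem smul_tm (a u : ℂ) (w : P.gD) : a • P.tm u w = P.tm (a * u) w :=
  TensorProduct.smul_tmul' a u w

/-- Complex conjugation on the complexification, `u ⊗ w ↦ ū ⊗ w`. -/
def conjD : P.gDC →ₛₗ[starRingEnd ℂ] P.gDC := conjT P.gD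

@[simp] theorem conjD_tm (u : ℂ) (w : P.gD) : P.conjD (P.tm u w) = P.tm (conj u) w := rfl

@[simp] theorem conjD_conjD (Z : P.gDC) : P.conjD (P.conjD Z) = Z := by
  induction Z using P.gDC_ind with
  | h0 => simp
  | ha x y hx hy => simp only [map_add, hx, hy]
  | ht u w => simp

theorem conjD_lie (Z W : P.gDC) : P.conjD ⁅Z, W⁆ = ⁅P.conjD Z, P.conjD W⁆ := by
  induction Z using P.gDC_ind with
  | h0 => simp
  | ha x y hx hy => simp only [map_add, add_lie, hx, hy]
  | ht u w =>
    induction W using P.gDC_ind with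
    | h0 => simp
    | ha x y hx hy => simp only [map_add, lie_add, hx, hy]
    | ht u' w' => simp

open scoped Classical in
/-- The element of the real Takiff algebra at the point `i` whose only coefficient is the projection
of `X` to the invariants, at `ε ^ p`; it is zero if `ε ^ p` vanishes at this point. -/
def realElt (i : Option ℂ) (p : ℕ) : D.Affine →ₗ[ℝ] P.gD where
  toFun X := ⟨fun j q => if j = i ∧ (q : ℕ) = p ∧ ¬(i = none ∧ p = 0) then D.avg i p X else 0, by
    refine ⟨fun j α hα q => ?_, fun q hq => ?_⟩
    · show D.rep j q α (if j = i ∧ (q : ℕ) = p ∧ ¬(i = none ∧ p = 0) then D.avg i p X else 0) =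
        if j = i ∧ (q : ℕ) = p ∧ ¬(i = none ∧ p = 0) then D.avg i p X else 0
      split_ifs with h
      · obtain ⟨rfl, h, _⟩ := h
        rw [h, D.rep_avg j p hα]
      · rw [map_zero]
    · refine if_neg ?_
      rintro ⟨h1, h2, h3⟩
      exact h3 ⟨h1.symm, h2.symm.trans hq⟩⟩
  map_add' X Y := by
    refine Subtype.ext (funext fun j => funext fun q => ?_)
    show (if j = i ∧ (q : ℕ) = p ∧ ¬(i = none ∧ p = 0) then D.avg i p (X + Y) else 0) =
      (if j = i ∧ (q : ℕ) = p ∧ ¬(i = none ∧ p = 0) then D.avg i p X else 0) +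
      (if j = i ∧ (q : ℕ) = p ∧ ¬(i = none ∧ p = 0) then D.avg i p Y else 0)
    split_ifs
    · rw [map_add]
    · rw [add_zero]
  map_smul' a X := by
    refine Subtype.ext (funext fun j => funext fun q => ?_)
    show (if j = i ∧ (q : ℕ) = p ∧ ¬(i = none ∧ p = 0) then D.avg i p (a • X) else 0) =
      a • (if j = i ∧ (q : ℕ) = p ∧ ¬(i = none ∧ p = 0) then D.avg i p X else 0)
    split_ifs
    · rw [map_smul]
    · rw [smul_zero]

open scoped Classical in
theorem realElt_apply (i : Option ℂ) (p : ℕ) (X : D.Affine) (j : Option ℂ) (q : Fin (P.mult j)) :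
    (P.realElt i p X).1 j q =
      if j = i ∧ (q : ℕ) = p ∧ ¬(i = none ∧ p = 0) then D.avg i p X else 0 := rfl

open scoped Classical in
/-- The normalisation of the modes: one half at points with trivial stabiliser, one otherwise. -/
def nrm (D : DihedralLie T 𝔤) (i : Option ℂ) : ℂ := if D.stab i = ⊥ then 1 / 2 else 1

/-- The mode `X^(i)_p`: at a point `i` with trivial stabiliser it is the element
`1/2 ((X εᵖ) ⊗ 1 - (i X εᵖ) ⊗ i)` of the complexification; at the other points it is
`(π X εᵖ) ⊗ 1 - (π (i X) εᵖ) ⊗ i` with `π` the projection to the invariants of the stabiliser. -/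
def mode (i : Option ℂ) (p : ℕ) : D.Affine →ₗ[ℂ] P.gDC where
  toFun X := nrm D i • (P.tm 1 (P.realElt i p X) - P.tm Complex.I (P.realElt i p (Complex.I • X)))
  map_add' X Y := by
    rw [← smul_add]
    simp only [smul_add Complex.I, map_add, tm_add]
    congr 1
    abel
  map_smul' a X := by
    have h : ∀ Y : D.Affine, a • Y = a.re • Y + a.im • (Complex.I • Y) := fun Y => by
      rw [← Complex.coe_smul, ← Complex.coe_smul, smul_smul, ← add_smul, Complex.re_add_im]
    have h4 : P.realElt i p (Complex.I • Complex.I • X) = (-1 : ℝ) • P.realElt i p X := by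
      rw [smul_smul, Complex.I_mul_I, ← map_smul, ← Complex.coe_smul]
      norm_num
    rw [RingHom.id_apply, smul_comm a]
    congr 1
    rw [smul_comm Complex.I a, h X, h (Complex.I • X)]
    have h5 : ∀ w : P.gD, P.tm Complex.I w = Complex.I • P.tm 1 w := fun w => by
      rw [smul_tm, mul_one]
    simp only [map_add, map_smul, tm_add, tm_real_smul, h4, h5]
    have ha : a = a.re + a.im * Complex.I := (Complex.re_add_im a).symm
    have hI : Complex.I * Complex.I = -1 := Complex.I_mul_I
    conv_rhs => rw [ha]
    match_scalars
    · ring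
    · linear_combination (a.im : ℂ) * hI
/-- The conjugate mode, `c (X^(i)_p)`; at a point `x` with trivial stabiliser this is the mode of `X`
at the complex conjugate point. -/
def modeBar (i : Option ℂ) (p : ℕ) : D.Affine →ₛₗ[starRingEnd ℂ] P.gDC where
  toFun X := P.conjD (P.mode i p X)
  map_add' X Y := by rw [map_add, map_add]
  map_smul' a X := by rw [map_smul, map_smulₛₗ]

theorem mode_def (i : Option ℂ) (p : ℕ) (X : D.Affine) : P.mode i p X =
    nrm D i • (P.tm 1 (P.realElt i p X) - P.tm Complex.I (P.realElt i p (Complex.I • X))) := rfl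

theorem modeBar_def (i : Option ℂ) (p : ℕ) (X : D.Affine) :
    P.modeBar i p X = P.conjD (P.mode i p X) := rfl

theorem conj_nrm (i : Option ℂ) : conj (nrm D i) = nrm D i := by
  unfold nrm
  split_ifs
  · rw [map_div₀, map_one, map_ofNat]
  · rw [map_one]

theorem realElt_none_zero (X : D.Affine) : P.realElt none 0 X = 0 := by
  refine Subtype.ext (funext fun j => funext fun q => ?_)
  rw [realElt_apply, if_neg]
  · rfl
  · simp

theorem mode_none_zero (X : D.Affine) : P.mode none 0 X = 0 := by
  rw [mode_def, realElt_none_zero, realElt_none_zero]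
  have h : ∀ u, P.tm u 0 = 0 := fun u => TensorProduct.tmul_zero _ u
  rw [h, h, sub_zero, smul_zero]

/-- The coefficient of `ε ^ q` at the point `j`, extended complex linearly. -/
def phi (j : Option ℂ) (q : Fin (P.mult j)) : P.gDC →ₗ[ℂ] D.Affine :=
  LinearMap.liftBaseChange (R := ℝ) (M := P.gD) ℂ
    { toFun := fun w => w.1 j q
      map_add' := fun _ _ => rfl
      map_smul' := fun _ _ => rfl }

@[simp] theorem phi_tm (j : Option ℂ) (q : Fin (P.mult j)) (u : ℂ) (w : P.gD) :
    P.phi j q (P.tm u w) = u • w.1 j q := LinearMap.liftBaseChange_tmul _ _ _ _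

open scoped Classical in
theorem phi_mode (j : Option ℂ) (q : Fin (P.mult j)) (i : Option ℂ) (p : ℕ) (X : D.Affine) :
    P.phi j q (P.mode i p X) = if j = i ∧ (q : ℕ) = p ∧ ¬(i = none ∧ p = 0) then
      nrm D i • (D.avg i p X - Complex.I • D.avg i p (Complex.I • X)) else 0 := by
  rw [mode_def, map_smul, map_sub, phi_tm, phi_tm, realElt_apply, realElt_apply]
  split_ifs
  · rw [one_smul]
  · simp

open scoped Classical in
theorem phi_modeBar (j : Option ℂ) (q : Fin (P.mult j)) (i : Option ℂ) (p : ℕ) (X : D.Affine) :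
    P.phi j q (P.modeBar i p X) = if j = i ∧ (q : ℕ) = p ∧ ¬(i = none ∧ p = 0) then
      nrm D i • (D.avg i p X + Complex.I • D.avg i p (Complex.I • X)) else 0 := by
  rw [modeBar_def, mode_def, map_smulₛₗ, map_sub, conjD_tm, conjD_tm, map_smul, map_sub, phi_tm,
    phi_tm, realElt_apply, realElt_apply, conj_nrm]
  split_ifs
  · simp
  · simp

theorem lie_realElt {j : Option ℂ} {q : ℕ} (h : ¬(j = none ∧ q = 0)) (w : P.gD) (Y : D.Affine) :
    ⁅w, P.realElt j q Y⁆ = ∑ p : Fin (P.mult j), P.realElt j (p + q) ⁅w.1 j p, Y⁆ := by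
  classical
  refine Subtype.ext (funext fun i => funext fun r => ?_)
  have hs : (∑ p : Fin (P.mult j), P.realElt j (p + q) ⁅w.1 j p, Y⁆).1 i r =
      ∑ p : Fin (P.mult j), (P.realElt j (p + q) ⁅w.1 j p, Y⁆).1 i r := by
    have : ∀ s : Finset (Fin (P.mult j)), (∑ p ∈ s, P.realElt j (p + q) ⁅w.1 j p, Y⁆).1 i r =
      ∑ p ∈ s, (P.realElt j (p + q) ⁅w.1 j p, Y⁆).1 i r := by
      intro s
      induction s using Finset.induction_on with
      | empty => rfl
      | insert a s ha ih =>
        rw [Finset.sum_insert ha, Finset.sum_insert ha, ← ih]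
        rfl
    exact this _
  rw [hs]
  show (⁅w.1, (P.realElt j q Y).1⁆ : P.Amb) i r = _
  rw [amb_lie]
  by_cases hij : i = j
  · subst hij
    refine Finset.sum_congr rfl fun p _ => ?_
    rw [realElt_apply]
    by_cases hr : (r : ℕ) = p + q
    · rw [if_pos ⟨rfl, hr, fun h' => h ⟨h'.1, by omega⟩⟩,
        Finset.sum_eq_single ⟨q, by omega⟩]
      · rw [if_pos hr.symm, realElt_apply, if_pos ⟨rfl, rfl, h⟩]
        exact D.lie_avg i p q (fun α hα => w.2.1 i α hα p) Y
      · intro q' _ hq'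
        split_ifs with h1
        · exact absurd (Fin.ext (by simp only; omega)) hq'
        · rfl
      · simp
    · rw [if_neg fun h' => hr h'.2.1]
      refine Finset.sum_eq_zero fun q' _ => ?_
      split_ifs with h1
      · rw [realElt_apply, if_neg, lie_zero]
        rintro ⟨_, h2, _⟩
        omega
      · rfl
  · have e1 : ∀ p : Fin (P.mult j), (P.realElt j (p + q) ⁅w.1 j p, Y⁆).1 i r = 0 := fun p => by
      rw [realElt_apply, if_neg fun h' => hij h'.1]
    have e2 : ∀ q' : Fin (P.mult i), (P.realElt j q Y).1 i q' = 0 := fun q' => by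
      rw [realElt_apply, if_neg fun h' => hij h'.1]
    simp only [e1, e2, lie_zero, ite_self, Finset.sum_const_zero]

theorem lie_mode {j : Option ℂ} {q : ℕ} (h : ¬(j = none ∧ q = 0)) (Z : P.gDC) (Y : D.Affine) :
    ⁅Z, P.mode j q Y⁆ = ∑ p : Fin (P.mult j), P.mode j (p + q) ⁅P.phi j p Z, Y⁆ := by
  induction Z using P.gDC_ind with
  | h0 => simp
  | ha x y hx hy => simp only [map_add, add_lie, hx, hy, Finset.sum_add_distrib]
  | ht u w =>
    simp only [phi_tm, smul_lie, map_smul]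
    rw [mode_def, lie_smul, lie_sub, tm_lie, tm_lie, P.lie_realElt h, P.lie_realElt h, tm_sum,
      tm_sum, ← Finset.sum_sub_distrib, Finset.smul_sum]
    refine Finset.sum_congr rfl fun p _ => ?_
    rw [mode_def, smul_comm u, smul_sub u, smul_tm, smul_tm, lie_smul]

/-- For `e = 1` this is the filtration `F_n` of the complexification, spanned by the modes of
elements of `F_n` and the conjugate modes of elements of the conjugate filtration (at points with
non-trivial stabiliser the latter are also of the former kind); for `e = -1` it is the image of this
filtration under the conjugation. -/
def FD (e : ℤ) (n : ℕ) : Submodule ℂ P.gDC :=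
  Submodule.span ℂ ({Z | ∃ i p, ∃ X ∈ D.F e n, Z = P.mode i p X} ∪
    {Z | ∃ i p, ∃ X ∈ D.F (-e) n, Z = P.modeBar i p X})

theorem mode_mem_FD {e : ℤ} {n : ℕ} (i : Option ℂ) (p : ℕ) {X : D.Affine} (hX : X ∈ D.F e n) :
    P.mode i p X ∈ P.FD e n := Submodule.subset_span (Or.inl ⟨i, p, X, hX, rfl⟩)

theorem modeBar_mem_FD {e : ℤ} {n : ℕ} (i : Option ℂ) (p : ℕ) {X : D.Affine}
    (hX : X ∈ D.F (-e) n) : P.modeBar i p X ∈ P.FD e n :=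
  Submodule.subset_span (Or.inr ⟨i, p, X, hX, rfl⟩)

theorem FD_ind {e : ℤ} {n : ℕ} {C : P.gDC → Prop} (h0 : C 0)
    (h1 : ∀ i p X, X ∈ D.F e n → C (P.mode i p X))
    (h2 : ∀ i p X, X ∈ D.F (-e) n → C (P.modeBar i p X))
    (ha : ∀ Z W, C Z → C W → C (Z + W)) (hs : ∀ (a : ℂ) Z, C Z → C (a • Z))
    {Z : P.gDC} (hZ : Z ∈ P.FD e n) : C Z := by
  induction hZ using Submodule.span_induction with
  | zero => exact h0
  | add X X' _ _ h h' => exact ha _ _ h h'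
  | smul a X _ h => exact hs _ _ h
  | mem Z hZ =>
    rcases hZ with ⟨i, p, X, hX, rfl⟩ | ⟨i, p, X, hX, rfl⟩
    · exact h1 i p X hX
    · exact h2 i p X hX

theorem FD_anti {e : ℤ} {m n : ℕ} (h : m ≤ n) : P.FD e n ≤ P.FD e m := fun _ hZ =>
  P.FD_ind (zero_mem _) (fun i p _ hX => P.mode_mem_FD i p (D.F_anti h hX))
    (fun i p _ hX => P.modeBar_mem_FD i p (D.F_anti h hX)) (fun _ _ => add_mem)
    (fun a _ => Submodule.smul_mem _ a) hZ

theorem conjD_mem_FD {e : ℤ} {n : ℕ} {Z : P.gDC} (hZ : Z ∈ P.FD e n) :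
    P.conjD Z ∈ P.FD (-e) n :=
  P.FD_ind (C := fun Z => P.conjD Z ∈ P.FD (-e) n) (by rw [map_zero]; exact zero_mem _)
    (fun i p X hX => P.modeBar_mem_FD i p (by rwa [neg_neg]))
    (fun i p X hX => by
      rw [modeBar_def, conjD_conjD]
      exact P.mode_mem_FD i p hX)
    (fun Z W h h' => by rw [map_add]; exact add_mem h h')
    (fun a Z h => by rw [map_smulₛₗ]; exact Submodule.smul_mem _ _ h) hZ

/-- The filtration for `e = -1` is the conjugate of the one for `e = 1`. -/
theorem map_conjD_FD (n : ℕ) : (P.conjD '' (P.FD 1 n : Set P.gDC)) = P.FD (-1) n := by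
  ext Z
  constructor
  · rintro ⟨W, hW, rfl⟩
    exact P.conjD_mem_FD hW
  · intro hZ
    refine ⟨P.conjD Z, ?_, P.conjD_conjD Z⟩
    have := P.conjD_mem_FD hZ
    rwa [neg_neg] at this

theorem phi_mem {e : ℤ} {n : ℕ} {Z : P.gDC} (hZ : Z ∈ P.FD e n) (j : Option ℂ)
    (q : Fin (P.mult j)) : P.phi j q Z ∈ D.F e n := by
  classical
  refine P.FD_ind (C := fun Z => P.phi j q Z ∈ D.F e n) (by rw [map_zero]; exact zero_mem _)
    (fun i p X hX => ?_) (fun i p X hX => ?_)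
    (fun Z W h h' => by rw [map_add]; exact add_mem h h')
    (fun a Z h => by rw [map_smul]; exact Submodule.smul_mem _ _ h) hZ
  · rw [phi_mode]
    split_ifs
    · exact Submodule.smul_mem _ _ (D.avg_sub_mem i p hX)
    · exact zero_mem _
  · rw [phi_modeBar]
    split_ifs
    · have := D.avg_add_mem i p hX
      rw [neg_neg] at this
      exact Submodule.smul_mem _ _ this
    · exact zero_mem _

theorem lie_mode_mem {e : ℤ} {n : ℕ} (j : Option ℂ) (q : ℕ) {Z : P.gDC} {Y : D.Affine}
    (h : ∀ p, ⁅P.phi j p Z, Y⁆ ∈ D.F e n) : ⁅Z, P.mode j q Y⁆ ∈ P.FD e n := by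
  by_cases h0 : j = none ∧ q = 0
  · obtain ⟨rfl, rfl⟩ := h0
    rw [mode_none_zero, lie_zero]
    exact zero_mem _
  · rw [P.lie_mode h0]
    exact Submodule.sum_mem _ fun p _ => P.mode_mem_FD _ _ (h p)

theorem lie_modeBar_mem {e : ℤ} {n : ℕ} (j : Option ℂ) (q : ℕ) {Z : P.gDC} {Y : D.Affine}
    (h : ∀ p, ⁅P.phi j p (P.conjD Z), Y⁆ ∈ D.F (-e) n) : ⁅Z, P.modeBar j q Y⁆ ∈ P.FD e n := by
  have h1 : ⁅Z, P.modeBar j q Y⁆ = P.conjD ⁅P.conjD Z, P.mode j q Y⁆ := by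
    rw [conjD_lie, conjD_conjD, modeBar_def]
  rw [h1]
  have h2 := P.conjD_mem_FD (P.lie_mode_mem j q h)
  rwa [neg_neg] at h2

theorem lie_mem_FD {e : ℤ} (he : e ≠ 0) {n : ℕ} {Z W : P.gDC} (hZ : Z ∈ P.FD e n)
    (hW : W ∈ P.FD e n) : ⁅Z, W⁆ ∈ P.FD e n :=
  P.FD_ind (C := fun W => ⁅Z, W⁆ ∈ P.FD e n) (by rw [lie_zero]; exact zero_mem _)
    (fun i p X hX => P.lie_mode_mem i p fun q => D.lie_mem_F he (P.phi_mem hZ i q) hX)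
    (fun i p X hX => P.lie_modeBar_mem i p fun q =>
      D.lie_mem_F (neg_ne_zero.2 he) (P.phi_mem (P.conjD_mem_FD hZ) i q) hX)
    (fun W W' h h' => by rw [lie_add]; exact add_mem h h')
    (fun a W h => by rw [lie_smul]; exact Submodule.smul_mem _ _ h) hW

theorem exists_forall_phi {e : ℤ} (he : e = 1 ∨ e = -1) (Z : P.gDC) :
    ∃ N, ∀ j (p : Fin (P.mult j)), ∀ n, ∀ Y ∈ D.F e (n + N), ⁅P.phi j p Z, Y⁆ ∈ D.F e n := by
  classical
  have h1 : ∀ j, ∃ N, ∀ p : Fin (P.mult j), ∀ n, ∀ Y ∈ D.F e (n + N),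
      ⁅P.phi j p Z, Y⁆ ∈ D.F e n := by
    intro j
    choose N hN using fun p : Fin (P.mult j) => D.exists_lie_mem_F he (P.phi j p Z)
    refine ⟨∑ p, N p, fun p n Y hY => hN p n Y (D.F_anti ?_ hY)⟩
    have := Finset.single_le_sum (fun i _ => Nat.zero_le (N i)) (Finset.mem_univ p)
    omega
  choose N hN using h1
  refine ⟨N none + ∑ x ∈ P.z, N (some x), fun j p n Y hY => hN j p n Y (D.F_anti ?_ hY)⟩
  cases j with
  | none => omega
  | some x =>
    have hx : x ∈ P.z := (P.mult_fin x).1 (Nat.one_le_iff_ne_zero.2 fun h0 => by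
      have := p.2
      omega)
    have := Finset.single_le_sum (f := fun x => N (some x)) (fun i _ => Nat.zero_le _) hx
    omega

theorem exists_lie_mem_FD {e : ℤ} (he : e = 1 ∨ e = -1) (Z : P.gDC) :
    ∃ N, ∀ n, ∀ W ∈ P.FD e (n + N), ⁅Z, W⁆ ∈ P.FD e n := by
  obtain ⟨N, hN⟩ := P.exists_forall_phi he Z
  obtain ⟨N', hN'⟩ := P.exists_forall_phi (e := -e) (by omega) (P.conjD Z)
  refine ⟨N + N', fun n W hW => ?_⟩
  exact P.FD_ind (C := fun W => ⁅Z, W⁆ ∈ P.FD e n) (by rw [lie_zero]; exact zero_mem _)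
    (fun i p X hX => P.lie_mode_mem i p fun q => hN i q n X (D.F_anti (by omega) hX))
    (fun i p X hX => P.lie_modeBar_mem i p fun q => hN' i q n X (D.F_anti (by omega) hX))
    (fun W W' h h' => by rw [lie_add]; exact add_mem h h')
    (fun a W h => by rw [lie_smul]; exact Submodule.smul_mem _ _ h) hW

end GaudinPoints

/-! ### The Poisson bracket on a symmetric algebra -/

section Poisson

variable {V : Type*} [AddCommGroup V] [Module ℂ V]

theorem sym_ind {C : SymmetricAlgebra ℂ V → Prop}
    (h1 : ∀ a : ℂ, C (algebraMap ℂ (SymmetricAlgebra ℂ V) a))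
    (h2 : ∀ v, C (SymmetricAlgebra.ι ℂ V v)) (h3 : ∀ f g, C f → C g → C (f * g))
    (h4 : ∀ f g, C f → C g → C (f + g)) (f : SymmetricAlgebra ℂ V) : C f :=
  SymmetricAlgebra.induction ℂ V h1 h2 h3 h4 f

/-- The algebra homomorphism `f ↦ f + ε d f` attached to a linear map `φ`, where `d` is the
derivation extending `φ`. -/
def derHom (φ : V →ₗ[ℂ] SymmetricAlgebra ℂ V) :
    SymmetricAlgebra ℂ V →ₐ[ℂ] TrivSqZeroExt (SymmetricAlgebra ℂ V) (SymmetricAlgebra ℂ V) :=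
  SymmetricAlgebra.lift
    ((TrivSqZeroExt.inlAlgHom ℂ (SymmetricAlgebra ℂ V) (SymmetricAlgebra ℂ V)).toLinearMap ∘ₗ
      SymmetricAlgebra.ι ℂ V + (TrivSqZeroExt.inrHom (SymmetricAlgebra ℂ V)
        (SymmetricAlgebra ℂ V)).restrictScalars ℂ ∘ₗ φ)

theorem derHom_fst (φ : V →ₗ[ℂ] SymmetricAlgebra ℂ V) (f : SymmetricAlgebra ℂ V) :
    (derHom φ f).fst = f := by
  induction f using sym_ind with
  | h1 a => rw [AlgHom.commutes]; rfl
  | h2 v => simp [derHom]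
  | h3 f g hf hg => rw [map_mul, TrivSqZeroExt.fst_mul, hf, hg]
  | h4 f g hf hg => rw [map_add, TrivSqZeroExt.fst_add, hf, hg]

/-- The derivation of the symmetric algebra extending a linear map. -/
def der (φ : V →ₗ[ℂ] SymmetricAlgebra ℂ V) (f : SymmetricAlgebra ℂ V) : SymmetricAlgebra ℂ V :=
  (derHom φ f).snd

@[simp] theorem der_algebraMap (φ : V →ₗ[ℂ] SymmetricAlgebra ℂ V) (a : ℂ) :
    der φ (algebraMap ℂ _ a) = 0 := by
  rw [der, AlgHom.commutes]; rfl

@[simp] theorem der_ι (φ : V →ₗ[ℂ] SymmetricAlgebra ℂ V) (v : V) :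
    der φ (SymmetricAlgebra.ι ℂ V v) = φ v := by
  simp [der, derHom]

theorem der_mul (φ : V →ₗ[ℂ] SymmetricAlgebra ℂ V) (f g : SymmetricAlgebra ℂ V) :
    der φ (f * g) = f * der φ g + g * der φ f := by
  rw [der, map_mul, TrivSqZeroExt.snd_mul, derHom_fst, derHom_fst,
    smul_eq_mul, op_smul_eq_mul, mul_comm _ g]
  rfl

theorem der_add (φ : V →ₗ[ℂ] SymmetricAlgebra ℂ V) (f g : SymmetricAlgebra ℂ V) :
    der φ (f + g) = der φ f + der φ g := by
  rw [der, map_add, TrivSqZeroExt.snd_add]; rfl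

theorem der_smul (φ : V →ₗ[ℂ] SymmetricAlgebra ℂ V) (a : ℂ) (f : SymmetricAlgebra ℂ V) :
    der φ (a • f) = a • der φ f := by
  rw [der, map_smul, TrivSqZeroExt.snd_smul]; rfl

theorem der_lin_add (φ ψ : V →ₗ[ℂ] SymmetricAlgebra ℂ V) (f : SymmetricAlgebra ℂ V) :
    der (φ + ψ) f = der φ f + der ψ f := by
  induction f using sym_ind with
  | h1 a => simp
  | h2 v => simp
  | h3 f g hf hg => simp only [der_mul, hf, hg]; ring
  | h4 f g hf hg => simp only [der_add, hf, hg]; ring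

theorem der_lin_smul (a : ℂ) (φ : V →ₗ[ℂ] SymmetricAlgebra ℂ V) (f : SymmetricAlgebra ℂ V) :
    der (a • φ) f = a • der φ f := by
  induction f using sym_ind with
  | h1 a => simp
  | h2 v => simp
  | h3 f g hf hg => simp only [der_mul, hf, hg, smul_add, mul_smul_comm]
  | h4 f g hf hg => simp only [der_add, hf, hg, smul_add]

end Poisson

section Poisson

variable {L : Type*} [LieRing L] [LieAlgebra ℂ L]

/-- The linear map `Y ↦ [X, Y]` with values in the symmetric algebra. -/
def adS (X : L) : L →ₗ[ℂ] SymmetricAlgebra ℂ L :=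
  SymmetricAlgebra.ι ℂ L ∘ₗ (LieModule.toEnd ℂ L L X : L →ₗ[ℂ] L)

theorem adS_apply (X Y : L) : adS X Y = SymmetricAlgebra.ι ℂ L ⁅X, Y⁆ := rfl

/-- The linear map `X ↦ {X, g}` for `X` in the Lie algebra and `g` in the symmetric algebra. -/
def hamL (g : SymmetricAlgebra ℂ L) : L →ₗ[ℂ] SymmetricAlgebra ℂ L where
  toFun X := der (adS X) g
  map_add' X Y := by
    rw [← der_lin_add]
    congr 1
    ext Z
    simp [adS]
  map_smul' a X := by
    rw [RingHom.id_apply, ← der_lin_smul]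
    congr 1
    ext Z
    simp [adS]

/-- The Poisson bracket on the symmetric algebra of a Lie algebra: the biderivation with
`{X, Y} = [X, Y]` for `X`, `Y` in the Lie algebra. -/
def pbS : SymmetricAlgebra ℂ L →ₗ[ℂ] SymmetricAlgebra ℂ L →ₗ[ℂ] SymmetricAlgebra ℂ L :=
  LinearMap.mk₂ ℂ (fun f g => der (hamL g) f)
    (fun f f' g => der_add _ f f') (fun a f g => der_smul _ a f)
    (fun f g g' => by
      rw [← der_lin_add]
      congr 1
      ext X
      exact der_add _ g g')
    (fun a f g => by
      rw [← der_lin_smul]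
      congr 1
      ext X
      exact der_smul _ a g)

theorem pbS_def (f g : SymmetricAlgebra ℂ L) : pbS f g = der (hamL g) f := rfl

theorem pbS_ι (X : L) (g : SymmetricAlgebra ℂ L) :
    pbS (SymmetricAlgebra.ι ℂ L X) g = der (adS X) g := by
  rw [pbS_def, der_ι]; rfl

theorem pbS_ι_ι (X Y : L) : pbS (SymmetricAlgebra.ι ℂ L X) (SymmetricAlgebra.ι ℂ L Y) =
    SymmetricAlgebra.ι ℂ L ⁅X, Y⁆ := by
  rw [pbS_ι, der_ι, adS_apply]

theorem algebraMap_pbS (a : ℂ) (g : SymmetricAlgebra ℂ L) : pbS (algebraMap ℂ _ a) g = 0 := by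
  rw [pbS_def, der_algebraMap]

theorem pbS_algebraMap (f : SymmetricAlgebra ℂ L) (a : ℂ) : pbS f (algebraMap ℂ _ a) = 0 := by
  induction f using sym_ind with
  | h1 b => exact algebraMap_pbS _ _
  | h2 v => rw [pbS_ι, der_algebraMap]
  | h3 f g hf hg => rw [pbS_def] at *; rw [der_mul, hf, hg, mul_zero, mul_zero, add_zero]
  | h4 f g hf hg => rw [map_add, LinearMap.add_apply, hf, hg, add_zero]

theorem mul_pbS (f f' g : SymmetricAlgebra ℂ L) :
    pbS (f * f') g = f * pbS f' g + f' * pbS f g := der_mul _ f f'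

theorem pbS_mul (f g g' : SymmetricAlgebra ℂ L) :
    pbS f (g * g') = g * pbS f g' + g' * pbS f g := by
  induction f using sym_ind with
  | h1 b => simp only [algebraMap_pbS, mul_zero, add_zero]
  | h2 v => simp only [pbS_ι, der_mul]
  | h3 f f' hf hf' => simp only [mul_pbS, hf, hf']; ring
  | h4 f f' hf hf' => simp only [map_add, LinearMap.add_apply, hf, hf']; ring

theorem pbS_skew (f g : SymmetricAlgebra ℂ L) : pbS f g = -pbS g f := by
  induction f using sym_ind with
  | h1 b => rw [algebraMap_pbS, pbS_algebraMap, neg_zero]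
  | h3 f f' hf hf' => rw [mul_pbS, pbS_mul, hf, hf']; ring
  | h4 f f' hf hf' => rw [map_add, LinearMap.add_apply, map_add, hf, hf', neg_add]
  | h2 X =>
    induction g using sym_ind with
    | h1 b => rw [algebraMap_pbS, pbS_algebraMap, neg_zero]
    | h3 f f' hf hf' => rw [mul_pbS, pbS_mul, hf, hf']; ring
    | h4 f f' hf hf' => rw [map_add, map_add, LinearMap.add_apply, hf, hf', neg_add]
    | h2 Y => rw [pbS_ι_ι, pbS_ι_ι, ← lie_skew, map_neg]

theorem pbS_jacobi (f g h : SymmetricAlgebra ℂ L) :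
    pbS f (pbS g h) = pbS (pbS f g) h + pbS g (pbS f h) := by
  induction f using sym_ind with
  | h1 b => simp only [algebraMap_pbS, map_zero, LinearMap.zero_apply, add_zero]
  | h3 f f' hf hf' => 
    have e := pbS_skew g f
    have e' := pbS_skew g f'
    simp only [mul_pbS, map_add, LinearMap.add_apply, pbS_mul, hf, hf', e, e']
    ring
  | h4 f f' hf hf' => simp only [map_add, LinearMap.add_apply, hf, hf']; ring
  | h2 X =>
    induction g using sym_ind with
    | h1 b => simp only [algebraMap_pbS, pbS_algebraMap, map_zero, LinearMap.zero_apply, add_zero]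
    | h3 f f' hf hf' => simp only [mul_pbS, map_add, LinearMap.add_apply, pbS_mul, hf, hf']; ring
    | h4 f f' hf hf' => simp only [map_add, LinearMap.add_apply, hf, hf']; ring
    | h2 Y =>
      induction h using sym_ind with
      | h1 b => simp only [pbS_algebraMap, map_zero, LinearMap.zero_apply, add_zero]
      | h3 f f' hf hf' => simp only [map_add, LinearMap.add_apply, pbS_mul, hf, hf']; ring
      | h4 f f' hf hf' => simp only [map_add, LinearMap.add_apply, hf, hf']; ring
      | h2 Z => simp only [pbS_ι_ι, ← map_add]; rw [leibniz_lie]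

/-- The bracket with an element mapping the generators of one ideal into another ideal maps the
former into the latter, if the former is contained in the latter. -/
theorem pbS_ι_span {X : L} {A B : Submodule ℂ L} (hAB : A ≤ B) (h : ∀ Y ∈ A, ⁅X, Y⁆ ∈ B)
    {g : SymmetricAlgebra ℂ L}
    (hg : g ∈ Ideal.span (SymmetricAlgebra.ι ℂ L '' (A : Set L))) :
    pbS (SymmetricAlgebra.ι ℂ L X) g ∈ Ideal.span (SymmetricAlgebra.ι ℂ L '' (B : Set L)) := by
  induction hg using Submodule.span_induction with
  | zero => rw [map_zero]; exact zero_mem _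
  | add f f' _ _ hf hf' => rw [map_add]; exact add_mem hf hf'
  | mem f hf =>
    obtain ⟨Y, hY, rfl⟩ := hf
    rw [pbS_ι_ι]
    exact Ideal.subset_span ⟨_, h Y hY, rfl⟩
  | smul a f hf hf' =>
    rw [smul_eq_mul, pbS_mul]
    refine add_mem (Ideal.mul_mem_left _ _ hf') (Ideal.mul_mem_right _ _ ?_)
    exact Ideal.span_mono (Set.image_mono hAB) hf

theorem pbS_span_span {A : Submodule ℂ L} (h : ∀ X ∈ A, ∀ Y ∈ A, ⁅X, Y⁆ ∈ A)
    {f g : SymmetricAlgebra ℂ L}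
    (hf : f ∈ Ideal.span (SymmetricAlgebra.ι ℂ L '' (A : Set L)))
    (hg : g ∈ Ideal.span (SymmetricAlgebra.ι ℂ L '' (A : Set L))) :
    pbS f g ∈ Ideal.span (SymmetricAlgebra.ι ℂ L '' (A : Set L)) := by
  induction hf using Submodule.span_induction with
  | zero => rw [map_zero]; exact zero_mem _
  | add f f' _ _ hf hf' => rw [map_add]; exact add_mem hf hf'
  | mem f hf =>
    obtain ⟨X, hX, rfl⟩ := hf
    exact pbS_ι_span le_rfl (h X hX) hg
  | smul a f hf hf' =>
    rw [smul_eq_mul, mul_pbS]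
    exact add_mem (Ideal.mul_mem_left _ _ hf') (Ideal.mul_mem_right _ _ hf)

end Poisson

/-! ### Completions -/

section Completion

variable {V W U : Type*} [AddCommGroup V] [Module ℂ V] [AddCommGroup W] [Module ℂ W]
  [AddCommGroup U] [Module ℂ U]
  {QV QW QU : ℕ → Type*} [∀ n, AddCommGroup (QV n)] [∀ n, Module ℂ (QV n)]
  [∀ n, AddCommGroup (QW n)] [∀ n, Module ℂ (QW n)]
  [∀ n, AddCommGroup (QU n)] [∀ n, Module ℂ (QU n)]

/-- The completion of `V` with respect to quotient maps `π n : V → V / F_n` of a descending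
filtration: the inverse limit of the `V / F_n`, that is, the sequences of classes which up to any
finite stage are the classes of one element of `V`. -/
def Compl (π : ∀ n, V →ₗ[ℂ] QV n) : Submodule ℂ (∀ n, QV n) where
  carrier := {x | ∀ n, ∃ a, ∀ k ≤ n, π k a = x k}
  add_mem' {x y} hx hy n := by
    obtain ⟨a, ha⟩ := hx n
    obtain ⟨b, hb⟩ := hy n
    exact ⟨a + b, fun k hk => by rw [map_add, ha k hk, hb k hk]; rfl⟩
  zero_mem' n := ⟨0, fun k _ => by rw [map_zero]; rfl⟩
  smul_mem' c x hx n := by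
    obtain ⟨a, ha⟩ := hx n
    exact ⟨c • a, fun k hk => by rw [map_smul, ha k hk]; rfl⟩

/-- `a` represents the sequence `x` up to stage `m`. -/
def Near (π : ∀ n, V →ₗ[ℂ] QV n) (x : ∀ n, QV n) (m : ℕ) (a : V) : Prop := ∀ k ≤ m, π k a = x k

theorem Near.mono {π : ∀ n, V →ₗ[ℂ] QV n} {x : ∀ n, QV n} {m m' : ℕ} {a : V}
    (h : Near π x m a) (hm : m' ≤ m) : Near π x m' a := fun k hk => h k (hk.trans hm)

theorem Near.add {π : ∀ n, V →ₗ[ℂ] QV n} {x y : ∀ n, QV n} {m : ℕ} {a b : V}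
    (h : Near π x m a) (h' : Near π y m b) : Near π (x + y) m (a + b) := fun k hk => by
  rw [map_add, h k hk, h' k hk]; rfl

theorem Near.smul {π : ∀ n, V →ₗ[ℂ] QV n} {x : ∀ n, QV n} {m : ℕ} {a : V} (c : ℂ)
    (h : Near π x m a) : Near π (c • x) m (c • a) := fun k hk => by
  rw [map_smul, h k hk]; rfl

theorem Near.sub {π : ∀ n, V →ₗ[ℂ] QV n} {x : ∀ n, QV n} {m : ℕ} {a b : V}
    (h : Near π x m a) (h' : Near π x m b) : ∀ k ≤ m, π k (a - b) = 0 := fun k hk => by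
  rw [map_sub, h k hk, h' k hk, sub_self]

/-- The element of the completion defined by an element of `V`. -/
def emb (π : ∀ n, V →ₗ[ℂ] QV n) : V →ₗ[ℂ] Compl π where
  toFun a := ⟨fun n => π n a, fun _ => ⟨a, fun _ _ => rfl⟩⟩
  map_add' a b := Subtype.ext (funext fun n => map_add (π n) a b)
  map_smul' c a := Subtype.ext (funext fun n => map_smul (π n) c a)

/-- Continuity of a linear map at the origin, for the topologies defined by the filtrations. -/
def ContLin (πV : ∀ n, V →ₗ[ℂ] QV n) (πU : ∀ n, U →ₗ[ℂ] QU n) (f : V →ₗ[ℂ] U) : Prop :=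
  ∀ n, ∃ m, ∀ a, (∀ k ≤ m, πV k a = 0) → πU n (f a) = 0

/-- Continuity of a bilinear map for the topologies defined by the filtrations: at the origin, and
separately in each variable. -/
structure ContBil (πV : ∀ n, V →ₗ[ℂ] QV n) (πW : ∀ n, W →ₗ[ℂ] QW n) (πU : ∀ n, U →ₗ[ℂ] QU n)
    (B : V →ₗ[ℂ] W →ₗ[ℂ] U) : Prop where
  joint : ∀ n, ∃ m, ∀ a b, (∀ k ≤ m, πV k a = 0) → (∀ k ≤ m, πW k b = 0) → πU n (B a b) = 0
  right : ∀ a n, ∃ m, ∀ b, (∀ k ≤ m, πW k b = 0) → πU n (B a b) = 0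
  left : ∀ b n, ∃ m, ∀ a, (∀ k ≤ m, πV k a = 0) → πU n (B a b) = 0

section Lin

variable {πV : ∀ n, V →ₗ[ℂ] QV n} {πU : ∀ n, U →ₗ[ℂ] QU n} {f : V →ₗ[ℂ] U}

theorem ContLin.exists_level (hf : ContLin πV πU f) (x : Compl πV) :
    ∃ z : Compl πU, ∀ n, ∃ M, ∀ a, Near πV x.1 M a → Near πU z.1 n (f a) := by
  choose M hM using hf
  choose A hA using x.2
  have key : ∀ n a, Near πV x.1 (M n) a → πU n (f a) = πU n (f (A (M n))) := by
    intro n a ha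
    have := hM n (a - A (M n)) (ha.sub (hA (M n)))
    rwa [map_sub, map_sub, sub_eq_zero] at this
  have hsup : ∀ n, ∃ N, ∀ k ≤ n, M k ≤ N := fun n =>
    ⟨∑ k ∈ Finset.range (n + 1), M k, fun k hk =>
      Finset.single_le_sum (fun i _ => Nat.zero_le (M i)) (Finset.mem_range.2 (by omega))⟩
  have hnear : ∀ n, ∃ N, ∀ a, Near πV x.1 N a →
      Near πU (fun n => πU n (f (A (M n)))) n (f a) := by
    intro n
    obtain ⟨N, hN⟩ := hsup n
    exact ⟨N, fun a ha k hk => key k a (ha.mono (hN k hk))⟩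
  refine ⟨⟨fun n => πU n (f (A (M n))), fun n => ?_⟩, hnear⟩
  obtain ⟨N, hN⟩ := hnear n
  exact ⟨f (A N), hN _ (hA N)⟩

theorem near_unique {x : Compl πV} {z z' : Compl πU}
    (h : ∀ n, ∃ M, ∀ a, Near πV x.1 M a → Near πU z.1 n (f a))
    (h' : ∀ n, ∃ M, ∀ a, Near πV x.1 M a → Near πU z'.1 n (f a)) : z = z' := by
  refine Subtype.ext (funext fun n => ?_)
  obtain ⟨M, hM⟩ := h n
  obtain ⟨M', hM'⟩ := h' n
  obtain ⟨a, ha⟩ := x.2 (max M M')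
  have ha : Near πV x.1 (max M M') a := ha
  rw [← hM a (ha.mono (le_max_left _ _)) n le_rfl, ← hM' a (ha.mono (le_max_right _ _)) n le_rfl]

/-- The extension of a continuous linear map to the completions. -/
def extLin (hf : ContLin πV πU f) : Compl πV →ₗ[ℂ] Compl πU where
  toFun x := (hf.exists_level x).choose
  map_add' x y := by
    refine near_unique (f := f) (hf.exists_level (x + y)).choose_spec fun n => ?_
    obtain ⟨M, hM⟩ := (hf.exists_level x).choose_spec n
    obtain ⟨M', hM'⟩ := (hf.exists_level y).choose_spec n
    refine ⟨max M M', fun c hc => ?_⟩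
    obtain ⟨a, ha⟩ := x.2 (max M M')
    have ha : Near πV x.1 (max M M') a := ha
    have hb : Near πV y.1 (max M M') (c - a) := fun k hk => by
      rw [map_sub, hc k hk, ha k hk]
      exact add_sub_cancel_left (x.1 k) (y.1 k)
    have := (hM a (ha.mono (le_max_left _ _))).add (hM' _ (hb.mono (le_max_right _ _)))
    rw [← map_add, add_sub_cancel] at this
    exact this
  map_smul' c x := by
    refine near_unique (f := f) (hf.exists_level (c • x)).choose_spec fun n => ?_
    obtain ⟨M, hM⟩ := (hf.exists_level x).choose_spec n
    obtain ⟨M', hM'⟩ := hf n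
    obtain ⟨N, hN⟩ := (hf.exists_level (c • x)).choose_spec n
    obtain ⟨a, ha⟩ := x.2 (max M N)
    have ha : Near πV x.1 (max M N) a := ha
    have h1 := (hM a (ha.mono (le_max_left _ _))).smul c
    have h2 := hN (c • a) ((ha.smul c).mono (le_max_right _ _))
    refine ⟨N, fun b hb k hk => ?_⟩
    rw [hN b hb k hk, ← h2 k hk, map_smul f]
    exact h1 k hk

theorem extLin_spec (hf : ContLin πV πU f) (x : Compl πV) (n : ℕ) :
    ∃ M, ∀ a, Near πV x.1 M a → Near πU (extLin hf x).1 n (f a) :=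
  (hf.exists_level x).choose_spec n

end Lin

section Bil

variable {πV : ∀ n, V →ₗ[ℂ] QV n} {πW : ∀ n, W →ₗ[ℂ] QW n} {πU : ∀ n, U →ₗ[ℂ] QU n}
  {B : V →ₗ[ℂ] W →ₗ[ℂ] U}

theorem ContBil.exists_level (hB : ContBil πV πW πU B) (x : Compl πV) (y : Compl πW) :
    ∃ z : Compl πU, ∀ n, ∃ M, ∀ a b, Near πV x.1 M a → Near πW y.1 M b →
      Near πU z.1 n (B a b) := by
  have key : ∀ n, ∃ M, ∀ a b a' b', Near πV x.1 M a → Near πW y.1 M b → Near πV x.1 M a' →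
      Near πW y.1 M b' → πU n (B a b) = πU n (B a' b') := by
    intro n
    obtain ⟨m, hm⟩ := hB.joint n
    obtain ⟨a₀, ha₀⟩ := x.2 m
    obtain ⟨b₀, hb₀⟩ := y.2 m
    obtain ⟨m₁, hm₁⟩ := hB.right a₀ n
    obtain ⟨m₂, hm₂⟩ := hB.left b₀ n
    refine ⟨m + m₁ + m₂, fun a b a' b' ha hb ha' hb' => ?_⟩
    have e1 := hm (a - a') (b - b₀) ((ha.mono (by omega)).sub (ha'.mono (by omega)))
      ((hb.mono (by omega : m ≤ _)).sub hb₀)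
    have e2 := hm₂ (a - a') ((ha.mono (by omega)).sub (ha'.mono (by omega)))
    have e3 := hm (a' - a₀) (b - b') ((ha'.mono (by omega : m ≤ _)).sub ha₀)
      ((hb.mono (by omega)).sub (hb'.mono (by omega)))
    have e4 := hm₁ (b - b') ((hb.mono (by omega)).sub (hb'.mono (by omega)))
    simp only [map_sub, LinearMap.sub_apply] at e1 e2 e3 e4
    have e5 : πU n (B a b) - πU n (B a' b') =
        (πU n (B a b) - πU n (B a' b) - (πU n (B a b₀) - πU n (B a' b₀))) +
        (πU n (B a b₀) - πU n (B a' b₀)) +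
        (πU n (B a' b) - πU n (B a₀ b) - (πU n (B a' b') - πU n (B a₀ b'))) +
        (πU n (B a₀ b) - πU n (B a₀ b')) := by abel
    rw [← sub_eq_zero, e5, e1, e2, e3, e4]
    simp
  choose M hM using key
  choose A hA using x.2
  choose C hC using y.2
  have hsup : ∀ n, ∃ N, ∀ k ≤ n, M k ≤ N := fun n =>
    ⟨∑ k ∈ Finset.range (n + 1), M k, fun k hk =>
      Finset.single_le_sum (fun i _ => Nat.zero_le (M i)) (Finset.mem_range.2 (by omega))⟩
  have hnear : ∀ n, ∃ N, ∀ a b, Near πV x.1 N a → Near πW y.1 N b →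
      Near πU (fun n => πU n (B (A (M n)) (C (M n)))) n (B a b) := by
    intro n
    obtain ⟨N, hN⟩ := hsup n
    exact ⟨N, fun a b ha hb k hk => hM k a b _ _ (ha.mono (hN k hk)) (hb.mono (hN k hk))
      (hA _) (hC _)⟩
  refine ⟨⟨fun n => πU n (B (A (M n)) (C (M n))), fun n => ?_⟩, hnear⟩
  obtain ⟨N, hN⟩ := hnear n
  exact ⟨B (A N) (C N), hN _ _ (hA N) (hC N)⟩

theorem near_unique₂ {x : Compl πV} {y : Compl πW} {z z' : Compl πU}
    (h : ∀ n, ∃ M, ∀ a b, Near πV x.1 M a → Near πW y.1 M b → Near πU z.1 n (B a b))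
    (h' : ∀ n, ∃ M, ∀ a b, Near πV x.1 M a → Near πW y.1 M b → Near πU z'.1 n (B a b)) :
    z = z' := by
  refine Subtype.ext (funext fun n => ?_)
  obtain ⟨M, hM⟩ := h n
  obtain ⟨M', hM'⟩ := h' n
  obtain ⟨a, ha⟩ := x.2 (max M M')
  obtain ⟨b, hb⟩ := y.2 (max M M')
  have ha : Near πV x.1 (max M M') a := ha
  have hb : Near πW y.1 (max M M') b := hb
  rw [← hM a b (ha.mono (le_max_left _ _)) (hb.mono (le_max_left _ _)) n le_rfl,
    ← hM' a b (ha.mono (le_max_right _ _)) (hb.mono (le_max_right _ _)) n le_rfl]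

/-- The value of the extension of a continuous bilinear map to the completions. -/
def extVal (hB : ContBil πV πW πU B) (x : Compl πV) (y : Compl πW) : Compl πU :=
  (hB.exists_level x y).choose

theorem extVal_spec (hB : ContBil πV πW πU B) (x : Compl πV) (y : Compl πW) (n : ℕ) :
    ∃ M, ∀ a b, Near πV x.1 M a → Near πW y.1 M b → Near πU (extVal hB x y).1 n (B a b) :=
  (hB.exists_level x y).choose_spec n

theorem extVal_component (hB : ContBil πV πW πU B) (x : Compl πV) (y : Compl πW) (n : ℕ) :
    ∃ M, ∀ a b, Near πV x.1 M a → Near πW y.1 M b → (extVal hB x y).1 n = πU n (B a b) := by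
  obtain ⟨M, hM⟩ := extVal_spec hB x y n
  exact ⟨M, fun a b ha hb => (hM a b ha hb n le_rfl).symm⟩

/-- The extension of a continuous bilinear map to the completions. -/
def extBil (hB : ContBil πV πW πU B) : Compl πV →ₗ[ℂ] Compl πW →ₗ[ℂ] Compl πU :=
  LinearMap.mk₂ ℂ (extVal hB)
    (fun x x' y => by
      refine Subtype.ext (funext fun n => ?_)
      obtain ⟨M₁, h₁⟩ := extVal_component hB (x + x') y n
      obtain ⟨M₂, h₂⟩ := extVal_component hB x y n
      obtain ⟨M₃, h₃⟩ := extVal_component hB x' y n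
      obtain ⟨a, ha⟩ := x.2 (M₁ + M₂ + M₃)
      obtain ⟨a', ha'⟩ := x'.2 (M₁ + M₂ + M₃)
      obtain ⟨b, hb⟩ := y.2 (M₁ + M₂ + M₃)
      have ha : Near πV x.1 _ a := ha
      have ha' : Near πV x'.1 _ a' := ha'
      have hb : Near πW y.1 _ b := hb
      show _ = (extVal hB x y).1 n + (extVal hB x' y).1 n
      rw [h₁ _ _ ((ha.add ha').mono (by omega)) (hb.mono (by omega)),
        h₂ _ _ (ha.mono (by omega)) (hb.mono (by omega)),
        h₃ _ _ (ha'.mono (by omega)) (hb.mono (by omega)), map_add, LinearMap.add_apply, map_add])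
    (fun c x y => by
      refine Subtype.ext (funext fun n => ?_)
      obtain ⟨M₁, h₁⟩ := extVal_component hB (c • x) y n
      obtain ⟨M₂, h₂⟩ := extVal_component hB x y n
      obtain ⟨a, ha⟩ := x.2 (M₁ + M₂)
      obtain ⟨b, hb⟩ := y.2 (M₁ + M₂)
      have ha : Near πV x.1 _ a := ha
      have hb : Near πW y.1 _ b := hb
      show _ = c • (extVal hB x y).1 n
      rw [h₁ _ _ ((ha.smul c).mono (by omega)) (hb.mono (by omega)),
        h₂ _ _ (ha.mono (by omega)) (hb.mono (by omega)), map_smul, LinearMap.smul_apply, map_smul])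
    (fun x y y' => by
      refine Subtype.ext (funext fun n => ?_)
      obtain ⟨M₁, h₁⟩ := extVal_component hB x (y + y') n
      obtain ⟨M₂, h₂⟩ := extVal_component hB x y n
      obtain ⟨M₃, h₃⟩ := extVal_component hB x y' n
      obtain ⟨a, ha⟩ := x.2 (M₁ + M₂ + M₃)
      obtain ⟨b, hb⟩ := y.2 (M₁ + M₂ + M₃)
      obtain ⟨b', hb'⟩ := y'.2 (M₁ + M₂ + M₃)
      have ha : Near πV x.1 _ a := ha
      have hb : Near πW y.1 _ b := hb
      have hb' : Near πW y'.1 _ b' := hb'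
      show _ = (extVal hB x y).1 n + (extVal hB x y').1 n
      rw [h₁ _ _ (ha.mono (by omega)) ((hb.add hb').mono (by omega)),
        h₂ _ _ (ha.mono (by omega)) (hb.mono (by omega)),
        h₃ _ _ (ha.mono (by omega)) (hb'.mono (by omega)), map_add, map_add])
    (fun c x y => by
      refine Subtype.ext (funext fun n => ?_)
      obtain ⟨M₁, h₁⟩ := extVal_component hB x (c • y) n
      obtain ⟨M₂, h₂⟩ := extVal_component hB x y n
      obtain ⟨a, ha⟩ := x.2 (M₁ + M₂)
      obtain ⟨b, hb⟩ := y.2 (M₁ + M₂)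
      have ha : Near πV x.1 _ a := ha
      have hb : Near πW y.1 _ b := hb
      show _ = c • (extVal hB x y).1 n
      rw [h₁ _ _ (ha.mono (by omega)) ((hb.smul c).mono (by omega)),
        h₂ _ _ (ha.mono (by omega)) (hb.mono (by omega)), map_smul, map_smul])

end Bil

end Completion

namespace GaudinPoints

variable {T : ℕ} [NeZero T] {𝔤 : Type*} [LieRing 𝔤] [LieAlgebra ℂ 𝔤] {D : DihedralLie T 𝔤}
  (P : GaudinPoints D)

/-! ### The algebra of formal observables -/

/-- The symmetric algebra of the complexified Takiff algebra. -/
abbrev S : Type _ := SymmetricAlgebra ℂ P.gDC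

/-- The ideal generated by the subspace `FD e n`. -/
def FI (e : ℤ) (n : ℕ) : Ideal P.S :=
  Ideal.span (SymmetricAlgebra.ι ℂ P.gDC '' (P.FD e n : Set P.gDC))

/-- The filtration of the symmetric algebra by the ideals `F_n S ∩ c(F_n) S`. -/
def FS (n : ℕ) : Ideal P.S := P.FI 1 n ⊓ P.FI (-1) n

theorem FI_anti {e : ℤ} {m n : ℕ} (h : m ≤ n) : P.FI e n ≤ P.FI e m :=
  Ideal.span_mono (Set.image_mono (P.FD_anti h))

/-- The quotient maps of the filtration. -/
def πS (n : ℕ) : P.S →ₗ[ℂ] P.S ⧸ P.FS n := (Ideal.Quotient.mkₐ ℂ (P.FS n)).toLinearMap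

theorem πS_eq_zero {n : ℕ} {f : P.S} : P.πS n f = 0 ↔ f ∈ P.FS n :=
  Ideal.Quotient.eq_zero_iff_mem

theorem πS_mul (n : ℕ) (f g : P.S) : P.πS n (f * g) = P.πS n f * P.πS n g :=
  map_mul (Ideal.Quotient.mkₐ ℂ (P.FS n)) f g

/-- The inverse limit of the quotients of the symmetric algebra by the ideals of its filtration, as a
subalgebra of the product of these quotients. -/
def limS : Subalgebra ℂ (∀ n, P.S ⧸ P.FS n) :=
  { Compl P.πS with
    mul_mem' := fun {x y} hx hy n => by
      obtain ⟨a, ha⟩ := hx n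
      obtain ⟨b, hb⟩ := hy n
      exact ⟨a * b, fun k hk => by rw [πS_mul, ha k hk, hb k hk]; rfl⟩
    algebraMap_mem' := fun a n => ⟨algebraMap ℂ _ a, fun k _ =>
      (Ideal.Quotient.mkₐ ℂ (P.FS k)).commutes a⟩ }

/-- The complexified algebra of formal observables, the completion of the symmetric algebra. -/
def Shat : Type _ := P.limS

instance : CommRing P.Shat := inferInstanceAs (CommRing P.limS)

instance : Algebra ℂ P.Shat := inferInstanceAs (Algebra ℂ P.limS)

/-- The canonical map to the completion. -/
def toShat : P.S →ₐ[ℂ] P.Shat where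
  toFun f := ⟨fun n => P.πS n f, fun _ => ⟨f, fun _ _ => rfl⟩⟩
  map_one' := rfl
  map_zero' := rfl
  map_add' _ _ := rfl
  map_mul' _ _ := rfl
  commutes' _ := rfl

theorem contBil_of_symm {B : P.S →ₗ[ℂ] P.S →ₗ[ℂ] P.S} (hB : ∀ f g, B f g = -B g f)
    (h1 : ∀ n, ∃ m, ∀ f g, f ∈ P.FS m → g ∈ P.FS m → B f g ∈ P.FS n)
    (h2 : ∀ f n, ∃ m, ∀ g, g ∈ P.FS m → B f g ∈ P.FS n) : ContBil P.πS P.πS P.πS B where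
  joint n := by
    obtain ⟨m, hm⟩ := h1 n
    exact ⟨m, fun a b ha hb => P.πS_eq_zero.2 (hm a b (P.πS_eq_zero.1 (ha m le_rfl))
      (P.πS_eq_zero.1 (hb m le_rfl)))⟩
  right f n := by
    obtain ⟨m, hm⟩ := h2 f n
    exact ⟨m, fun b hb => P.πS_eq_zero.2 (hm b (P.πS_eq_zero.1 (hb m le_rfl)))⟩
  left f n := by
    obtain ⟨m, hm⟩ := h2 f n
    refine ⟨m, fun b hb => P.πS_eq_zero.2 ?_⟩
    rw [hB]
    exact neg_mem (hm b (P.πS_eq_zero.1 (hb m le_rfl)))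

theorem pbS_mem_FS {n : ℕ} {f g : P.S} (hf : f ∈ P.FS n) (hg : g ∈ P.FS n) :
    pbS f g ∈ P.FS n :=
  ⟨pbS_span_span (fun _ hX _ hY => P.lie_mem_FD one_ne_zero hX hY) hf.1 hg.1,
    pbS_span_span (fun _ hX _ hY => P.lie_mem_FD (by norm_num) hX hY) hf.2 hg.2⟩

theorem exists_pbS_mem_FS (f : P.S) (n : ℕ) : ∃ m, ∀ g ∈ P.FS m, pbS f g ∈ P.FS n := by
  suffices h : ∃ N, ∀ n, ∀ g ∈ P.FS (n + N), pbS f g ∈ P.FS n by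
    obtain ⟨N, hN⟩ := h
    exact ⟨n + N, hN n⟩
  have hanti : ∀ {m n : ℕ}, m ≤ n → P.FS n ≤ P.FS m := fun h =>
    inf_le_inf (P.FI_anti h) (P.FI_anti h)
  induction f using sym_ind with
  | h1 a => exact ⟨0, fun n g _ => by rw [algebraMap_pbS]; exact zero_mem _⟩
  | h2 X =>
    obtain ⟨N, hN⟩ := P.exists_lie_mem_FD (e := 1) (Or.inl rfl) X
    obtain ⟨N', hN'⟩ := P.exists_lie_mem_FD (e := -1) (Or.inr rfl) X
    refine ⟨N + N', fun n g hg => ⟨?_, ?_⟩⟩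
    · exact pbS_ι_span (P.FD_anti (by omega))
        (fun Y hY => hN n Y (P.FD_anti (by omega) hY)) hg.1
    · exact pbS_ι_span (P.FD_anti (by omega))
        (fun Y hY => hN' n Y (P.FD_anti (by omega) hY)) hg.2
  | h3 f f' hf hf' =>
    obtain ⟨N, hN⟩ := hf
    obtain ⟨N', hN'⟩ := hf'
    refine ⟨N + N', fun n g hg => ?_⟩
    rw [mul_pbS]
    exact add_mem (Ideal.mul_mem_left _ _ (hN' n g (hanti (by omega) hg)))
      (Ideal.mul_mem_left _ _ (hN n g (hanti (by omega) hg)))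
  | h4 f f' hf hf' =>
    obtain ⟨N, hN⟩ := hf
    obtain ⟨N', hN'⟩ := hf'
    refine ⟨N + N', fun n g hg => ?_⟩
    rw [map_add, LinearMap.add_apply]
    exact add_mem (hN n g (hanti (by omega) hg)) (hN' n g (hanti (by omega) hg))

theorem contBil_pbS : ContBil P.πS P.πS P.πS pbS :=
  P.contBil_of_symm pbS_skew (fun n => ⟨n, fun _ _ => P.pbS_mem_FS⟩) P.exists_pbS_mem_FS

/-- The Poisson bracket of the algebra of formal observables, the continuous extension of the one of
the symmetric algebra. -/
def pb : P.Shat →ₗ[ℂ] P.Shat →ₗ[ℂ] P.Shat := extBil P.contBil_pbS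

theorem pb_spec (x y : P.Shat) (n : ℕ) : ∃ M, ∀ a b, Near P.πS x.1 M a → Near P.πS y.1 M b →
    Near P.πS (P.pb x y).1 n (pbS a b) := extVal_spec P.contBil_pbS x y n

theorem exists_near (x : P.Shat) (m : ℕ) : ∃ a, Near P.πS x.1 m a := x.2 m

theorem near_mul {x y : P.Shat} {m : ℕ} {a b : P.S} (ha : Near P.πS x.1 m a)
    (hb : Near P.πS y.1 m b) : Near P.πS (x * y).1 m (a * b) := fun k hk => by
  rw [πS_mul, ha k hk, hb k hk]; rfl

theorem pb_skew (x y : P.Shat) : P.pb x y = -P.pb y x := by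
  refine Subtype.ext (funext fun n => ?_)
  obtain ⟨M, hM⟩ := P.pb_spec x y n
  obtain ⟨M', hM'⟩ := P.pb_spec y x n
  obtain ⟨a, ha⟩ := P.exists_near x (M + M')
  obtain ⟨b, hb⟩ := P.exists_near y (M + M')
  show (P.pb x y).1 n = -(P.pb y x).1 n
  rw [← hM a b (ha.mono (by omega)) (hb.mono (by omega)) n le_rfl,
    ← hM' b a (hb.mono (by omega)) (ha.mono (by omega)) n le_rfl, ← map_neg, pbS_skew]

theorem pb_mul (x y z : P.Shat) : P.pb x (y * z) = y * P.pb x z + z * P.pb x y := by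
  refine Subtype.ext (funext fun n => ?_)
  obtain ⟨M₁, h₁⟩ := P.pb_spec x (y * z) n
  obtain ⟨M₂, h₂⟩ := P.pb_spec x z n
  obtain ⟨M₃, h₃⟩ := P.pb_spec x y n
  obtain ⟨a, ha⟩ := P.exists_near x (M₁ + M₂ + M₃ + n)
  obtain ⟨b, hb⟩ := P.exists_near y (M₁ + M₂ + M₃ + n)
  obtain ⟨c, hc⟩ := P.exists_near z (M₁ + M₂ + M₃ + n)
  show (P.pb x (y * z)).1 n = y.1 n * (P.pb x z).1 n + z.1 n * (P.pb x y).1 n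
  rw [← h₁ a (b * c) (ha.mono (by omega)) ((P.near_mul hb hc).mono (by omega)) n le_rfl,
    ← h₂ a c (ha.mono (by omega)) (hc.mono (by omega)) n le_rfl,
    ← h₃ a b (ha.mono (by omega)) (hb.mono (by omega)) n le_rfl, ← hb n (by omega),
    ← hc n (by omega), ← πS_mul, ← πS_mul, ← map_add, pbS_mul]

theorem pb_jacobi (x y z : P.Shat) :
    P.pb x (P.pb y z) = P.pb (P.pb x y) z + P.pb y (P.pb x z) := by
  refine Subtype.ext (funext fun n => ?_)
  obtain ⟨M₁, h₁⟩ := P.pb_spec x (P.pb y z) n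
  obtain ⟨M₂, h₂⟩ := P.pb_spec (P.pb x y) z n
  obtain ⟨M₃, h₃⟩ := P.pb_spec y (P.pb x z) n
  obtain ⟨N₁, k₁⟩ := P.pb_spec y z M₁
  obtain ⟨N₂, k₂⟩ := P.pb_spec x y M₂
  obtain ⟨N₃, k₃⟩ := P.pb_spec x z M₃
  obtain ⟨a, ha⟩ := P.exists_near x (M₁ + M₂ + M₃ + N₁ + N₂ + N₃)
  obtain ⟨b, hb⟩ := P.exists_near y (M₁ + M₂ + M₃ + N₁ + N₂ + N₃)
  obtain ⟨c, hc⟩ := P.exists_near z (M₁ + M₂ + M₃ + N₁ + N₂ + N₃)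
  show (P.pb x (P.pb y z)).1 n = (P.pb (P.pb x y) z).1 n + (P.pb y (P.pb x z)).1 n
  rw [← h₁ a _ (ha.mono (by omega)) (k₁ b c (hb.mono (by omega)) (hc.mono (by omega))) n le_rfl,
    ← h₂ _ c (k₂ a b (ha.mono (by omega)) (hb.mono (by omega))) (hc.mono (by omega)) n le_rfl,
    ← h₃ b _ (hb.mono (by omega)) (k₃ a c (ha.mono (by omega)) (hc.mono (by omega))) n le_rfl,
    ← map_add, pbS_jacobi]

/-! ### The space of formal fields -/

/-- The tensor product of the auxiliary space and the operator space. -/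
abbrev FT : Type _ := D.Affine ⊗[ℂ] P.gDC

/-- The filtration `F_n ⊗ c(F_n) + F̄_n ⊗ F_n` of the tensor product. -/
def FF (n : ℕ) : Submodule ℂ P.FT :=
  Submodule.map₂ (TensorProduct.mk ℂ D.Affine P.gDC) (D.F 1 n) (P.FD (-1) n) ⊔
    Submodule.map₂ (TensorProduct.mk ℂ D.Affine P.gDC) (D.F (-1) n) (P.FD 1 n)

/-- The quotient maps of the filtration. -/
def πF (n : ℕ) : P.FT →ₗ[ℂ] P.FT ⧸ P.FF n := (P.FF n).mkQ

theorem πF_eq_zero {n : ℕ} {f : P.FT} : P.πF n f = 0 ↔ f ∈ P.FF n :=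
  Submodule.Quotient.mk_eq_zero _

/-- The completed tensor product in which the formal fields live. -/
abbrev Fields : Type _ := Compl P.πF

theorem FF_ind {n : ℕ} {C : P.FT → Prop} (h0 : C 0)
    (h1 : ∀ X Z, X ∈ D.F 1 n → Z ∈ P.FD (-1) n → C (X ⊗ₜ Z))
    (h2 : ∀ X Z, X ∈ D.F (-1) n → Z ∈ P.FD 1 n → C (X ⊗ₜ Z))
    (ha : ∀ u v, C u → C v → C (u + v)) {u : P.FT} (hu : u ∈ P.FF n) : C u := by
  have key : ∀ e e' : ℤ, (∀ X Z, X ∈ D.F e n → Z ∈ P.FD e' n → C (X ⊗ₜ Z)) →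
      ∀ v ∈ Submodule.map₂ (TensorProduct.mk ℂ D.Affine P.gDC) (D.F e n) (P.FD e' n), C v := by
    intro e e' h v hv
    rw [Submodule.map₂_eq_span_image2] at hv
    refine Submodule.closure_induction (p := fun v _ => C v) h0 (fun u v _ _ => ha u v) ?_ hv
    rintro a _ ⟨X, hX, Z, hZ, rfl⟩
    have := h (a • X) Z (Submodule.smul_mem _ a hX) hZ
    rwa [← TensorProduct.smul_tmul'] at this
  obtain ⟨v, hv, w, hw, rfl⟩ := Submodule.mem_sup.1 hu
  exact ha _ _ (key _ _ h1 v hv) (key _ _ h2 w hw)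

theorem FF_anti {m n : ℕ} (h : m ≤ n) : P.FF n ≤ P.FF m :=
  sup_le_sup (Submodule.map₂_le_map₂ (D.F_anti h) (P.FD_anti h))
    (Submodule.map₂_le_map₂ (D.F_anti h) (P.FD_anti h))

theorem tmul_mem_FF {n : ℕ} {X : D.Affine} {Z : P.gDC} (hX : X ∈ D.F 1 n)
    (hZ : Z ∈ P.FD (-1) n) : (X ⊗ₜ Z : P.FT) ∈ P.FF n :=
  Submodule.mem_sup_left (Submodule.apply_mem_map₂ _ hX hZ)

theorem tmul_mem_FF' {n : ℕ} {X : D.Affine} {Z : P.gDC} (hX : X ∈ D.F (-1) n)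
    (hZ : Z ∈ P.FD 1 n) : (X ⊗ₜ Z : P.FT) ∈ P.FF n :=
  Submodule.mem_sup_right (Submodule.apply_mem_map₂ _ hX hZ)

/-- The bilinear map `(X ⊗ Z, Y ⊗ W) ↦ (X | Y) Z W`. -/
def prePair : P.FT →ₗ[ℂ] P.FT →ₗ[ℂ] P.S :=
  (TensorProduct.map₂ D.aform ((LinearMap.mul ℂ P.S).compl₁₂ (SymmetricAlgebra.ι ℂ P.gDC)
    (SymmetricAlgebra.ι ℂ P.gDC))).compr₂ (TensorProduct.lid ℂ P.S).toLinearMap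

@[simp] theorem prePair_tmul (X Y : D.Affine) (Z W : P.gDC) :
    P.prePair (X ⊗ₜ Z) (Y ⊗ₜ W) = D.aform X Y •
      (SymmetricAlgebra.ι ℂ P.gDC Z * SymmetricAlgebra.ι ℂ P.gDC W) := rfl

theorem prePair_symm (u v : P.FT) : P.prePair u v = P.prePair v u := by
  induction u using TensorProduct.induction_on with
  | zero => rw [map_zero, map_zero, LinearMap.zero_apply]
  | add u u' hu hu' => rw [map_add, map_add, LinearMap.add_apply, hu, hu']
  | tmul X Z =>
    induction v using TensorProduct.induction_on with
    | zero => rw [map_zero, map_zero, LinearMap.zero_apply]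
    | add u u' hu hu' => rw [map_add, map_add, LinearMap.add_apply, hu, hu']
    | tmul Y W => rw [prePair_tmul, prePair_tmul, D.aform_symm, mul_comm]

theorem ι_mul_ι_mem_FS {n : ℕ} {Z W : P.gDC} (hZ : Z ∈ P.FD (-1) n) (hW : W ∈ P.FD 1 n) :
    SymmetricAlgebra.ι ℂ P.gDC Z * SymmetricAlgebra.ι ℂ P.gDC W ∈ P.FS n :=
  ⟨Ideal.mul_mem_left _ _ (Ideal.subset_span ⟨W, hW, rfl⟩),
    Ideal.mul_mem_right _ _ (Ideal.subset_span ⟨Z, hZ, rfl⟩)⟩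

theorem FS_smul_mem {n : ℕ} (a : ℂ) {f : P.S} (hf : f ∈ P.FS n) : a • f ∈ P.FS n := by
  rw [Algebra.smul_def]
  exact Ideal.mul_mem_left _ _ hf

theorem prePair_mem {n : ℕ} {u v : P.FT} (hu : u ∈ P.FF (n + 1)) (hv : v ∈ P.FF (n + 1)) :
    P.prePair u v ∈ P.FS n := by
  refine P.FF_ind (C := fun u => P.prePair u v ∈ P.FS n) ?_ (fun X Z hX hZ => ?_)
    (fun X Z hX hZ => ?_) (fun u u' h h' => ?_) hu
  · rw [map_zero, LinearMap.zero_apply]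
    exact zero_mem _
  · refine P.FF_ind (C := fun v => P.prePair (X ⊗ₜ Z) v ∈ P.FS n) ?_ (fun Y W hY hW => ?_)
      (fun Y W hY hW => ?_) (fun v v' h h' => ?_) hv
    · rw [map_zero]
      exact zero_mem _
    · rw [prePair_tmul, D.aform_F_F one_ne_zero (by omega) hX hY, zero_smul]
      exact zero_mem _
    · rw [prePair_tmul]
      exact P.FS_smul_mem _ (P.ι_mul_ι_mem_FS (P.FD_anti (by omega) hZ) (P.FD_anti (by omega) hW))
    · rw [map_add]
      exact add_mem h h'
  · refine P.FF_ind (C := fun v => P.prePair (X ⊗ₜ Z) v ∈ P.FS n) ?_ (fun Y W hY hW => ?_)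
      (fun Y W hY hW => ?_) (fun v v' h h' => ?_) hv
    · rw [map_zero]
      exact zero_mem _
    · rw [prePair_tmul, mul_comm (SymmetricAlgebra.ι ℂ P.gDC Z)]
      exact P.FS_smul_mem _ (P.ι_mul_ι_mem_FS (P.FD_anti (by omega) hW) (P.FD_anti (by omega) hZ))
    · rw [prePair_tmul, D.aform_F_F (by norm_num) (by omega) hX hY, zero_smul]
      exact zero_mem _
    · rw [map_add]
      exact add_mem h h'
  · rw [map_add, LinearMap.add_apply]
    exact add_mem h h'

theorem exists_prePair_eq_zero (u : P.FT) : ∃ N, ∀ v ∈ P.FF N, P.prePair u v = 0 := by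
  induction u using TensorProduct.induction_on with
  | zero => exact ⟨0, fun v _ => by rw [map_zero, LinearMap.zero_apply]⟩
  | add u u' hu hu' =>
    obtain ⟨N, hN⟩ := hu
    obtain ⟨N', hN'⟩ := hu'
    refine ⟨N + N', fun v hv => ?_⟩
    rw [map_add, LinearMap.add_apply, hN v (P.FF_anti (by omega) hv),
      hN' v (P.FF_anti (by omega) hv), add_zero]
  | tmul X Z =>
    obtain ⟨N, hN⟩ := D.exists_aform_F (Or.inl rfl) X
    obtain ⟨N', hN'⟩ := D.exists_aform_F (Or.inr rfl) X
    refine ⟨N + N', fun v hv => ?_⟩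
    refine P.FF_ind (C := fun v => P.prePair (X ⊗ₜ Z) v = 0) (map_zero _) (fun Y W hY hW => ?_)
      (fun Y W hY hW => ?_) (fun v v' h h' => ?_) hv
    · rw [prePair_tmul, hN Y (D.F_anti (by omega) hY), zero_smul]
    · rw [prePair_tmul, hN' Y (D.F_anti (by omega) hY), zero_smul]
    · rw [map_add, h, h', add_zero]

theorem contBil_prePair : ContBil P.πF P.πF P.πS P.prePair where
  joint n := ⟨n + 1, fun u v hu hv => P.πS_eq_zero.2 (P.prePair_mem
    (P.πF_eq_zero.1 (hu _ le_rfl)) (P.πF_eq_zero.1 (hv _ le_rfl)))⟩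
  right u n := by
    obtain ⟨N, hN⟩ := P.exists_prePair_eq_zero u
    exact ⟨N, fun v hv => by rw [hN v (P.πF_eq_zero.1 (hv _ le_rfl)), map_zero]⟩
  left u n := by
    obtain ⟨N, hN⟩ := P.exists_prePair_eq_zero u
    exact ⟨N, fun v hv => by
      rw [prePair_symm, hN v (P.πF_eq_zero.1 (hv _ le_rfl)), map_zero]⟩

/-- The bilinear map `( · | · )` from pairs of formal fields to formal observables. -/
def pair : P.Fields →ₗ[ℂ] P.Fields →ₗ[ℂ] P.Shat := extBil P.contBil_prePair

theorem contLin_σ : ContLin P.πF P.πF (TensorProduct.map D.σa LinearMap.id) := fun n =>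
  ⟨n, fun u hu => P.πF_eq_zero.2 (P.FF_ind
    (C := fun u => TensorProduct.map D.σa LinearMap.id u ∈ P.FF n)
    (by rw [map_zero]; exact zero_mem _)
    (fun _ _ hX hZ => P.tmul_mem_FF (D.σa_mem_F hX) hZ)
    (fun _ _ hX hZ => P.tmul_mem_FF' (D.σa_mem_F hX) hZ)
    (fun u v h h' => by rw [map_add]; exact add_mem h h') (P.πF_eq_zero.1 (hu n le_rfl)))⟩

/-- The action of `σ` on formal fields, through the auxiliary space. -/
def σF : P.Fields →ₗ[ℂ] P.Fields := extLin P.contLin_σ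

/-! ### Formal fields -/

section CanonicalFields

variable {ι : Type*} [Fintype ι] [DecidableEq ι] (I : Module.Basis ι ℂ 𝔤)

/-- The term `∑ₐ A((I_a)₋ₙ) ⊗ M((I^a)ₙ)`, where `I^a` is the basis dual to `I_a`. -/
def canonTerm (A : D.Affine → D.Affine) (M : D.Affine → P.gDC) (n : ℤ) : P.FT :=
  ∑ a, A (D.mon (-n) (I a)) ⊗ₜ[ℂ]
    M (D.mon n (LinearMap.BilinForm.dualBasis D.form D.form_nondegenerate I a))

/-- The part `A(D) ⊗ M(K) + A(K) ⊗ M(D) + ∑_{|n| < k} ∑ₐ A((I_a)₋ₙ) ⊗ M((I^a)ₙ)` of the image under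
`A ⊗ M` of the canonical element of the affine algebra. -/
def canonSum (A : D.Affine → D.Affine) (M : D.Affine → P.gDC) (k : ℕ) : P.FT :=
  A D.Dd ⊗ₜ[ℂ] M D.K + A D.K ⊗ₜ[ℂ] M D.Dd +
    ∑ n ∈ Finset.Ioo (-(k : ℤ)) k, P.canonTerm I A M n

/-- The image under `A ⊗ M` of the canonical element of the affine algebra. -/
def canonField (A : D.Affine → D.Affine) (M : D.Affine → P.gDC)
    (h : ∀ (k : ℕ) (n : ℤ), (k : ℤ) ≤ |n| → P.canonTerm I A M n ∈ P.FF k) : P.Fields :=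
  ⟨fun k => P.πF k (P.canonSum I A M k), fun l => ⟨P.canonSum I A M l, fun k hk => by
    rw [← sub_eq_zero, ← map_sub, πF_eq_zero, canonSum, canonSum, add_sub_add_left_eq_sub,
      ← Finset.sum_sdiff_eq_sub (Finset.Ioo_subset_Ioo (by omega) (by omega))]
    refine Submodule.sum_mem _ fun n hn => h k n ?_
    rw [Finset.mem_sdiff, Finset.mem_Ioo, Finset.mem_Ioo] at hn
    rw [le_abs]
    omega⟩⟩

theorem mon_mem_F_one {k : ℕ} {n : ℤ} (h : (k : ℤ) ≤ n) (x : 𝔤) : D.mon n x ∈ D.F 1 k := by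
  have := D.mon_mem_F (e := 1) (n := k) n.toNat x (by omega)
  rwa [one_mul, Int.toNat_of_nonneg (by omega)] at this

theorem mon_mem_F_neg {k : ℕ} {n : ℤ} (h : (k : ℤ) ≤ n) (x : 𝔤) : D.mon (-n) x ∈ D.F (-1) k := by
  have := D.mon_mem_F (e := -1) (n := k) n.toNat x (by omega)
  rwa [neg_one_mul, Int.toNat_of_nonneg (by omega)] at this

theorem canonTerm_mode (i : Option ℂ) (p : ℕ) (k : ℕ) (n : ℤ) (h : (k : ℤ) ≤ |n|) :
    P.canonTerm I id (P.mode i p) n ∈ P.FF k := by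
  refine Submodule.sum_mem _ fun a _ => ?_
  rcases le_abs.1 h with h | h
  · exact P.tmul_mem_FF' (mon_mem_F_neg h _) (P.mode_mem_FD i p (mon_mem_F_one h _))
  · refine P.tmul_mem_FF (mon_mem_F_one h _) (P.mode_mem_FD i p ?_)
    have := mon_mem_F_neg (D := D) h (LinearMap.BilinForm.dualBasis D.form D.form_nondegenerate I a)
    rwa [neg_neg] at this

theorem canonTerm_modeBar (i : Option ℂ) (p : ℕ) (k : ℕ) (n : ℤ) (h : (k : ℤ) ≤ |n|) :
    P.canonTerm I D.τa (P.modeBar i p) n ∈ P.FF k := by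
  refine Submodule.sum_mem _ fun a _ => ?_
  rcases le_abs.1 h with h | h
  · have h1 := D.τa_mem_F (mon_mem_F_neg (D := D) h (I a))
    rw [neg_neg] at h1
    refine P.tmul_mem_FF h1 (P.modeBar_mem_FD i p ?_)
    rw [neg_neg]
    exact mon_mem_F_one h _
  · refine P.tmul_mem_FF' (D.τa_mem_F (mon_mem_F_one h _)) (P.modeBar_mem_FD i p ?_)
    have := mon_mem_F_neg (D := D) h (LinearMap.BilinForm.dualBasis D.form D.form_nondegenerate I a)
    rwa [neg_neg] at this

/-- The formal field attached to the point `i` of the divisor (a finite point or infinity):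
`I_ã ⊗ (I^ã)^(i)_p`. -/
def fieldAt (i : Option ℂ) (p : ℕ) : P.Fields :=
  P.canonField I id (P.mode i p) (P.canonTerm_mode I i p)

/-- The formal field attached to the conjugate of a point `i` with trivial stabiliser:
`τ I_ã ⊗ c((I^ã)^(i)_p)`. -/
def fieldBarAt (i : Option ℂ) (p : ℕ) : P.Fields :=
  P.canonField I D.τa (P.modeBar i p) (P.canonTerm_modeBar I i p)

open scoped Classical in
/-- The formal field `𝒜^y_p` at a finite point `y`, for `y` in the divisor or conjugate to a point of
the divisor with trivial stabiliser; it is zero at all other points. -/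
def field (y : ℂ) (p : ℕ) : P.Fields :=
  if y ∈ P.z then P.fieldAt I (some y) p
  else if conj y ∈ P.z ∧ D.stab (some (conj y)) = ⊥ then P.fieldBarAt I (some (conj y)) p
  else 0

/-- The formal field `𝒜^∞_p` at infinity. -/
def fieldInf (p : ℕ) : P.Fields := P.fieldAt I none p

open scoped Classical in
/-- The points of the divisor with trivial stabiliser. -/
def zc : Finset ℂ := P.z.filter fun x => D.stab (some x) = ⊥

/-- The nonzero finite points of the divisor together with the conjugates of those with trivial
stabiliser. -/
def Z' : Finset ℂ := (P.z ∪ P.zc.image conj).erase 0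

/-- A bound for the order of the poles: all `𝒜^y_p` with `p ≥ bound` vanish. -/
def bound : ℕ := P.mult none + ∑ x ∈ P.z, P.mult (some x)

/-! ### Quadratic Hamiltonians -/

/-- The quadratic Gaudin Hamiltonian `ℋ^x_p` at a nonzero finite point. -/
def ham (x : ℂ) (p : ℕ) : P.Shat :=
  (∑ j ∈ (Finset.range T ×ˢ insert 0 P.Z').erase (0, x),
    ∑ q ∈ Finset.range P.bound, ∑ s ∈ Finset.range P.bound,
      (((q + s).choose s : ℂ) * (-1) ^ s * D.ω ^ (j.1 * q) /
        (x - D.ω ^ j.1 * j.2) ^ (q + s + 1)) •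
        P.pair (P.field I x (p + s)) (P.σF^[j.1] (P.field I j.2 q)))
  - (T : ℂ) • (∑ q ∈ Finset.range P.bound, ∑ s ∈ Finset.range P.bound,
      ((q.choose s : ℂ) * x ^ (q - s)) • P.pair (P.field I x (p + s)) (P.fieldInf I (q + 1)))
  + (1 / 2 : ℂ) • ∑ q ∈ Finset.range p, P.pair (P.field I x q) (P.field I x (p - q - 1))

/-- The quadratic Gaudin Hamiltonian `ℋ^0_p` at the origin. -/
def hamZero (p : ℕ) : P.Shat :=
  (∑ x ∈ P.Z', ∑ q ∈ Finset.range P.bound, ∑ s ∈ Finset.range P.bound,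
      ((-1) ^ (q + 1) * ((q + s).choose s : ℂ) / x ^ (q + s + 1)) •
        P.pair (P.field I 0 (p + s)) (P.field I x q))
  - (∑ q ∈ Finset.range P.bound, P.pair (P.field I 0 (p + q)) (P.fieldInf I (q + 1)))
  + (1 / 2 : ℂ) • ∑ q ∈ Finset.range p, P.pair (P.field I 0 (p - q - 1)) (P.field I 0 q)

/-- The quadratic Gaudin Hamiltonian `ℋ^∞_q` at infinity. -/
def hamInf (q : ℕ) : P.Shat :=
  -(∑ x ∈ P.Z', ∑ p ∈ Finset.range P.bound, ∑ s ∈ Finset.range P.bound,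
      ((s.choose p : ℂ) * x ^ (s - p)) • P.pair (P.field I x p) (P.fieldInf I (q + s + 2)))
  - (∑ p ∈ Finset.range P.bound, P.pair (P.field I 0 p) (P.fieldInf I (q + p + 2)))
  + (1 / 2 : ℂ) • ∑ p ∈ Finset.range (q + 1),
      P.pair (P.fieldInf I (p + 1)) (P.fieldInf I (q - p + 1))

/-- The collection of all quadratic Gaudin Hamiltonians. Among the `hamZero I p` and `hamInf I q`,
those with `p ≡ 1` and `q + 2 ≡ 0` modulo `T` are the coefficients of the generating function; the
formulas make sense for all indices. -/
def gaudinHams : Set P.Shat :=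
  {h | ∃ x ∈ P.Z', ∃ p, h = P.ham I x p} ∪ {h | ∃ p, h = P.hamZero I p} ∪
  {h | ∃ q, h = P.hamInf I q}

end CanonicalFields

/-! ### Momentum, constraints and reduction -/

/-- The canonical map from the complexified Takiff algebra to the algebra of formal observables. -/
def lin (Z : P.gDC) : P.Shat := P.toShat (SymmetricAlgebra.ι ℂ P.gDC Z)

/-- The linear element `-i ∑_x X^(x)_0 + i ∑_x X^(x̄)_0`, where the first sum is over all finite
points and the second one over those with trivial stabiliser. -/
def preMomentum (X : D.Affine) : P.gDC :=
  -(Complex.I • ∑ x ∈ P.z, P.mode (some x) 0 X) + Complex.I • ∑ x ∈ P.zc, P.modeBar (some x) 0 X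

/-- The formal momentum. -/
def momentum : P.Shat := P.lin (P.preMomentum D.Dd)

/-- The central constraint. -/
def preK : P.gDC := P.preMomentum D.K

/-- The modes `∑_x (yₙ)^(x)_0 + ∑_x (y₋ₙ)^(x̄)_0` of the formal constraint. -/
def preC (y : 𝔤) (n : ℤ) : P.gDC :=
  ∑ x ∈ P.z, P.mode (some x) 0 (D.mon n y) + ∑ x ∈ P.zc, P.modeBar (some x) 0 (D.mon (-n) y)

/-- The real subalgebra of the elements of `𝔤` fixed by `σ` and `τ`, as a real subspace. -/
def fixedPart (D : DihedralLie T 𝔤) : Submodule ℝ 𝔤 where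
  carrier := {y | D.σ y = y ∧ D.τ y = y}
  add_mem' {x y} hx hy := ⟨by rw [map_add, hx.1, hy.1], by rw [map_add, hx.2, hy.2]⟩
  zero_mem' := ⟨map_zero _, map_zero _⟩
  smul_mem' a y hy := by
    refine ⟨?_, ?_⟩
    · rw [← Complex.coe_smul, map_smul, hy.1]
    · rw [← Complex.coe_smul, map_smulₛₗ, hy.2, Complex.conj_ofReal]

section Reduction

variable {κ : Type*} (I0 : Module.Basis κ ℝ (fixedPart D))

/-- The ideal of the symmetric algebra generated by the constraints. -/
def J : Ideal P.S :=
  Ideal.span (SymmetricAlgebra.ι ℂ P.gDC ''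
    ({P.preK} ∪ {Z | ∃ (α : κ) (n : ℤ), Z = P.preC (I0 α : 𝔤) n}))

/-- The completion of the ideal `J`: the inverse limit of its images in the quotients of the symmetric
algebra by the ideals of the filtration. -/
def Jhat : Ideal P.Shat where
  carrier := {X | ∀ n, ∃ f ∈ P.J I0, P.πS n f = X.1 n}
  add_mem' {X Y} hX hY n := by
    obtain ⟨f, hf, hX⟩ := hX n
    obtain ⟨g, hg, hY⟩ := hY n
    exact ⟨f + g, add_mem hf hg, by rw [map_add, hX, hY]; rfl⟩
  zero_mem' n := ⟨0, zero_mem _, map_zero _⟩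
  smul_mem' X Y hY n := by
    obtain ⟨f, hf⟩ := P.exists_near X n
    obtain ⟨g, hg, hY⟩ := hY n
    exact ⟨f * g, Ideal.mul_mem_left _ _ hg, by rw [πS_mul, hf n le_rfl, hY]; rfl⟩

theorem pb_one (X : P.Shat) : P.pb X 1 = 0 := by
  have h := P.pb_mul X 1 1
  rw [mul_one, one_mul] at h
  exact left_eq_add.1 h

/-- The normaliser of `Jhat`. -/
def Nhat : Subalgebra ℂ P.Shat where
  carrier := {X | ∀ Y ∈ P.Jhat I0, P.pb X Y ∈ P.Jhat I0}
  mul_mem' {X X'} hX hX' Y hY := by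
    rw [pb_skew, pb_mul, neg_add, ← mul_neg, ← mul_neg, ← pb_skew, ← pb_skew]
    exact add_mem (Ideal.mul_mem_left _ _ (hX' Y hY)) (Ideal.mul_mem_left _ _ (hX Y hY))
  add_mem' {X X'} hX hX' Y hY := by
    rw [map_add, LinearMap.add_apply]
    exact add_mem (hX Y hY) (hX' Y hY)
  algebraMap_mem' a Y hY := by
    rw [Algebra.algebraMap_eq_smul_one, map_smul, LinearMap.smul_apply, pb_skew, pb_one, neg_zero,
      smul_zero]
    exact zero_mem _

theorem pb_mem_Nhat {X Y : P.Shat} (hX : X ∈ P.Nhat I0) (hY : Y ∈ P.Nhat I0) :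
    P.pb X Y ∈ P.Nhat I0 := fun W hW => by
  have h : P.pb (P.pb X Y) W = P.pb X (P.pb Y W) - P.pb Y (P.pb X W) :=
    eq_sub_of_add_eq (P.pb_jacobi X Y W).symm
  rw [h]
  exact sub_mem (hX _ (hY W hW)) (hY _ (hX W hW))

/-- `Jhat` as an ideal of its normaliser. -/
def JN : Ideal (P.Nhat I0) := (P.Jhat I0).comap (P.Nhat I0).val

/-- The Hamiltonian reduction, the quotient of the normaliser of `Jhat` by `Jhat`. -/
abbrev Red : Type _ := P.Nhat I0 ⧸ P.JN I0

/-- The class of an element of the normaliser in the Hamiltonian reduction. -/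
def toRed (X : P.Shat) (hX : X ∈ P.Nhat I0) : P.Red I0 := Ideal.Quotient.mk (P.JN I0) ⟨X, hX⟩

/-- The Poisson bracket of the Hamiltonian reduction. -/
def redPb : P.Red I0 → P.Red I0 → P.Red I0 :=
  Quotient.map₂ (fun X Y => ⟨P.pb X.1 Y.1, P.pb_mem_Nhat I0 X.2 Y.2⟩) (by
    intro X X' hX Y Y' hY
    have hX := (Submodule.quotientRel_def _).1 hX
    have hY := (Submodule.quotientRel_def _).1 hY
    refine (Submodule.quotientRel_def _).2 ?_
    have hX : X.1 - X'.1 ∈ P.Jhat I0 := hX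
    have hY : Y.1 - Y'.1 ∈ P.Jhat I0 := hY
    show P.pb X.1 Y.1 - P.pb X'.1 Y'.1 ∈ P.Jhat I0
    have h : P.pb X.1 Y.1 - P.pb X'.1 Y'.1 =
        P.pb X'.1 (Y.1 - Y'.1) - P.pb Y.1 (X.1 - X'.1) := by
      rw [P.pb_skew Y.1, map_sub, map_sub, LinearMap.sub_apply]
      abel
    rw [h]
    exact sub_mem (X'.2 _ hY) (Y.2 _ hX))

theorem redPb_toRed {X Y : P.Shat} (hX : X ∈ P.Nhat I0) (hY : Y ∈ P.Nhat I0) :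
    P.redPb I0 (P.toRed I0 X hX) (P.toRed I0 Y hY) =
      P.toRed I0 (P.pb X Y) (P.pb_mem_Nhat I0 hX hY) := rfl

end Reduction

end GaudinPoints

end DihedralGaudin

end

open scoped TensorProduct ComplexConjugate

noncomputable section

namespace DihedralGaudin

namespace GaudinPoints

variable {T : ℕ} [NeZero T] {𝔤 : Type*} [LieRing 𝔤] [LieAlgebra ℂ 𝔤] {D : DihedralLie T 𝔤}
  (P : GaudinPoints D)

/-! ### The normaliser of the completed constraint ideal -/

/-! The constraints and the momentum are all scalar multiples of diagonal elements `diag A`, the sum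
of A^(x)_0 over the finite points and of (τA)^(x̄)_0 over those with trivial stabiliser, where A is
K, D or y_n with σy = τy = y. In each case σA = A. The opposite signs of the two sums in the
momentum and in 𝒦 come from τD = -D and τK = -K (`preMomentum_eq`, `preK_eq`, `preC_eq`). So the
main point is that `diag A` Poisson commutes with every quadratic Hamiltonian as soon as σA = A.

The modes are normalised so that the ε⁰-coefficient of A^(x)_0 at x is exactly A, whatever the
stabiliser (`nrm_smul_avg_of_fixed`). Hence bracketing with `diag A` acts on the modes at x as ad A,
and on the modes at x̄ as ad τA (`lie_diag_mode`, `lie_diag_modeBar`). A formal field is an image of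
the canonical element, which is invariant under A ⊗ 1 + 1 ⊗ A. Acting with `diag A` on the operator
factor of a field is therefore minus acting with A on its auxiliary factor (`opF_canonField`). This
covariance survives applying σ, because σA = A. The bracket with `diag A` is a derivation of the
pairing of fields (`pb_lin_pair`), and the pairing is invariant under ad A on the auxiliary factors
(`pair_auxF`); together these give zero.

Two points need care. The canonical element is an infinite sum. For A = x_m its truncations are
invariant only up to terms deep in the filtration, left over by a telescoping sum, and the two terms
produced by the cocycle cancel against D ⊗ K + K ⊗ D (`exists_leibCanon_mem`). At infinity `diag A`
has no component, so covariance cannot come from the same mechanism; with n_∞ = 1 the fields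
𝒜^∞_{q+1} are built from zero modes and nothing is left to check.

The momentum does not commute with the constraints but rescales them: `diag` respects brackets on
σ-invariants, and [D, y_n] = n y_n, [D, K] = 0. Membership in the normaliser may be tested on the
generating constraints, since the bracket is a derivation and continuous (`mem_Nhat_of_generators`).
-/

theorem FS_anti {m n : ℕ} (h : m ≤ n) : P.FS n ≤ P.FS m :=
  inf_le_inf (P.FI_anti h) (P.FI_anti h)

/-- The filtration is descending, so agreement at stage m forces agreement at all earlier stages.
This is needed because `Jhat` is described one stage at a time, while continuity is phrased with
`Near`. -/
theorem near_of_eq {X : P.Shat} {m : ℕ} {f : P.S} (h : P.πS m f = X.1 m) :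
    Near P.πS X.1 m f := fun k hk => by
  obtain ⟨g, hg⟩ := P.exists_near X m
  rw [← hg k hk, ← sub_eq_zero, ← map_sub, πS_eq_zero]
  refine P.FS_anti hk (P.πS_eq_zero.1 ?_)
  rw [map_sub, h, hg m le_rfl, sub_self]

theorem near_toShat (f : P.S) (m : ℕ) : Near P.πS (P.toShat f).1 m f := fun _ _ => rfl

/-- Z and W represent their own images at every stage, so the extended bracket is read off from the
one on the symmetric algebra. -/
theorem pb_lin_lin (Z W : P.gDC) : P.pb (P.lin Z) (P.lin W) = P.lin ⁅Z, W⁆ := by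
  refine Subtype.ext (funext fun n => ?_)
  obtain ⟨M, hM⟩ := P.pb_spec (P.lin Z) (P.lin W) n
  rw [← hM _ _ (P.near_toShat _ M) (P.near_toShat _ M) n le_rfl, pbS_ι_ι]
  rfl

theorem lin_smul (a : ℂ) (Z : P.gDC) : P.lin (a • Z) = a • P.lin Z := by
  rw [lin, map_smul, map_smul, lin]

/-! ### Testing the normaliser on generators -/

section Constraints

variable {κ : Type*} (I0 : Module.Basis κ ℝ (fixedPart D))

theorem toShat_mem_Jhat {f : P.S} (hf : f ∈ P.J I0) : P.toShat f ∈ P.Jhat I0 :=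
  fun _ => ⟨f, hf, rfl⟩

theorem lin_preC_mem_Jhat (α : κ) (n : ℤ) : P.lin (P.preC (I0 α : 𝔤) n) ∈ P.Jhat I0 :=
  P.toShat_mem_Jhat I0 (Ideal.subset_span ⟨_, Or.inr ⟨α, n, rfl⟩, rfl⟩)

/-- An observable normalises the completed ideal if it does so on the generating constraints. -/
theorem mem_Nhat_of_generators {h : P.Shat} (hK : P.pb h (P.lin P.preK) ∈ P.Jhat I0)
    (hC : ∀ (α : κ) (n : ℤ), P.pb h (P.lin (P.preC (I0 α : 𝔤) n)) ∈ P.Jhat I0) :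
    h ∈ P.Nhat I0 := by
  -- Before completion: bracketing with `h` is a derivation, so the generators of the ideal decide.
  have key : ∀ f ∈ P.J I0, P.pb h (P.toShat f) ∈ P.Jhat I0 := by
    intro f hf
    induction hf using Submodule.span_induction with
    | zero => rw [map_zero, map_zero]; exact zero_mem _
    | add f g _ _ hf hg => rw [map_add, map_add]; exact add_mem hf hg
    | mem f hf =>
      obtain ⟨Z, rfl | ⟨α, n, rfl⟩, rfl⟩ := hf
      · exact hK
      · exact hC α n
    | smul a f hf hf' =>
      rw [smul_eq_mul, map_mul, pb_mul]
      exact add_mem (Ideal.mul_mem_left _ _ hf')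
        (Ideal.mul_mem_right _ _ (P.toShat_mem_Jhat I0 hf))
  -- Passage to the completion: the n-th component of the bracket sees `Y` only up to a finite stage
  -- M, where `Y` may be replaced by an element `f` of the uncompleted ideal.
  intro Y hY n
  obtain ⟨M, hM⟩ := P.pb_spec h Y n
  obtain ⟨f, hf, hfY⟩ := hY M
  -- The bracket with the image of `f` has its own stage of precision; one representative `a` of `h`
  -- serves for both.
  obtain ⟨M', hM'⟩ := P.pb_spec h (P.toShat f) n
  obtain ⟨a, ha⟩ := P.exists_near h (M + M')
  obtain ⟨g, hg, hgn⟩ := key f hf n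
  refine ⟨g, hg, ?_⟩
  rw [hgn, ← hM a f (ha.mono (by omega)) (P.near_of_eq hfY) n le_rfl,
    ← hM' a f (ha.mono (by omega)) (P.near_toShat f M') n le_rfl]

end Constraints

/-! ### Adjoint actions on formal fields -/

theorem contLin_of_FF {f : P.FT →ₗ[ℂ] P.FT}
    (h : ∀ n, ∃ m, ∀ u ∈ P.FF m, f u ∈ P.FF n) : ContLin P.πF P.πF f := fun n => by
  obtain ⟨m, hm⟩ := h n
  exact ⟨m, fun u hu => P.πF_eq_zero.2 (hm u (P.πF_eq_zero.1 (hu m le_rfl)))⟩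

/-- The adjoint action of an element of the complexified Takiff algebra on the operator space. -/
def opT (Z : P.gDC) : P.FT →ₗ[ℂ] P.FT :=
  TensorProduct.map LinearMap.id (LieModule.toEnd ℂ P.gDC P.gDC Z)

@[simp] theorem opT_tmul (Z W : P.gDC) (X : D.Affine) :
    P.opT Z (X ⊗ₜ W) = X ⊗ₜ ⁅Z, W⁆ := rfl

/-- The adjoint action of an element of the affine algebra on the auxiliary space. -/
def auxT (A : D.Affine) : P.FT →ₗ[ℂ] P.FT :=
  TensorProduct.map (LieModule.toEnd ℂ D.Affine D.Affine A) LinearMap.id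

@[simp] theorem auxT_tmul (A X : D.Affine) (W : P.gDC) :
    P.auxT A (X ⊗ₜ W) = ⁅A, X⁆ ⊗ₜ W := rfl

/-- Bracketing with Z lowers each of the two conjugate filtrations by a bounded amount, N and N';
starting N + N' stages deeper handles both summands of `FF`, the auxiliary factor being untouched.
-/
theorem contLin_opT (Z : P.gDC) : ContLin P.πF P.πF (P.opT Z) := P.contLin_of_FF fun n => by
  obtain ⟨N, hN⟩ := P.exists_lie_mem_FD (Or.inl rfl) Z
  obtain ⟨N', hN'⟩ := P.exists_lie_mem_FD (Or.inr rfl) Z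
  refine ⟨n + (N + N'), fun u hu => P.FF_ind (C := fun u => P.opT Z u ∈ P.FF n)
    (by rw [map_zero]; exact zero_mem _) (fun X W hX hW => ?_) (fun X W hX hW => ?_)
    (fun u v h h' => by rw [map_add]; exact add_mem h h') hu⟩
  · exact P.tmul_mem_FF (D.F_anti (by omega) hX) (hN' n W (P.FD_anti (by omega) hW))
  · exact P.tmul_mem_FF' (D.F_anti (by omega) hX) (hN n W (P.FD_anti (by omega) hW))

theorem contLin_auxT (A : D.Affine) : ContLin P.πF P.πF (P.auxT A) := P.contLin_of_FF fun n => by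
  obtain ⟨N, hN⟩ := D.exists_lie_mem_F (Or.inl rfl) A
  obtain ⟨N', hN'⟩ := D.exists_lie_mem_F (Or.inr rfl) A
  refine ⟨n + (N + N'), fun u hu => P.FF_ind (C := fun u => P.auxT A u ∈ P.FF n)
    (by rw [map_zero]; exact zero_mem _) (fun X W hX hW => ?_) (fun X W hX hW => ?_)
    (fun u v h h' => by rw [map_add]; exact add_mem h h') hu⟩
  · exact P.tmul_mem_FF (hN n X (D.F_anti (by omega) hX)) (P.FD_anti (by omega) hW)
  · exact P.tmul_mem_FF' (hN' n X (D.F_anti (by omega) hX)) (P.FD_anti (by omega) hW)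

/-- The continuous extension of `opT` to formal fields. -/
def opF (Z : P.gDC) : P.Fields →ₗ[ℂ] P.Fields := extLin (P.contLin_opT Z)

/-- The continuous extension of `auxT` to formal fields. -/
def auxF (A : D.Affine) : P.Fields →ₗ[ℂ] P.Fields := extLin (P.contLin_auxT A)

/-- The coefficients (X|Y) are constants for the bracket, so only the two operator factors are
differentiated. -/
theorem pbS_prePair (Z : P.gDC) (u v : P.FT) :
    pbS (SymmetricAlgebra.ι ℂ P.gDC Z) (P.prePair u v) =
      P.prePair (P.opT Z u) v + P.prePair u (P.opT Z v) := by
  induction u using TensorProduct.induction_on with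
  | zero => simp only [map_zero, LinearMap.zero_apply, add_zero]
  | add u u' hu hu' => simp only [map_add, LinearMap.add_apply, hu, hu']; abel
  | tmul X W =>
    induction v using TensorProduct.induction_on with
    | zero => simp only [map_zero, add_zero]
    | add u u' hu hu' => simp only [map_add, hu, hu']; abel
    | tmul Y W' =>
      rw [opT_tmul, opT_tmul, prePair_tmul, prePair_tmul, prePair_tmul, map_smul, pbS_mul,
        pbS_ι_ι, pbS_ι_ι, ← smul_add]
      congr 1
      ring

/-- This is ad-invariance of the affine form; the operator factors are merely carried along. -/
theorem prePair_auxT (A : D.Affine) (u v : P.FT) :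
    P.prePair (P.auxT A u) v + P.prePair u (P.auxT A v) = 0 := by
  -- The loop brackets cancel by invariance of the loop form, the terms with the D-component of A by
  -- skewness of t d/dt. The terms with the D-components of X and Y cancel against the central
  -- components of the brackets.
  have inv : ∀ X Y : D.Affine, D.aform ⁅A, X⁆ Y + D.aform X ⁅A, Y⁆ = 0 := fun X Y => by
    have h1 := loopForm_invariant D.form_invariant X.1 A.1 Y.1
    have h2 := loopBr_symm X.1 A.1
    have h3 := loopForm_loopDer (κ := D.form) A.1 X.1
    have h4 := loopForm_symm D.form_symm X.1 (loopDer A.1)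
    have h5 := loopForm_loopDer (κ := D.form) X.1 Y.1
    rw [h2] at h1
    simp only [map_neg, LinearMap.neg_apply] at h1
    simp only [DihedralLie.aform, LinearMap.mk₂_apply, DihedralLie.lie_fst, DihedralLie.lie_k,
      DihedralLie.lie_d, map_add, map_sub, map_smul, LinearMap.add_apply, LinearMap.sub_apply,
      LinearMap.smul_apply, smul_eq_mul, h4, h5, ← h1]
    ring
  induction u using TensorProduct.induction_on with
  | zero => simp only [map_zero, LinearMap.zero_apply, add_zero]
  | add u u' hu hu' =>
    simp only [map_add, LinearMap.add_apply]
    rw [add_add_add_comm, hu, hu', add_zero]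
  | tmul X W =>
    induction v using TensorProduct.induction_on with
    | zero => simp only [map_zero, add_zero]
    | add u u' hu hu' =>
      simp only [map_add]
      rw [add_add_add_comm, hu, hu', add_zero]
    | tmul Y W' =>
      rw [auxT_tmul, auxT_tmul, prePair_tmul, prePair_tmul, ← add_smul, inv, zero_smul]

theorem pair_spec (u v : P.Fields) (n : ℕ) : ∃ M, ∀ a b, Near P.πF u.1 M a → Near P.πF v.1 M b →
    Near P.πS (P.pair u v).1 n (P.prePair a b) := extVal_spec P.contBil_prePair u v n

/-- The bracket with a linear observable acts on a pairing of formal fields by the Leibniz rule. -/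
theorem pb_lin_pair (Z : P.gDC) (u v : P.Fields) :
    P.pb (P.lin Z) (P.pair u v) = P.pair (P.opF Z u) v + P.pair u (P.opF Z v) := by
  refine Subtype.ext (funext fun n => ?_)
  obtain ⟨M₁, h₁⟩ := P.pb_spec (P.lin Z) (P.pair u v) n
  -- The precisions are chained: the outer bracket needs the pairing up to M₁, the outer pairings
  -- need the transformed fields up to M₃ and M₄. A single pair of representatives beyond the sum of
  -- all stages then reduces the claim to `pbS_prePair`.
  obtain ⟨M₂, h₂⟩ := P.pair_spec u v M₁
  obtain ⟨M₃, h₃⟩ := P.pair_spec (P.opF Z u) v n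
  obtain ⟨M₄, h₄⟩ := P.pair_spec u (P.opF Z v) n
  obtain ⟨M₅, h₅⟩ := extLin_spec (P.contLin_opT Z) u M₃
  obtain ⟨M₆, h₆⟩ := extLin_spec (P.contLin_opT Z) v M₄
  obtain ⟨a, ha⟩ := u.2 (M₂ + M₃ + M₄ + M₅ + M₆)
  obtain ⟨b, hb⟩ := v.2 (M₂ + M₃ + M₄ + M₅ + M₆)
  have ha : Near P.πF u.1 _ a := ha
  have hb : Near P.πF v.1 _ b := hb
  show (P.pb (P.lin Z) (P.pair u v)).1 n =
    (P.pair (P.opF Z u) v).1 n + (P.pair u (P.opF Z v)).1 n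
  rw [← h₁ _ _ (P.near_toShat _ M₁) (h₂ a b (ha.mono (by omega)) (hb.mono (by omega))) n le_rfl,
    ← h₃ _ b (h₅ a (ha.mono (by omega))) (hb.mono (by omega)) n le_rfl,
    ← h₄ a _ (ha.mono (by omega)) (h₆ b (hb.mono (by omega))) n le_rfl, pbS_prePair, map_add]

/-- The pairing of formal fields is invariant under the action on the auxiliary space. -/
theorem pair_auxF (A : D.Affine) (u v : P.Fields) :
    P.pair (P.auxF A u) v + P.pair u (P.auxF A v) = 0 := by
  refine Subtype.ext (funext fun n => ?_)
  obtain ⟨M₃, h₃⟩ := P.pair_spec (P.auxF A u) v n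
  obtain ⟨M₄, h₄⟩ := P.pair_spec u (P.auxF A v) n
  obtain ⟨M₅, h₅⟩ := extLin_spec (P.contLin_auxT A) u M₃
  obtain ⟨M₆, h₆⟩ := extLin_spec (P.contLin_auxT A) v M₄
  obtain ⟨a, ha⟩ := u.2 (M₃ + M₄ + M₅ + M₆)
  obtain ⟨b, hb⟩ := v.2 (M₃ + M₄ + M₅ + M₆)
  have ha : Near P.πF u.1 _ a := ha
  have hb : Near P.πF v.1 _ b := hb
  show (P.pair (P.auxF A u) v).1 n + (P.pair u (P.auxF A v)).1 n = 0
  rw [← h₃ _ b (h₅ a (ha.mono (by omega))) (hb.mono (by omega)) n le_rfl,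
    ← h₄ a _ (ha.mono (by omega)) (h₆ b (hb.mono (by omega))) n le_rfl, ← map_add,
    prePair_auxT, map_zero]

/-- Both composites are computed at each stage from one common representative, so an identity before
completion persists. -/
theorem extLin_comm {f g : P.FT →ₗ[ℂ] P.FT} (hf : ContLin P.πF P.πF f)
    (hg : ContLin P.πF P.πF g) (h : ∀ u, f (g u) = g (f u)) (u : P.Fields) :
    extLin hf (extLin hg u) = extLin hg (extLin hf u) := by
  refine Subtype.ext (funext fun n => ?_)
  obtain ⟨M₁, h₁⟩ := extLin_spec hf (extLin hg u) n
  obtain ⟨M₂, h₂⟩ := extLin_spec hg (extLin hf u) n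
  obtain ⟨M₃, h₃⟩ := extLin_spec hg u M₁
  obtain ⟨M₄, h₄⟩ := extLin_spec hf u M₂
  obtain ⟨a, ha⟩ := u.2 (M₃ + M₄)
  have ha : Near P.πF u.1 _ a := ha
  rw [← h₁ _ (h₃ a (ha.mono (by omega))) n le_rfl, ← h₂ _ (h₄ a (ha.mono (by omega))) n le_rfl, h]

/-- The two maps act on different tensor factors. -/
theorem opF_σF (Z : P.gDC) (u : P.Fields) : P.opF Z (P.σF u) = P.σF (P.opF Z u) := by
  refine P.extLin_comm _ _ (fun u => ?_) u
  induction u using TensorProduct.induction_on with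
  | zero => simp only [map_zero]
  | add u u' hu hu' => simp only [map_add, hu, hu']
  | tmul X W => rfl

/-- Both maps act on the auxiliary factor; σ is an automorphism fixing A, hence commutes with ad A.
This lets the twisted fields in the Hamiltonians transform like the untwisted ones. -/
theorem auxF_σF {A : D.Affine} (hA : D.σa A = A) (u : P.Fields) :
    P.auxF A (P.σF u) = P.σF (P.auxF A u) := by
  refine P.extLin_comm _ _ (fun u => ?_) u
  induction u using TensorProduct.induction_on with
  | zero => simp only [map_zero]
  | add u u' hu hu' => simp only [map_add, hu, hu']
  | tmul X W =>
    simp only [auxT_tmul, TensorProduct.map_tmul, LinearMap.id_apply, D.σa_lie, hA]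

end GaudinPoints

/-! ### Invariance of the canonical element -/

namespace DihedralLie

variable {T : ℕ} {𝔤 : Type*} [LieRing 𝔤] [LieAlgebra ℂ 𝔤] (D : DihedralLie T 𝔤)

/-- The linear map `x ↦ xₙ`. -/
def monL (n : ℤ) : 𝔤 →ₗ[ℂ] D.Affine where
  toFun := D.mon n
  map_add' x y := by apply affine_ext <;> simp [mon]
  map_smul' a x := by apply affine_ext <;> simp [mon]

@[simp] theorem monL_apply (n : ℤ) (x : 𝔤) : D.monL n x = D.mon n x := rfl

theorem lie_K (X : D.Affine) : ⁅X, D.K⁆ = 0 := by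
  rw [← lie_skew, K_lie, neg_zero]

/-! ### Dual bases and the adjoint action on the canonical element -/

section DualBases

variable {ι : Type*} [Fintype ι] [DecidableEq ι] (I : Module.Basis ι ℂ 𝔤)

/-- The basis dual to `I` for the invariant form. -/
abbrev dual : Module.Basis ι ℂ 𝔤 := LinearMap.BilinForm.dualBasis D.form D.form_nondegenerate I

theorem sum_form_basis_smul_dual (y : 𝔤) : ∑ a, D.form y (I a) • D.dual I a = y := by
  conv_rhs => rw [← (D.dual I).sum_repr y]
  exact Finset.sum_congr rfl fun a _ => by
    rw [LinearMap.BilinForm.dualBasis_repr_apply]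

/-- Symmetry of the form makes the pairings with the dual basis the coordinates in the original
basis. This and the previous expansion are what turn adjoint actions and cocycle terms into
coefficients. -/
theorem sum_form_dual_smul_basis (y : 𝔤) : ∑ a, D.form y (D.dual I a) • I a = y := by
  conv_rhs => rw [← I.sum_repr y]
  refine Finset.sum_congr rfl fun a _ => ?_
  congr 1
  conv_lhs => rw [← I.sum_repr y]
  rw [D.form_symm, map_sum, Finset.sum_eq_single a]
  · rw [map_smul, LinearMap.BilinForm.apply_dualBasis_left, if_pos rfl, smul_eq_mul, mul_one]
  · intro b _ hb
    rw [map_smul, LinearMap.BilinForm.apply_dualBasis_left, if_neg hb, smul_zero]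
  · simp

variable {ρ : ℂ →+* ℂ} {W : Type*} [AddCommGroup W] [Module ℂ W]

/-- Invariance of ∑ I_a ⊗ I^a under ad x, tested on ψ. In the double expansions the coefficients
⟨[x, I^a], I_b⟩ and ⟨[x, I_b], I^a⟩ are opposite, by invariance and skew-symmetry. The map ρ is left
free so that the linear modes and the anti-linear conjugate modes are treated together. -/
theorem sum_lie_basis_dual (ψ : 𝔤 →ₛₗ[ρ] 𝔤 →ₛₗ[ρ] W) (x : 𝔤) :
    ∑ a, ψ (I a) ⁅x, D.dual I a⁆ = -∑ a, ψ ⁅x, I a⁆ (D.dual I a) := by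
  have h1 : ∀ a, ψ (I a) ⁅x, D.dual I a⁆ =
      ∑ b, ρ (D.form ⁅x, D.dual I a⁆ (I b)) • ψ (I a) (D.dual I b) := fun a => by
    conv_lhs => rw [← D.sum_form_basis_smul_dual I ⁅x, D.dual I a⁆, map_sum]
    exact Finset.sum_congr rfl fun b _ => map_smulₛₗ _ _ _
  have h2 : ∀ a, ψ ⁅x, I a⁆ (D.dual I a) =
      ∑ b, ρ (D.form ⁅x, I a⁆ (D.dual I b)) • ψ (I b) (D.dual I a) := fun a => by
    conv_lhs => rw [← D.sum_form_dual_smul_basis I ⁅x, I a⁆, map_sum, LinearMap.sum_apply]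
    exact Finset.sum_congr rfl fun b _ => by rw [map_smulₛₗ, LinearMap.smul_apply]
  simp only [h1, h2]
  rw [Finset.sum_comm, ← Finset.sum_neg_distrib]
  refine Finset.sum_congr rfl fun b _ => ?_
  rw [← Finset.sum_neg_distrib]
  refine Finset.sum_congr rfl fun a _ => ?_
  rw [← neg_smul, ← map_neg, ← lie_skew, map_neg, LinearMap.neg_apply, D.form_invariant,
    D.form_symm]

/-- The Leibniz action of an element `B` of the affine algebra on a semi-bilinear map. -/
def leib (β : D.Affine →ₛₗ[ρ] D.Affine →ₛₗ[ρ] W) (B X Y : D.Affine) : W :=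
  β ⁅B, X⁆ Y + β X ⁅B, Y⁆

/-- The value of the Leibniz action of `B` on a truncation of the canonical element. -/
def leibCanon (β : D.Affine →ₛₗ[ρ] D.Affine →ₛₗ[ρ] W) (B : D.Affine) (k : ℕ) : W :=
  D.leib β B D.Dd D.K + D.leib β B D.K D.Dd + ∑ n ∈ Finset.Ioo (-(k : ℤ)) k,
    ∑ a, D.leib β B (D.mon (-n) (I a)) (D.mon n (D.dual I a))

variable (β : D.Affine →ₛₗ[ρ] D.Affine →ₛₗ[ρ] W)

/-- The sum `∑ₐ β([x, I_a]ₘ₋ₙ, (I^a)ₙ)`. -/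
def shiftTerm (m : ℤ) (x : 𝔤) (n : ℤ) : W :=
  ∑ a, β (D.mon (m - n) ⁅x, I a⁆) (D.mon n (D.dual I a))

/-- In the n-th layer, acting on the first factor gives the shifted sum at n. Acting on the second
factor gives, after moving ad x across the dual bases, minus the same sum at n + m, so that summing
over n telescopes. The cocycle contributes only in the layers n = m and n = -m. -/
theorem sum_leib_mon (m : ℤ) (x : 𝔤) (n : ℤ) :
    ∑ a, D.leib β (D.mon m x) (D.mon (-n) (I a)) (D.mon n (D.dual I a)) =
      D.shiftTerm I β m x n - D.shiftTerm I β m x (n + m) +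
      (if n = m then (m : ℂ) • β D.K (D.mon m x) else 0) +
      (if n = -m then (m : ℂ) • β (D.mon m x) D.K else 0) := by
  have e1 : ∑ a, β (D.mon (-n) (I a)) (D.mon (m + n) ⁅x, D.dual I a⁆) =
      -D.shiftTerm I β m x (n + m) := by
    -- Here ψ(x, y) = β(x₋ₙ, yₘ₊ₙ): ad x is moved from the dual basis to the basis with the loop
    -- degrees frozen.
    have h := D.sum_lie_basis_dual I ((β.comp (D.monL (-n))).compl₂ (D.monL (m + n))) x
    simp only [LinearMap.compl₂_apply, LinearMap.comp_apply, monL_apply] at h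
    rw [h, shiftTerm, show m - (n + m) = -n by ring, add_comm n m]
  -- Cocycle on the first factor: in the layer n = m the coefficients ⟨x, I_a⟩ reassemble x from the
  -- dual basis. The integer m passes unchanged through ρ.
  have e2 : ∑ a, β ((if m + -n = 0 then (m : ℂ) * D.form x (I a) else 0) • D.K)
      (D.mon n (D.dual I a)) = if n = m then (m : ℂ) • β D.K (D.mon m x) else 0 := by
    by_cases h : n = m
    · subst h
      rw [if_pos rfl]
      conv_rhs => rw [← D.sum_form_basis_smul_dual I x, ← monL_apply, map_sum, map_sum,
        Finset.smul_sum]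
      refine Finset.sum_congr rfl fun a _ => ?_
      rw [if_pos (by ring), map_smulₛₗ, LinearMap.smul_apply, map_smul, map_smulₛₗ, map_mul,
        map_intCast, mul_smul, monL_apply]
    · rw [if_neg h]
      refine Finset.sum_eq_zero fun a _ => ?_
      rw [if_neg (by omega), zero_smul, map_zero, LinearMap.zero_apply]
  -- Cocycle on the second factor: in the layer n = -m the coefficients ⟨x, I^a⟩ reassemble x from
  -- the original basis.
  have e3 : ∑ a, β (D.mon (-n) (I a))
      ((if m + n = 0 then (m : ℂ) * D.form x (D.dual I a) else 0) • D.K) =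
      if n = -m then (m : ℂ) • β (D.mon m x) D.K else 0 := by
    by_cases h : n = -m
    · subst h
      rw [if_pos rfl]
      conv_rhs => rw [← D.sum_form_dual_smul_basis I x, ← monL_apply, map_sum, map_sum,
        LinearMap.sum_apply, Finset.smul_sum]
      refine Finset.sum_congr rfl fun a _ => ?_
      rw [if_pos (by ring), map_smulₛₗ, map_smul, map_smulₛₗ, LinearMap.smul_apply, map_mul,
        map_intCast, mul_smul, monL_apply, neg_neg]
    · rw [if_neg h]
      refine Finset.sum_eq_zero fun a _ => ?_
      rw [if_neg (by omega), zero_smul, map_zero]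
  have e0 : ∑ a, β (D.mon (m + -n) ⁅x, I a⁆) (D.mon n (D.dual I a)) = D.shiftTerm I β m x n := by
    rw [← sub_eq_add_neg, shiftTerm]
  simp only [leib, lie_mon_mon, map_add, LinearMap.add_apply, Finset.sum_add_distrib, e0, e1, e2,
    e3]
  abel

/-- The sums over the window and over its translate by m differ only near the ends. Both are
compared with one window enlarged by |m|, and the omitted indices satisfy |n| ≥ k - |m| ≥ l + |m|,
which is where the bound l + 2|m| on k comes from. -/
theorem sum_sub_sum_shift_mem (N : Submodule ℂ W) (f : ℤ → W) (m : ℤ) (l k : ℕ)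
    (hk : l + 2 * m.natAbs ≤ k) (hf : ∀ n : ℤ, (l : ℤ) + m.natAbs ≤ |n| → f n ∈ N) :
    ∑ n ∈ Finset.Ioo (-(k : ℤ)) k, (f n - f (n + m)) ∈ N := by
  have h1 : ∑ n ∈ Finset.Ioo (-(k : ℤ)) k, f (n + m) =
      ∑ n ∈ Finset.Ioo (-(k : ℤ) + m) (k + m), f n := by
    rw [← Finset.map_add_right_Ioo, Finset.sum_map]
    rfl
  have h2 : ∀ s : Finset ℤ, s ⊆ Finset.Ioo (-(k : ℤ) - m.natAbs) (k + m.natAbs) →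
      (∀ n, n ∉ s → (l : ℤ) + m.natAbs ≤ |n|) →
      ∑ n ∈ Finset.Ioo (-(k : ℤ) - m.natAbs) (k + m.natAbs), f n - ∑ n ∈ s, f n ∈ N := by
    intro s hs hn
    rw [← Finset.sum_sdiff_eq_sub hs]
    exact Submodule.sum_mem _ fun n hns => hf n (hn n (Finset.mem_sdiff.1 hns).2)
  have h3 := h2 (Finset.Ioo (-(k : ℤ)) k) (Finset.Ioo_subset_Ioo (by omega) (by omega))
    fun n hn => by
      rw [Finset.mem_Ioo] at hn
      rw [le_abs]
      omega
  have h4 := h2 (Finset.Ioo (-(k : ℤ) + m) (k + m)) (Finset.Ioo_subset_Ioo (by omega) (by omega))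
    fun n hn => by
      rw [Finset.mem_Ioo] at hn
      rw [le_abs]
      omega
  rw [Finset.sum_sub_distrib, h1]
  have h5 := sub_mem h4 h3
  rwa [sub_sub_sub_cancel_left] at h5

/-- The canonical element of the affine algebra is invariant: the Leibniz action on its truncations
tends to zero. -/
theorem exists_leibCanon_mem (N : ℕ → Submodule ℂ W)
    (hβ : ∀ (l : ℕ) (n n' : ℤ) (x y : 𝔤), ((l : ℤ) ≤ n ∧ n' ≤ -l) ∨ (n ≤ -l ∧ (l : ℤ) ≤ n') →
      β (D.mon n x) (D.mon n' y) ∈ N l) (B : D.Affine) (l : ℕ) :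
    ∃ k₀, ∀ k, k₀ ≤ k → D.leibCanon I β B k ∈ N l := by
  induction B using D.affine_ind with
  | ha B B' h h' =>
    obtain ⟨k₀, h⟩ := h
    obtain ⟨k₁, h'⟩ := h'
    refine ⟨max k₀ k₁, fun k hk => ?_⟩
    have e : D.leibCanon I β (B + B') k = D.leibCanon I β B k + D.leibCanon I β B' k := by
      have e1 : ∀ X Y, D.leib β (B + B') X Y = D.leib β B X Y + D.leib β B' X Y := fun X Y => by
        simp only [leib, add_lie, map_add, LinearMap.add_apply]
        abel
      simp only [leibCanon, e1, Finset.sum_add_distrib]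
      abel
    rw [e]
    exact add_mem (h k (le_trans (le_max_left _ _) hk)) (h' k (le_trans (le_max_right _ _) hk))
  | hs c B h =>
    obtain ⟨k₀, h⟩ := h
    refine ⟨k₀, fun k hk => ?_⟩
    have e : D.leibCanon I β (c • B) k = ρ c • D.leibCanon I β B k := by
      have e1 : ∀ X Y, D.leib β (c • B) X Y = ρ c • D.leib β B X Y := fun X Y => by
        simp only [leib, smul_lie, map_smulₛₗ, LinearMap.smul_apply, smul_add]
      simp only [leibCanon, e1, smul_add, Finset.smul_sum]
    rw [e]
    exact Submodule.smul_mem _ _ (h k hk)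
  | hK =>
    refine ⟨0, fun k _ => ?_⟩
    simp only [leibCanon, leib, K_lie, map_zero, LinearMap.zero_apply, add_zero,
      Finset.sum_const_zero]
    exact zero_mem _
  | hD =>
    refine ⟨0, fun k _ => ?_⟩
    -- The tensor (I_a)₋ₙ ⊗ (I^a)ₙ has total degree -n + n = 0, so D kills each layer separately,
    -- without telescoping.
    simp only [leibCanon, leib, lie_K, Dd_lie_mon, lie_self, map_zero, LinearMap.zero_apply,
      map_smulₛₗ, LinearMap.smul_apply, map_intCast, map_neg, LinearMap.neg_apply,
      Int.cast_neg, neg_smul, neg_add_cancel,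
      add_zero, Finset.sum_const_zero]
    exact zero_mem _
  | hm m x =>
    -- Beyond the bound needed for telescoping, the extra 1 keeps n = ±m inside the open window even
    -- when m = l = 0, so both cocycle layers are counted.
    refine ⟨l + 2 * m.natAbs + 1, fun k hk => ?_⟩
    have hD : ⁅D.mon m x, D.Dd⁆ = -((m : ℂ) • D.mon m x) := by rw [← lie_skew, Dd_lie_mon]
    -- Since [x_m, D] = -m x_m, the terms D ⊗ K and K ⊗ D yield -m x_m ⊗ K and -m K ⊗ x_m,
    -- cancelling exactly the two cocycle layers.
    have e : D.leibCanon I β (D.mon m x) k = ∑ n ∈ Finset.Ioo (-(k : ℤ)) k,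
        (D.shiftTerm I β m x n - D.shiftTerm I β m x (n + m)) := by
      rw [leibCanon, Finset.sum_congr rfl fun n _ => D.sum_leib_mon I β m x n,
        Finset.sum_add_distrib, Finset.sum_add_distrib, Finset.sum_ite_eq', Finset.sum_ite_eq',
        if_pos (Finset.mem_Ioo.2 (by omega)), if_pos (Finset.mem_Ioo.2 (by omega))]
      simp only [leib, hD, lie_K, map_neg, LinearMap.neg_apply, map_zero, LinearMap.zero_apply,
        map_smulₛₗ, LinearMap.smul_apply, map_intCast]
      abel
    rw [e]
    refine sum_sub_sum_shift_mem (N l) _ m l k (by omega) fun n hn => ?_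
    -- For |n| ≥ l + |m| the degrees m - n and n have opposite signs and size at least l, as the
    -- two-sided filtration requires.
    refine Submodule.sum_mem _ fun a _ => hβ l _ _ _ _ ?_
    rw [le_abs] at hn
    omega

end DualBases

end DihedralLie

/-! ### Covariance of the formal fields -/

namespace GaudinPoints

variable {T : ℕ} [NeZero T] {𝔤 : Type*} [LieRing 𝔤] [LieAlgebra ℂ 𝔤] {D : DihedralLie T 𝔤}
  (P : GaudinPoints D) {ι : Type*} [Fintype ι] [DecidableEq ι] (I : Module.Basis ι ℂ 𝔤)

/-- If `Z` acts on the image of `M` as `B` and `A` acts on the image of `A₀` as `B`, then `Z` and `A`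
act oppositely on the image of the canonical element under `A₀ ⊗ M`. -/
theorem opF_canonField {ρ : ℂ →+* ℂ} (A₀ : D.Affine →ₛₗ[ρ] D.Affine) (M : D.Affine →ₛₗ[ρ] P.gDC)
    (h : ∀ (k : ℕ) (n : ℤ), (k : ℤ) ≤ |n| → P.canonTerm I A₀ M n ∈ P.FF k)
    (hF : ∀ (l : ℕ) (n n' : ℤ) (x y : 𝔤), ((l : ℤ) ≤ n ∧ n' ≤ -l) ∨ (n ≤ -l ∧ (l : ℤ) ≤ n') →
      A₀ (D.mon n x) ⊗ₜ M (D.mon n' y) ∈ P.FF l)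
    (A B : D.Affine) (Z : P.gDC) (hM : ∀ X, ⁅Z, M X⁆ = M ⁅B, X⁆)
    (hA : ∀ X, ⁅A, A₀ X⁆ = A₀ ⁅B, X⁆) :
    P.opF Z (P.canonField I A₀ M h) + P.auxF A (P.canonField I A₀ M h) = 0 := by
  -- A₀ and M are semilinear over the same ρ, so A₀ ⊗ M is a single semi-bilinear map and the
  -- invariance of the canonical element can be transported along it.
  let β : D.Affine →ₛₗ[ρ] D.Affine →ₛₗ[ρ] P.FT := LinearMap.mk₂'ₛₗ ρ ρ
    (fun X Y => A₀ X ⊗ₜ M Y)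
    (fun X X' Y => by rw [map_add, TensorProduct.add_tmul])
    (fun c X Y => by rw [map_smulₛₗ, TensorProduct.smul_tmul'])
    (fun X Y Y' => by rw [map_add, TensorProduct.tmul_add])
    (fun c X Y => by rw [map_smulₛₗ, TensorProduct.tmul_smul])
  -- The two intertwining hypotheses turn both actions into the action of `B` on the corresponding
  -- factor of the canonical element.
  have hsum : ∀ k, P.opT Z (P.canonSum I A₀ M k) + P.auxT A (P.canonSum I A₀ M k) =
      D.leibCanon I β B k := by
    intro k
    simp only [canonSum, canonTerm, map_add, map_sum, opT_tmul, auxT_tmul, hM, hA,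
      DihedralLie.leibCanon, DihedralLie.leib, Finset.sum_add_distrib]
    simp only [β, LinearMap.mk₂'ₛₗ_apply]
    abel
  refine Subtype.ext (funext fun n => ?_)
  obtain ⟨M₁, h₁⟩ := extLin_spec (P.contLin_opT Z) (P.canonField I A₀ M h) n
  obtain ⟨M₂, h₂⟩ := extLin_spec (P.contLin_auxT A) (P.canonField I A₀ M h) n
  obtain ⟨k₀, hk⟩ := D.exists_leibCanon_mem I β P.FF hF B n
  -- The truncation at a given stage represents the field up to that stage, because the omitted
  -- layers lie in the filtration. Truncating also beyond k₀ makes the defect of invariance vanish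
  -- modulo stage n.
  have hnear : Near P.πF (P.canonField I A₀ M h).1 (M₁ + M₂ + k₀)
      (P.canonSum I A₀ M (M₁ + M₂ + k₀)) := fun k hk => by
    show _ = P.πF k (P.canonSum I A₀ M k)
    rw [← sub_eq_zero, ← map_sub, πF_eq_zero, canonSum, canonSum, add_sub_add_left_eq_sub,
      ← Finset.sum_sdiff_eq_sub (Finset.Ioo_subset_Ioo (by omega) (by omega))]
    refine Submodule.sum_mem _ fun n hn => h k n ?_
    rw [Finset.mem_sdiff, Finset.mem_Ioo, Finset.mem_Ioo] at hn
    rw [le_abs]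
    omega
  show (extLin (P.contLin_opT Z) (P.canonField I A₀ M h)).1 n +
    (extLin (P.contLin_auxT A) (P.canonField I A₀ M h)).1 n = 0
  rw [← h₁ _ (hnear.mono (by omega)) n le_rfl, ← h₂ _ (hnear.mono (by omega)) n le_rfl,
    ← map_add, hsum, πF_eq_zero]
  exact hk _ (by omega)

theorem opF_fieldAt (i : Option ℂ) (p : ℕ) (A : D.Affine) (Z : P.gDC)
    (hM : ∀ X, ⁅Z, P.mode i p X⁆ = P.mode i p ⁅A, X⁆) :
    P.opF Z (P.fieldAt I i p) + P.auxF A (P.fieldAt I i p) = 0 := by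
  refine P.opF_canonField I LinearMap.id (P.mode i p) (P.canonTerm_mode I i p) ?_ A A Z hM
    fun _ => rfl
  rintro l n n' x y (⟨h, h'⟩ | ⟨h, h'⟩)
  · have h2 := mon_mem_F_neg (D := D) (n := -n') (k := l) (by omega) y
    rw [neg_neg] at h2
    exact P.tmul_mem_FF (mon_mem_F_one h x) (P.mode_mem_FD i p h2)
  · have h2 := mon_mem_F_neg (D := D) (n := -n) (k := l) (by omega) x
    rw [neg_neg] at h2
    exact P.tmul_mem_FF' h2 (P.mode_mem_FD i p (mon_mem_F_one h' y))

/-- Here A₀ = τ and the conjugate modes are both anti-linear. The intermediate element is B = τA,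
since τ[τA, X] = [A, τX] by τ² = 1. -/
theorem opF_fieldBarAt (i : Option ℂ) (p : ℕ) (A : D.Affine) (Z : P.gDC)
    (hM : ∀ X, ⁅Z, P.modeBar i p X⁆ = P.modeBar i p ⁅D.τa A, X⁆) :
    P.opF Z (P.fieldBarAt I i p) + P.auxF A (P.fieldBarAt I i p) = 0 := by
  refine P.opF_canonField I D.τa (P.modeBar i p) (P.canonTerm_modeBar I i p) ?_ A (D.τa A) Z hM
    fun X => by rw [D.τa_lie, D.τa_τa]
  rintro l n n' x y (⟨h, h'⟩ | ⟨h, h'⟩)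
  · have h2 := mon_mem_F_neg (D := D) (n := -n') (k := l) (by omega) y
    rw [neg_neg] at h2
    exact P.tmul_mem_FF' (D.τa_mem_F (mon_mem_F_one h x))
      (P.modeBar_mem_FD i p (by exact h2))
  · have h2 := mon_mem_F_neg (D := D) (n := -n) (k := l) (by omega) x
    rw [neg_neg] at h2
    have h3 := D.τa_mem_F h2
    rw [neg_neg] at h3
    exact P.tmul_mem_FF h3 (P.modeBar_mem_FD i p (by rw [neg_neg]; exact mon_mem_F_one h' y))

end GaudinPoints

/-! ### The diagonal action of the constraints and of the momentum -/

namespace DihedralLie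

variable {T : ℕ} [NeZero T] {𝔤 : Type*} [LieRing 𝔤] [LieAlgebra ℂ 𝔤] (D : DihedralLie T 𝔤)

/-- The dihedral relation τστσ = 1 applied to a fixed vector of σ gives τστA = A. -/
theorem σa_τa_of_fixed {A : D.Affine} (hA : D.σa A = A) : D.σa (D.τa A) = D.τa A := by
  have h := D.τa_σa_τa_σa A
  rw [hA] at h
  conv_rhs => rw [← h, τa_τa]

theorem ptAct_r (k : ZMod T) (x : ℂ) : D.ptAct (.r k) x = D.ω ^ k.val * x := by
  show (LinearMap.mulLeft ℝ D.ω ^ k.val) x = _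
  rw [LinearMap.pow_mulLeft, LinearMap.mulLeft_apply]

/-- A non-trivial rotation fixes no finite point but 0, and 0 is fixed by every reflection as well.
-/
theorem exists_sr_mem_stab {x : ℂ} (h : D.stab (some x) ≠ ⊥) :
    ∃ k, DihedralGroup.sr k ∈ D.stab (some x) := by
  obtain ⟨α, hα, h1⟩ := (Subgroup.bot_or_exists_ne_one _).resolve_left h
  rcases α with k | k
  · have h2 : D.ω ^ k.val * x = x := (D.ptAct_r k x).symm.trans hα
    have hk : k.val ≠ 0 := fun h0 => h1 (by rw [(ZMod.val_eq_zero k).1 h0]; rfl)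
    have h3 := D.isPrimitiveRoot_ω.pow_ne_one_of_pos_of_lt hk k.val_lt
    have hx : x = 0 := by
      by_contra hx
      exact h3 (mul_right_cancel₀ hx (h2.trans (one_mul x).symm))
    -- At the origin any reflection serves, the action being by real linear maps.
    refine ⟨0, ?_⟩
    show D.ptAct _ x = x
    rw [hx, map_zero]
  · exact ⟨k, hα⟩

theorem avg_of_stab_eq_bot {i : Option ℂ} (h : D.stab i = ⊥) (p : ℕ) (X : D.Affine) :
    D.avg i p X = X := by
  classical
  have hs : (Finset.univ.filter fun α => α ∈ D.stab i) = {1} := by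
    ext α
    simp [h, Subgroup.mem_bot]
  rw [avg, hs, Finset.sum_singleton, h, map_one, LinearMap.smul_apply, Module.End.one_apply]
  simp

/-- The combination extracts twice the complex linear part: rotations act linearly and fix A in
ε-degree 0, while reflections act anti-linearly and drop out. -/
theorem rep_sub_of_fixed (i : Option ℂ) {A : D.Affine} (hA : D.σa A = A) (α : DihedralGroup T) :
    D.rep i 0 α A - Complex.I • D.rep i 0 α (Complex.I • A) =
      match α with
      | .r _ => (2 : ℂ) • A
      | .sr _ => 0 := by
  rcases α with k | k
  · rw [rep_r, rep_r, σa_iter_smul, Function.iterate_fixed hA, pow_zero, one_pow, one_smul,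
      one_smul, smul_smul, Complex.I_mul_I]
    simp only
    module
  · rw [rep_sr, rep_sr, σa_iter_smul, Function.iterate_fixed hA, pow_zero, one_pow, one_smul,
      one_smul, map_smulₛₗ, smul_smul]
    simp

/-- Multiplication by a reflection of the stabiliser exchanges its rotations and reflections, so
exactly half its elements are rotations, each contributing 2A. -/
theorem sum_stab_of_fixed {x : ℂ} (h : D.stab (some x) ≠ ⊥) {A : D.Affine} (hA : D.σa A = A)
    (s : Finset (DihedralGroup T)) (hs : ∀ α, α ∈ s ↔ α ∈ D.stab (some x)) :
    ∑ α ∈ s, (D.rep (some x) 0 α A - Complex.I • D.rep (some x) 0 α (Complex.I • A)) =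
      (s.card : ℂ) • A := by
  obtain ⟨k, hk⟩ := D.exists_sr_mem_stab h
  set c : DihedralGroup T → D.Affine := fun α =>
    D.rep (some x) 0 α A - Complex.I • D.rep (some x) 0 α (Complex.I • A) with hc
  have h1 : ∑ α ∈ s, c α = ∑ α ∈ s, c (.sr k * α) := by
    refine (Finset.sum_bij (fun β _ => DihedralGroup.sr k * β) (fun β hβ => ?_)
      (fun β _ γ _ h => mul_left_cancel h) (fun β hβ => ?_) fun β _ => rfl).symm
    · rw [hs] at hβ ⊢
      exact mul_mem hk hβ
    · rw [hs] at hβ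
      exact ⟨(DihedralGroup.sr k)⁻¹ * β, (hs _).2 (mul_mem (inv_mem hk) hβ),
        mul_inv_cancel_left _ _⟩
  have h2 : ∀ α, c α + c (.sr k * α) = (2 : ℂ) • A := by
    rintro (j | j)
    · simp only [hc, rep_sub_of_fixed D _ hA, DihedralGroup.sr_mul_r, add_zero]
    · simp only [hc, rep_sub_of_fixed D _ hA, DihedralGroup.sr_mul_sr, zero_add]
  -- Adding the sum to its reindexed copy makes each summand equal to 2A, without counting rotations
  -- explicitly.
  have h3 : (2 : ℂ) • ∑ α ∈ s, c α = (2 : ℂ) • ((s.card : ℂ) • A) := by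
    rw [two_smul]
    nth_rewrite 2 [h1]
    rw [← Finset.sum_add_distrib, Finset.sum_congr rfl fun α _ => h2 α, Finset.sum_const,
      ← Nat.cast_smul_eq_nsmul ℂ, smul_comm]
  exact smul_right_injective _ (two_ne_zero (α := ℂ)) h3

/-- At finite points, the complex linear part of the projection to the invariants of the stabiliser,
normalised as in the definition of the modes, fixes the invariants of `σ`. -/
theorem nrm_smul_avg_of_fixed (x : ℂ) {A : D.Affine} (hA : D.σa A = A) :
    GaudinPoints.nrm D (some x) •
      (D.avg (some x) 0 A - Complex.I • D.avg (some x) 0 (Complex.I • A)) = A := by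
  classical
  by_cases h : D.stab (some x) = ⊥
  · rw [GaudinPoints.nrm, if_pos h, D.avg_of_stab_eq_bot h, D.avg_of_stab_eq_bot h, smul_smul,
      Complex.I_mul_I]
    module
  · rw [GaudinPoints.nrm, if_neg h, one_smul]
    simp only [avg, LinearMap.smul_apply, LinearMap.sum_apply]
    rw [smul_comm Complex.I, ← smul_sub, Finset.smul_sum, ← Finset.sum_sub_distrib,
      D.sum_stab_of_fixed h hA _ (fun α => by simp), ← Complex.coe_smul, smul_smul]
    have hcard : (Finset.univ.filter fun α => α ∈ D.stab (some x)).card =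
        Nat.card (D.stab (some x)) := by
      rw [Nat.card_eq_fintype_card, Fintype.card_subtype]
    have h0 : (Nat.card (D.stab (some x)) : ℂ) ≠ 0 := Nat.cast_ne_zero.2 Nat.card_pos.ne'
    rw [hcard]
    push_cast
    rw [inv_mul_cancel₀ h0, one_smul]

end DihedralLie

/-! ### The diagonal embedding of the σ-invariants -/

namespace GaudinPoints

variable {T : ℕ} [NeZero T] {𝔤 : Type*} [LieRing 𝔤] [LieAlgebra ℂ 𝔤] {D : DihedralLie T 𝔤}
  (P : GaudinPoints D)

/-- The diagonal embedding of the `σ`-invariants, `A ↦ ∑_x A^(x)_0 + ∑_x (τ A)^(x̄)_0`. -/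
def diag (A : D.Affine) : P.gDC :=
  ∑ x ∈ P.z, P.mode (some x) 0 A + ∑ x ∈ P.zc, P.modeBar (some x) 0 (D.τa A)

theorem mem_zc {x : ℂ} : x ∈ P.zc ↔ x ∈ P.z ∧ D.stab (some x) = ⊥ := by
  classical
  rw [zc, Finset.mem_filter]

theorem diag_smul (a : ℂ) (A : D.Affine) : P.diag (a • A) = a • P.diag A := by
  simp only [diag, map_smul, map_smulₛₗ, Complex.conj_conj, smul_add, Finset.smul_sum]

/-- The minus sign in τA = -A absorbs the relative sign between the points and their conjugates. -/
theorem preMomentum_eq {A : D.Affine} (hA : D.τa A = -A) :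
    P.preMomentum A = -Complex.I • P.diag A := by
  rw [preMomentum, diag, hA]
  simp only [map_neg, Finset.sum_neg_distrib]
  module

theorem preK_eq : P.preK = -Complex.I • P.diag D.K := P.preMomentum_eq D.τa_K

theorem preC_eq {y : 𝔤} (hy : D.τ y = y) (n : ℤ) : P.preC y n = P.diag (D.mon n y) := by
  rw [preC, diag, D.τa_mon, hy]

theorem mult_pos {x : ℂ} (hx : x ∈ P.z) : 0 < P.mult (some x) := (P.mult_fin x).2 hx

/-- With no reflection in the stabiliser there is no anti-linear part. So a conjugate mode at such a
point is invisible to `phi`, and the modes at x and x̄ are separated. -/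
theorem nrm_smul_avg_add {i : Option ℂ} (h : D.stab i = ⊥) (A : D.Affine) (p : ℕ) :
    nrm D i • (D.avg i p A + Complex.I • D.avg i p (Complex.I • A)) = 0 := by
  rw [D.avg_of_stab_eq_bot h, D.avg_of_stab_eq_bot h, smul_smul, Complex.I_mul_I]
  module

theorem phi_mode_of_fixed {A : D.Affine} (hA : D.σa A = A) {x : ℂ} (q : Fin (P.mult (some x)))
    (y : ℂ) : P.phi (some x) q (P.mode (some y) 0 A) =
      if x = y then if (q : ℕ) = 0 then A else 0 else 0 := by
  classical
  rw [phi_mode]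
  by_cases h : x = y
  · subst h
    by_cases hq : (q : ℕ) = 0
    · rw [if_pos ⟨rfl, hq, by simp⟩, if_pos rfl, if_pos hq, D.nrm_smul_avg_of_fixed x hA]
    · rw [if_neg (fun h => hq h.2.1), if_pos rfl, if_neg hq]
  · rw [if_neg (fun h' => h (Option.some_injective _ h'.1)), if_neg h]

theorem phi_modeBar_of_stab_eq_bot (A : D.Affine) {x y : ℂ} (q : Fin (P.mult (some x)))
    (h : x = y → D.stab (some y) = ⊥) : P.phi (some x) q (P.modeBar (some y) 0 A) = 0 := by
  classical
  rw [phi_modeBar]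
  by_cases h' : x = y
  · rw [nrm_smul_avg_add (h h'), ite_self]
  · exact if_neg fun h'' => h' (Option.some_injective _ h''.1)

/-- Only the mode at x itself contributes: other points have other coefficients, and conjugate modes
occur only at points with trivial stabiliser, where `phi` does not see them. -/
theorem phi_diag {A : D.Affine} (hA : D.σa A = A) {x : ℂ} (hx : x ∈ P.z)
    (q : Fin (P.mult (some x))) :
    P.phi (some x) q (P.diag A) = if (q : ℕ) = 0 then A else 0 := by
  rw [diag, map_add, map_sum, map_sum,
    Finset.sum_congr rfl fun y _ => P.phi_mode_of_fixed hA q y,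
    Finset.sum_eq_zero (s := P.zc) fun y hy => P.phi_modeBar_of_stab_eq_bot _ q
      fun _ => (P.mem_zc.1 hy).2,
    add_zero, Finset.sum_ite_eq, if_pos hx]

/-- Conjugation exchanges modes and conjugate modes. At a point with trivial stabiliser the former
modes thus become invisible, and the conjugate part contributes τA, which is again σ-invariant. -/
theorem phi_conjD_diag {A : D.Affine} (hA : D.σa A = A) {x : ℂ} (hx : x ∈ P.zc)
    (q : Fin (P.mult (some x))) :
    P.phi (some x) q (P.conjD (P.diag A)) = if (q : ℕ) = 0 then D.τa A else 0 := by
  simp only [diag, map_add, map_sum, ← modeBar_def]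
  simp only [modeBar_def P _ _ (D.τa A), conjD_conjD]
  rw [Finset.sum_eq_zero (s := P.z) fun y _ => P.phi_modeBar_of_stab_eq_bot _ q
      fun h => h ▸ (P.mem_zc.1 hx).2,
    Finset.sum_congr rfl fun y _ => P.phi_mode_of_fixed (D.σa_τa_of_fixed hA) q y,
    zero_add, Finset.sum_ite_eq, if_pos hx]

/-- The bracket with a mode at x depends only on the ε-coefficients of Z at x; when these are
concentrated in ε⁰, the degree p is not shifted. -/
theorem lie_mode_of_phi {x : ℂ} (hx : x ∈ P.z) {Z : P.gDC} {A : D.Affine}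
    (h : ∀ q : Fin (P.mult (some x)), P.phi (some x) q Z = if (q : ℕ) = 0 then A else 0)
    (p : ℕ) (X : D.Affine) : ⁅Z, P.mode (some x) p X⁆ = P.mode (some x) p ⁅A, X⁆ := by
  rw [P.lie_mode (by simp), Finset.sum_eq_single ⟨0, P.mult_pos hx⟩]
  · rw [h, if_pos rfl, zero_add]
  · intro q _ hq
    rw [h, if_neg fun h0 => hq (Fin.ext h0), zero_lie, map_zero]
  · simp

theorem lie_diag_mode {A : D.Affine} (hA : D.σa A = A) {x : ℂ} (hx : x ∈ P.z) (p : ℕ)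
    (X : D.Affine) : ⁅P.diag A, P.mode (some x) p X⁆ = P.mode (some x) p ⁅A, X⁆ :=
  P.lie_mode_of_phi hx (P.phi_diag hA hx) p X

theorem lie_diag_modeBar {A : D.Affine} (hA : D.σa A = A) {x : ℂ} (hx : x ∈ P.zc) (p : ℕ)
    (X : D.Affine) : ⁅P.diag A, P.modeBar (some x) p X⁆ = P.modeBar (some x) p ⁅D.τa A, X⁆ := by
  rw [modeBar_def, modeBar_def,
    ← P.lie_mode_of_phi (P.mem_zc.1 hx).1 (P.phi_conjD_diag hA hx), conjD_lie, conjD_conjD]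

/-- Acting by ad A at each point and by ad τA at each conjugate point is compatible with brackets
because τ is one; this yields the brackets of the momentum with the constraints. -/
theorem lie_diag_diag {A : D.Affine} (hA : D.σa A = A) (B : D.Affine) :
    ⁅P.diag A, P.diag B⁆ = P.diag ⁅A, B⁆ := by
  rw [diag.eq_1 P B, lie_add, lie_sum, lie_sum, diag.eq_1 P ⁅A, B⁆, D.τa_lie]
  congr 1
  · exact Finset.sum_congr rfl fun x hx => P.lie_diag_mode hA hx 0 B
  · exact Finset.sum_congr rfl fun x hx => P.lie_diag_modeBar hA hx 0 (D.τa B)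

/-- Here εᵖ = 0 in the truncated polynomial algebra at this point. -/
theorem mode_eq_zero_of_le {i : Option ℂ} {p : ℕ} (h : P.mult i ≤ p) (X : D.Affine) :
    P.mode i p X = 0 := by
  classical
  have h0 : ∀ X, P.realElt i p X = 0 := fun X =>
    Subtype.ext (funext fun j => funext fun q => by
      rw [realElt_apply, if_neg]
      · rfl
      · rintro ⟨rfl, hq, _⟩
        omega)
  have ht : ∀ u, P.tm u 0 = 0 := fun u => TensorProduct.tmul_zero _ u
  rw [mode_def, h0, h0, ht, ht, sub_zero, smul_zero]

/-! ### Commutation with the Hamiltonians -/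

section Hamiltonians

variable {ι : Type*} [Fintype ι] [DecidableEq ι] (I : Module.Basis ι ℂ 𝔤)

/-- The formal fields on which the diagonal element `diag A` acts opposite to `A`. -/
def covariant (A : D.Affine) : Submodule ℂ P.Fields := LinearMap.ker (P.opF (P.diag A) + P.auxF A)

theorem mem_covariant {A : D.Affine} {u : P.Fields} :
    u ∈ P.covariant A ↔ P.opF (P.diag A) u + P.auxF A u = 0 := Iff.rfl

theorem field_mem_covariant {A : D.Affine} (hA : D.σa A = A) (y : ℂ) (p : ℕ) :
    P.field I y p ∈ P.covariant A := by
  rw [field]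
  split_ifs with h h'
  · exact P.mem_covariant.2 (P.opF_fieldAt I _ p A _ (P.lie_diag_mode hA h p))
  · exact P.mem_covariant.2
      (P.opF_fieldBarAt I _ p A _ (P.lie_diag_modeBar hA (P.mem_zc.2 h') p))
  · exact zero_mem _

theorem fieldInf_mem_covariant (hinf : P.mult none = 1) (A : D.Affine) (q : ℕ) :
    P.fieldInf I (q + 1) ∈ P.covariant A := by
  refine P.mem_covariant.2 (P.opF_fieldAt I _ _ A _ fun X => ?_)
  -- The only use of n_∞ = 1: the modes of degree q + 1 ≥ 1 at infinity are zero, so they intertwine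
  -- any two actions.
  rw [P.mode_eq_zero_of_le (by omega), P.mode_eq_zero_of_le (by omega), lie_zero]

theorem σF_iterate_mem_covariant {A : D.Affine} (hA : D.σa A = A) {u : P.Fields}
    (hu : u ∈ P.covariant A) (j : ℕ) : P.σF^[j] u ∈ P.covariant A := by
  induction j with
  | zero => exact hu
  | succ j ih =>
    rw [Function.iterate_succ_apply']
    rw [mem_covariant] at ih ⊢
    rw [opF_σF, P.auxF_σF hA, ← map_add, ih, map_zero]

/-- The observables which Poisson commute with `diag A`. -/
def centralizer (A : D.Affine) : Submodule ℂ P.Shat := LinearMap.ker (P.pb (P.lin (P.diag A)))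

/-- By the Leibniz rule and covariance of both fields, the bracket is minus the action of A on the
two auxiliary factors, which vanishes by invariance of the pairing. -/
theorem pair_mem_centralizer {A : D.Affine} {u v : P.Fields} (hu : u ∈ P.covariant A)
    (hv : v ∈ P.covariant A) : P.pair u v ∈ P.centralizer A := by
  have h := P.pair_auxF A u v
  have h1 : P.pair (P.opF (P.diag A) u) v + P.pair (P.auxF A u) v = 0 := by
    rw [← LinearMap.map_add₂, P.mem_covariant.1 hu, map_zero, LinearMap.zero_apply]
  have h2 : P.pair u (P.opF (P.diag A) v) + P.pair u (P.auxF A v) = 0 := by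
    rw [← map_add, P.mem_covariant.1 hv, map_zero]
  rw [centralizer, LinearMap.mem_ker, pb_lin_pair]
  linear_combination h1 + h2 - h

/-- All quadratic Gaudin Hamiltonians Poisson commute with the diagonal elements attached to the
invariants of `σ`. -/
theorem gaudinHams_subset_centralizer (hinf : P.mult none = 1) {A : D.Affine} (hA : D.σa A = A)
    {h : P.Shat} (hh : h ∈ P.gaudinHams I) : h ∈ P.centralizer A := by
  -- The scalar coefficients play no role: each Hamiltonian is a combination of pairings of
  -- covariant fields, some of them twisted by powers of σ.
  have hf := P.field_mem_covariant I hA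
  have hi := P.fieldInf_mem_covariant I hinf A
  rcases hh with (⟨x, -, p, rfl⟩ | ⟨p, rfl⟩) | ⟨q, rfl⟩
  · refine add_mem (sub_mem ?_ (Submodule.smul_mem _ _ ?_)) (Submodule.smul_mem _ _ ?_)
    · exact sum_mem fun j _ => sum_mem fun q _ => sum_mem fun s _ => Submodule.smul_mem _ _
        (P.pair_mem_centralizer (hf _ _) (P.σF_iterate_mem_covariant hA (hf _ _) _))
    · exact sum_mem fun q _ => sum_mem fun s _ => Submodule.smul_mem _ _
        (P.pair_mem_centralizer (hf _ _) (hi _))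
    · exact sum_mem fun q _ => P.pair_mem_centralizer (hf _ _) (hf _ _)
  · refine add_mem (sub_mem ?_ ?_) (Submodule.smul_mem _ _ ?_)
    · exact sum_mem fun j _ => sum_mem fun q _ => sum_mem fun s _ => Submodule.smul_mem _ _
        (P.pair_mem_centralizer (hf _ _) (hf _ _))
    · exact sum_mem fun q _ => P.pair_mem_centralizer (hf _ _) (hi _)
    · exact sum_mem fun q _ => P.pair_mem_centralizer (hf _ _) (hf _ _)
  · refine add_mem (sub_mem (neg_mem ?_) ?_) (Submodule.smul_mem _ _ ?_)
    · exact sum_mem fun j _ => sum_mem fun q _ => sum_mem fun s _ => Submodule.smul_mem _ _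
        (P.pair_mem_centralizer (hf _ _) (hi _))
    · exact sum_mem fun q _ => P.pair_mem_centralizer (hf _ _) (hi _)
    · exact sum_mem fun q _ => P.pair_mem_centralizer (hi _) (hi _)

theorem pb_lin_diag_eq_zero {A : D.Affine} {h : P.Shat} (hh : h ∈ P.centralizer A) (a : ℂ) :
    P.pb h (P.lin (a • P.diag A)) = 0 := by
  rw [lin_smul, map_smul, pb_skew, LinearMap.mem_ker.1 hh, neg_zero, smul_zero]

end Hamiltonians

/-! ### Brackets of the momentum with the constraints -/

theorem pb_momentum_preK : P.pb P.momentum (P.lin P.preK) = 0 := by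
  rw [momentum, pb_lin_lin, P.preMomentum_eq D.τa_Dd, preK_eq, smul_lie, lie_smul,
    P.lie_diag_diag D.σa_Dd, D.lie_K, ← zero_smul ℂ (0 : D.Affine), diag_smul, zero_smul,
    smul_zero, smul_zero, lin, map_zero, map_zero]

theorem pb_momentum_preC {y : 𝔤} (hy : D.τ y = y) (n : ℤ) :
    P.pb P.momentum (P.lin (P.preC y n)) = (-Complex.I * n) • P.lin (P.preC y n) := by
  rw [momentum, pb_lin_lin, P.preMomentum_eq D.τa_Dd, P.preC_eq hy, smul_lie,
    P.lie_diag_diag D.σa_Dd, D.Dd_lie_mon, diag_smul, smul_smul, lin_smul]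

end GaudinPoints

end DihedralGaudin

end

theorem mainTheorem11 {T : ℕ} [NeZero T] {𝔤 : Type*} [LieRing 𝔤] [LieAlgebra ℂ 𝔤]
    (D : DihedralGaudin.DihedralLie T 𝔤) (P : DihedralGaudin.GaudinPoints D)
    {ι : Type*} [Fintype ι] [DecidableEq ι] (I : Module.Basis ι ℂ 𝔤)
    {κ : Type*} (I0 : Module.Basis κ ℝ (DihedralGaudin.GaudinPoints.fixedPart D))
    (hinf : P.mult none = 1) :
    (∃ hP : P.momentum ∈ P.Nhat I0, ∀ h ∈ P.gaudinHams I, ∃ hh : h ∈ P.Nhat I0,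
      P.redPb I0 (P.toRed I0 h hh) (P.toRed I0 P.momentum hP) = 0) ∧
    (∀ h ∈ P.gaudinHams I,
      P.pb h (P.lin P.preK) = 0 ∧
      (∀ (α : κ) (n : ℤ), P.pb h (P.lin (P.preC (I0 α) n)) = 0) ∧
      P.pb h P.momentum = 0) ∧
    P.pb P.momentum (P.lin P.preK) = 0 ∧
    ∀ (α : κ) (n : ℤ), P.pb P.momentum (P.lin (P.preC (I0 α) n)) =
      (-Complex.I * n) • P.lin (P.preC (I0 α) n) := by
  have hham : ∀ h ∈ P.gaudinHams I, P.pb h (P.lin P.preK) = 0 ∧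
      (∀ (α : κ) (n : ℤ), P.pb h (P.lin (P.preC (I0 α) n)) = 0) ∧ P.pb h P.momentum = 0 := by
    intro h hh
    refine ⟨?_, fun α n => ?_, ?_⟩
    · rw [P.preK_eq]
      exact P.pb_lin_diag_eq_zero (P.gaudinHams_subset_centralizer I hinf D.σa_K hh) _
    · rw [P.preC_eq (I0 α).2.2, ← one_smul ℂ (P.diag _)]
      exact P.pb_lin_diag_eq_zero (P.gaudinHams_subset_centralizer I hinf
        (by rw [D.σa_mon, (I0 α).2.1]) hh) _
    · rw [DihedralGaudin.GaudinPoints.momentum, P.preMomentum_eq D.τa_Dd]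
      exact P.pb_lin_diag_eq_zero (P.gaudinHams_subset_centralizer I hinf D.σa_Dd hh) _
  have hK := P.pb_momentum_preK
  have hC : ∀ (α : κ) (n : ℤ), P.pb P.momentum (P.lin (P.preC (I0 α) n)) =
      (-Complex.I * n) • P.lin (P.preC (I0 α) n) := fun α n => P.pb_momentum_preC (I0 α).2.2 n
  -- The momentum sends each mode of the constraint to a multiple of itself, which stays in the
  -- completed ideal though it need not vanish.
  have hP : P.momentum ∈ P.Nhat I0 := by
    refine P.mem_Nhat_of_generators I0 ?_ fun α n => ?_
    · rw [hK]
      exact zero_mem _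
    · rw [hC, Algebra.smul_def]
      exact Ideal.mul_mem_left _ _ (P.lin_preC_mem_Jhat I0 α n)
  refine ⟨⟨hP, fun h hh => ?_⟩, hham, hK, hC⟩
  obtain ⟨h1, h2, h3⟩ := hham h hh
  refine ⟨P.mem_Nhat_of_generators I0 ?_ fun α n => ?_, ?_⟩
  · rw [h1]
    exact zero_mem _
  · rw [h2]
    exact zero_mem _
  · rw [P.redPb_toRed]
    -- The reduced bracket is the class of the bracket of representatives, which already vanishes
    -- before reduction.
    refine Ideal.Quotient.eq_zero_iff_mem.2 ?_
    show P.pb h P.momentum ∈ P.Jhat I0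
    rw [h3]
    exact zero_mem _
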